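/- **Conventions.** Let $d,s\ge 1$ be integers, $|x|=\max_i|x_i|$ on $\mathbb R^d$, and $\langle g,f\rangle=\int\bar g f$ on $L^2(\mathbb R^d)$ (real or complex scalars). Let $\Omega=(\{0,1\}^d)^{\mathbb Z}$ carry the probability measure under which the coordinates $\omega_j$ are independent and uniformly distributed on $\{0,1\}^d$, with expectation $\mathbb E_\omega$. For $\omega\in\Omega$ let $\mathscr D^\omega$ be the system of the cubes $I=2^{-k}([0,1)^d+l)+t_k$, where $k\in\mathbb Z$, $l\in\mathbb Z^d$, $t_k=\sum_{j>k}2^{-j}\omega_j$; write $\ell(I)=2^{-k}$, and let $mI$ be the cube with the same centre and side length $m\,\ell(I)$. *Wavelets.* Fix $m\ge1$ and $C$. Let $\psi^\eta$, $\eta\in\{0,1\}^d\setminus\{0\}$, be functions such that for every $\omega$ the functions $\psi_I^\eta(x)=2^{dk/2}\psi^\eta(2^k(x-t_k)-l)$, $I\in\mathscr D^\omega$, form a wavelet system with parameters $(m,s,s-1)$: they are an orthonormal basis of $L^2(\mathbb R^d)$; $\psi_I^\eta$ vanishes outside $mI$; $\psi_I^\eta$ is $s$ times differentiable with $|\partial^\alpha\psi_I^\eta|\le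 C\,\ell(I)^{-|\alpha|}|I|^{-1/2}$ for $|\alpha|\le s$; and $\int x^\alpha\psi_I^\eta(x)\,dx=0$ for $|\alpha|\le s-1$. *Shifts.* A good wavelet shift with parameters $(i,j)$ on $\mathscr D^\omega$ is a bounded operator $S$ on $L^2(\mathbb R^d)$ of the form $$Sf=\sum_{K\in\mathscr D^\omega}\ \sum_{\substack{I,J\in\mathscr D^\omega;\ I,J\subseteq K\\ \ell(I)=2^{-i}\ell(K),\ \ell(J)=2^{-j}\ell(K)}}\ \sum_{\eta,\zeta}a_{IJK}^{\eta\zeta}\,\langle\psi_I^\eta,f\rangle\,\psi_J^\zeta,$$ where the sum over $K$ converges unconditionally in $L^2$, $|a_{IJK}^{\eta\zeta}|\le\sqrt{|I||J|}/|K|$, and $a_{IJK}^{\eta\zeta}\ne0$ only if $mI\subset K$ and $mJ\subset K$. *Operators.* Let $T$ be a bounded operator on $L^2(\mathbb R^d)$ with $Tf(x)=\int K(x,y)f(y)\,dy$ for almost every $x\notin\operatorname{supp}f$, for all compactly supported $f\in L^2$, where $K$ is $s$ times differentiable off the diagonal and $|\partial^\alpha K(x,y)|\le A|x-y|^{-d-|\alpha|}$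 for all $x\ne y$ and all $\alpha\in\mathbb N^{2d}$ with $|\alpha|\le s$, for some $A$; let $\|K\|_{CZ_s}$ be the smallest such $A$. Let $\mathcal P_s$ be the space of polynomials of degree less than $s$. For $p\in\mathcal P_s$, $Tp$ is defined up to elements of $\mathcal P_s$ by $\langle\varphi,Tp\rangle=\langle T^*\varphi,p\rangle$ for all compactly supported $\varphi\in L^2$ with $\int x^\alpha\varphi=0$ for all $|\alpha|<s$; similarly for $T^*$. **Theorem 3.1.** For all $d,s\ge1$, $\varepsilon>0$, $m\ge1$ and $C$ there is a constant $c>0$, depending only on these parameters (and on the choice of real or complex scalars), such that the following holds for all $\psi^\eta$, $T$, $K$ as above. If $T$ and $T^*$ map $\mathcal P_s$ to $\mathcal P_s$, then there are good wavelet shifts $S^{ij}_\omega$ with parameters $(i,j)$ on $\mathscr D^\omega$ ($i,j\ge1$, $\omega\in\Omega$) such that for all $f,g\in C^1_c(\mathbb R^d)$ $$\langle g,Tf\rangle=c\,\big(\|K\|_{CZ_s}+\|T\|_{L^2\to L^2}\big)\,\mathbb E_\omega\sum_{i,j=1}^\infty2^{-(s-\varepsilon)\max(i,j)}\langle g,S^{ij}_\omega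 f\rangle,$$ where the double series converges absolutely for every $\omega$ and its sum is integrable over $\Omega$. -/

import Mathlib

open MeasureTheory
open scoped ComplexConjugate

namespace DyadicWavelet

/-! ## Ambient spaces -/

/-- `ℝ^d`; its norm in Mathlib is the `ℓ^∞` norm, and `volume` is Lebesgue measure. -/
abbrev Pt (d : ℕ) : Type := Fin d → ℝ

/-- The Hilbert space `L²(ℝ^d)` with scalars `𝕜 = ℝ` or `ℂ`; the inner product is
`⟪g, f⟫ = ∫ conj g * f`. -/
abbrev L2 (𝕜 : Type*) [RCLike 𝕜] (d : ℕ) : Type _ := Lp 𝕜 2 (volume : Measure (Pt d))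

open Classical in
/-- The class in `L²` of a square integrable function (and `0` for any other function). -/
noncomputable def toL2 {𝕜 : Type*} [RCLike 𝕜] {d : ℕ} (f : Pt d → 𝕜) : L2 𝕜 d :=
  if h : MemLp f 2 (volume : Measure (Pt d)) then h.toLp f else 0

/-- `f` is `n` times differentiable (in the sense of Fréchet) at every point of the open set `U`. -/
def TimesDifferentiableOn {E F : Type*} [NormedAddCommGroup E] [NormedSpace ℝ E]
    [NormedAddCommGroup F] [NormedSpace ℝ F] (n : ℕ) (f : E → F) (U : Set E) : Prop :=
  ∀ k < n, ∀ x ∈ U, DifferentiableAt ℝ (iteratedFDeriv ℝ k f) x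

/-- The monomial `x^α`. -/
def monomialFn {d : ℕ} (α : Fin d → ℕ) (x : Pt d) : ℝ := ∏ i, x i ^ α i

/-- `∫ x^α φ(x) dx = 0` for all multi-indices of order `|α| < n`. -/
def HasVanishingMoments {𝕜 : Type*} [RCLike 𝕜] {d : ℕ} (n : ℕ) (φ : Pt d → 𝕜) : Prop :=
  ∀ α : Fin d → ℕ, ∑ i, α i < n → ∫ x, ((monomialFn α x : ℝ) : 𝕜) * φ x = 0

/-! ## Random dyadic systems -/

/-- The parameter space `Ω = ({0,1}^d)^ℤ`. -/
abbrev Omega (d : ℕ) : Type := ℤ → Fin d → Fin 2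

/-- The natural probability on `Ω`: the coordinates `ω_j` are independent and uniformly
distributed on `{0,1}^d`. -/
noncomputable def omegaMeasure (d : ℕ) : Measure (Omega d) :=
  Measure.infinitePi fun _ : ℤ => (PMF.uniformOfFintype (Fin d → Fin 2)).toMeasure

/-- The index `(k, l)` stands for the reference cube `2^{-k}([0,1)^d + l)`, and, once `ω` is given,
for the translated cube `I ∔ ω` of the system `𝒟^ω`. -/
abbrev CubeIdx (d : ℕ) : Type := ℤ × (Fin d → ℤ)

/-- The side length `ℓ(I) = 2^{-k}`. -/
noncomputable def side {d : ℕ} (Q : CubeIdx d) : ℝ := (2 : ℝ) ^ (-Q.1)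

/-- The volume `|I| = ℓ(I)^d`. -/
noncomputable def vol {d : ℕ} (Q : CubeIdx d) : ℝ := side Q ^ d

/-- The translation `∑_{j : 2^{-j} < 2^{-k}} 2^{-j} ω_j`, the sum being over `j = k+1, k+2, …`. -/
noncomputable def translation {d : ℕ} (ω : Omega d) (k : ℤ) : Pt d := fun i =>
  ∑' n : ℕ, (2 : ℝ) ^ (-(k + 1 + n)) * ((ω (k + 1 + n) i : ℕ) : ℝ)

/-- The lower left corner `2^{-k} l + ∑_{j : 2^{-j} < 2^{-k}} 2^{-j} ω_j` of `I ∔ ω`. -/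
noncomputable def corner {d : ℕ} (ω : Omega d) (Q : CubeIdx d) : Pt d := fun i =>
  side Q * (Q.2 i : ℝ) + translation ω Q.1 i

/-- The half-open cube `I ∔ ω`. -/
def cube {d : ℕ} (ω : Omega d) (Q : CubeIdx d) : Set (Pt d) :=
  {x | ∀ i, corner ω Q i ≤ x i ∧ x i < corner ω Q i + side Q}

/-- The cube `m I` with the same centre as `I = cube ω Q` and `m` times its side length. -/
def dilatedCube {d : ℕ} (m : ℝ) (ω : Omega d) (Q : CubeIdx d) : Set (Pt d) :=
  {x | ∀ i, corner ω Q i + side Q / 2 - m * side Q / 2 ≤ x i ∧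
    x i < corner ω Q i + side Q / 2 + m * side Q / 2}

theorem side_pos {d : ℕ} (Q : CubeIdx d) : 0 < side Q := zpow_pos (by norm_num) _

theorem corner_mem_cube {d : ℕ} (ω : Omega d) (Q : CubeIdx d) : corner ω Q ∈ cube ω Q :=
  fun _ => ⟨le_rfl, lt_add_of_pos_right _ (side_pos Q)⟩

/-- For given `K` and `i` there are only finitely many `I ⊆ K` with `ℓ(I) = 2^{-i} ℓ(K)`. -/
theorem finite_descendants {d : ℕ} (ω : Omega d) (i : ℕ) (K : CubeIdx d) :
    {I : CubeIdx d | cube ω I ⊆ cube ω K ∧ I.1 = K.1 + i}.Finite := by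
  set t : Pt d := translation ω (K.1 + i) with ht
  set σ : ℝ := (2 : ℝ) ^ (-(K.1 + (i : ℤ))) with hσ
  have hσ0 : 0 < σ := zpow_pos (by norm_num) _
  let B : Set (Fin d → ℤ) := Set.pi Set.univ fun a =>
    Set.Icc ⌊(corner ω K a - t a) / σ⌋ ⌈(corner ω K a + side K - t a) / σ⌉
  have hB : B.Finite := Set.Finite.pi fun a => Set.finite_Icc _ _
  refine ((Set.finite_singleton (K.1 + (i : ℤ))).prod hB).subset ?_
  rintro ⟨k, l⟩ ⟨hsub, hk⟩
  simp only at hk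
  subst hk
  refine ⟨rfl, fun a _ => ?_⟩
  have h := hsub (corner_mem_cube ω _) a
  have hc : corner ω (K.1 + (i : ℤ), l) a = σ * (l a : ℝ) + t a := rfl
  rw [hc] at h
  constructor
  · have h1 : (corner ω K a - t a) / σ ≤ (l a : ℝ) := by
      rw [div_le_iff₀ hσ0]; nlinarith [h.1]
    exact_mod_cast (Int.floor_le _).trans h1
  · have h1 : (l a : ℝ) ≤ (corner ω K a + side K - t a) / σ := by
      rw [le_div_iff₀ hσ0]; nlinarith [h.2]
    exact_mod_cast h1.trans (Int.le_ceil _)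

/-- The finite family of all `I ∈ 𝒟^ω` with `I ⊆ K` and `ℓ(I) = 2^{-i} ℓ(K)`. -/
noncomputable def descendants {d : ℕ} (ω : Omega d) (i : ℕ) (K : CubeIdx d) :
    Finset (CubeIdx d) :=
  (finite_descendants ω i K).toFinset

/-! ## Wavelets -/

/-- The index set `{0,1}^d \ {0}`. -/
abbrev Eta (d : ℕ) : Type := {η : Fin d → Fin 2 // η ≠ 0}

/-- The function `ψ_I^η(x) = 2^{dk/2} ψ^η(2^k (x - t) - l)` for the cube
`I = 2^{-k}([0,1)^d + l) + t` of `𝒟^ω`, where `t = ∑_{j : 2^{-j} < 2^{-k}} 2^{-j} ω_j`. -/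
noncomputable def wavelet {𝕜 : Type*} [RCLike 𝕜] {d : ℕ} (ψ : Eta d → Pt d → 𝕜) (ω : Omega d)
    (Q : CubeIdx d) (η : Eta d) (x : Pt d) : 𝕜 :=
  (((2 : ℝ) ^ ((d : ℝ) * (Q.1 : ℝ) / 2) : ℝ) : 𝕜) *
    ψ η (fun i => (2 : ℝ) ^ Q.1 * (x i - translation ω Q.1 i) - (Q.2 i : ℝ))

/-- The functions `ψ_I^η`, `I ∈ 𝒟^ω`, `η ∈ {0,1}^d \ {0}`, form a system of wavelets with parameters
`(m, u, v)`, with the constant `C` in the regularity estimate. A partial derivative `∂^α` of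
order `k = |α|` is written as `∂_{w 0} ⋯ ∂_{w (k-1)}` with a word `w` in the coordinates. -/
structure IsWaveletSystem {𝕜 : Type*} [RCLike 𝕜] {d : ℕ} (ψ : Eta d → Pt d → 𝕜) (ω : Omega d)
    (m : ℝ) (u v : ℕ) (C : ℝ) : Prop where
  memLp : ∀ Q η, MemLp (wavelet ψ ω Q η) 2 (volume : Measure (Pt d))
  orthonormal : Orthonormal 𝕜 fun p : CubeIdx d × Eta d => toL2 (wavelet ψ ω p.1 p.2)
  complete : (Submodule.span 𝕜
    (Set.range fun p : CubeIdx d × Eta d => toL2 (wavelet ψ ω p.1 p.2))).topologicalClosure = ⊤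
  localization : ∀ Q η, Function.support (wavelet ψ ω Q η) ⊆ dilatedCube m ω Q
  differentiable : ∀ Q η, TimesDifferentiableOn u (wavelet ψ ω Q η) Set.univ
  regularity : ∀ Q η, ∀ k ≤ u, ∀ (w : Fin k → Fin d) (x : Pt d),
    ‖iteratedFDeriv ℝ k (wavelet ψ ω Q η) x (fun a => Pi.single (w a) 1)‖ ≤
      C * (side Q)⁻¹ ^ k * (√(vol Q))⁻¹
  cancellation : ∀ Q η, HasVanishingMoments (v + 1) (wavelet ψ ω Q η)

/-! ## Wavelet shifts -/

/-- The operator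
`A_K f = ∑_{I, J ⊆ K, ℓ(I) = 2^{-i} ℓ(K), ℓ(J) = 2^{-j} ℓ(K)} a_{IJK} ⟨ψ_I, f⟩ ψ_J`,
the summation over the superscripts `η` of `ψ_I` and `ζ` of `ψ_J` included. -/
noncomputable def blockOp {𝕜 : Type*} [RCLike 𝕜] {d : ℕ} (ψ : Eta d → Pt d → 𝕜) (ω : Omega d)
    (i j : ℕ) (a : CubeIdx d × Eta d → CubeIdx d × Eta d → CubeIdx d → 𝕜) (K : CubeIdx d)
    (f : L2 𝕜 d) : L2 𝕜 d :=
  ∑ I ∈ descendants ω i K, ∑ J ∈ descendants ω j K, ∑ η : Eta d, ∑ ζ : Eta d,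
    (a (I, η) (J, ζ) K * inner 𝕜 (toL2 (wavelet ψ ω I η)) f) • toL2 (wavelet ψ ω J ζ)

/-- `S` is a good wavelet shift with parameters `(i, j)` on `𝒟^ω`: one has `S f = ∑_K A_K f`
(unconditionally in `L²`), where the coefficients satisfy `|a_{IJK}| ≤ √(|I| |J|) / |K|`, and
`a_{IJK} ≠ 0` only if `m I ⊆ K` and `m J ⊆ K`. -/
def IsGoodWaveletShift {𝕜 : Type*} [RCLike 𝕜] {d : ℕ} (ψ : Eta d → Pt d → 𝕜) (m : ℝ) (ω : Omega d)
    (i j : ℕ) (S : L2 𝕜 d →L[𝕜] L2 𝕜 d) : Prop :=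
  ∃ a : CubeIdx d × Eta d → CubeIdx d × Eta d → CubeIdx d → 𝕜,
    (∀ K, ∀ I ∈ descendants ω i K, ∀ J ∈ descendants ω j K, ∀ η ζ : Eta d,
      ‖a (I, η) (J, ζ) K‖ ≤ √(vol I * vol J) / vol K ∧
      (a (I, η) (J, ζ) K ≠ 0 →
        dilatedCube m ω I ⊆ cube ω K ∧ dilatedCube m ω J ⊆ cube ω K)) ∧
    ∀ f : L2 𝕜 d, HasSum (fun K : CubeIdx d => blockOp ψ ω i j a K f) (S f)

/-! ## Calderón–Zygmund operators -/

/-- The coordinate directions of `ℝ^d × ℝ^d`. -/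
noncomputable def pairBasis {d : ℕ} : Fin d ⊕ Fin d → Pt d × Pt d
  | Sum.inl i => (Pi.single i 1, 0)
  | Sum.inr i => (0, Pi.single i 1)

/-- `|∂^α K(x, y)| ≤ A / |x - y|^{d + |α|}` for all `x ≠ y` and all multi-indices `α ∈ ℕ^{2d}`
of order `|α| ≤ s`. -/
def KernelBound {𝕜 : Type*} [RCLike 𝕜] {d : ℕ} (s : ℕ) (K : Pt d → Pt d → 𝕜) (A : ℝ) : Prop :=
  ∀ k ≤ s, ∀ (w : Fin k → Fin d ⊕ Fin d) (x y : Pt d), x ≠ y →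
    ‖iteratedFDeriv ℝ k (fun p : Pt d × Pt d => K p.1 p.2) (x, y) (fun a => pairBasis (w a))‖ ≤
      A / ‖x - y‖ ^ (d + k)

/-- `K` is `s` times differentiable off the diagonal and satisfies the standard estimates of
order `s` there, for some constant. The values of `K` on the diagonal play no role. -/
def IsCZKernel {𝕜 : Type*} [RCLike 𝕜] {d : ℕ} (s : ℕ) (K : Pt d → Pt d → 𝕜) : Prop :=
  TimesDifferentiableOn s (fun p : Pt d × Pt d => K p.1 p.2) {p | p.1 ≠ p.2} ∧
    ∃ A : ℝ, KernelBound s K A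

/-- `‖K‖_{CZ_s}`, the smallest admissible constant in the standard estimates of order `s`. -/
noncomputable def czNorm {𝕜 : Type*} [RCLike 𝕜] {d : ℕ} (s : ℕ) (K : Pt d → Pt d → 𝕜) : ℝ :=
  sInf {A : ℝ | 0 ≤ A ∧ KernelBound s K A}

/-- `T f(x) = ∫ K(x, y) f(y) dy` for (almost all) `x ∉ supp f`, where `f ∈ L²` has
compact support. -/
def HasKernel {𝕜 : Type*} [RCLike 𝕜] {d : ℕ} (T : L2 𝕜 d →L[𝕜] L2 𝕜 d) (K : Pt d → Pt d → 𝕜) :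
    Prop :=
  ∀ f : Pt d → 𝕜, MemLp f 2 (volume : Measure (Pt d)) → HasCompactSupport f →
    ∀ᵐ x : Pt d, x ∉ tsupport f → (T (toL2 f) : Pt d → 𝕜) x = ∫ y, K x y * f y

/-- A polynomial as a function on `ℝ^d`. -/
noncomputable def polyFn {𝕜 : Type*} [RCLike 𝕜] {d : ℕ} (p : MvPolynomial (Fin d) 𝕜) (x : Pt d) :
    𝕜 :=
  MvPolynomial.eval (fun i => ((x i : ℝ) : 𝕜)) p

/-- `T : 𝒫_s → 𝒫_s`, where `𝒫_s` is the space of polynomials of degree less than `s`.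
Polynomials are not in `L²`; as usual for a kernel with `s` derivatives, `T p` is defined by duality,
`⟨φ, T p⟩ := ⟨T* φ, p⟩`, for compactly supported `φ ∈ L²` whose moments of order less than `s`
vanish (for these, `T* φ` decays like `|x|^{-d-s}` and the integral converges absolutely). So `T p`
is determined up to elements of `𝒫_s`, and the condition says that `T p` is represented by some
`q ∈ 𝒫_s`. -/
def MapsPolynomials {𝕜 : Type*} [RCLike 𝕜] {d : ℕ} (s : ℕ) (T : L2 𝕜 d →L[𝕜] L2 𝕜 d) : Prop :=
  ∀ p : MvPolynomial (Fin d) 𝕜, p.totalDegree < s →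
    ∃ q : MvPolynomial (Fin d) 𝕜, q.totalDegree < s ∧
      ∀ φ : Pt d → 𝕜, MemLp φ 2 (volume : Measure (Pt d)) → HasCompactSupport φ →
        HasVanishingMoments s φ →
        Integrable (fun x =>
          conj ((ContinuousLinearMap.adjoint T (toL2 φ) : Pt d → 𝕜) x) * polyFn p x) ∧
        ∫ x, conj ((ContinuousLinearMap.adjoint T (toL2 φ) : Pt d → 𝕜) x) * polyFn p x =
          ∫ x, conj (φ x) * polyFn q x

/-- The class `C^1_c(ℝ^d)`. -/
def IsC1c {𝕜 : Type*} [RCLike 𝕜] {d : ℕ} (f : Pt d → 𝕜) : Prop :=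
  ContDiff ℝ 1 f ∧ HasCompactSupport f

end DyadicWavelet

open DyadicWavelet

namespace DyadicWavelet

/-! ## Translations and bit flips -/

section Translation

variable {d : ℕ}

/-! Expanding `f` and `g` in the wavelets of `𝒟^ω` turns `⟨g, T f⟩` into a double series of terms
`⟨g, ψ_J⟩ ⟨ψ_J, T ψ_I⟩ ⟨ψ_I, f⟩`. A shift collects pairs `I, J` with a common ancestor `K` of
prescribed generations, but for a given `ω` two close cubes may be separated by the grid at many
scales. Randomness removes this obstacle.

To each pair of reference cubes a level `ancLevel` is attached, independent of `ω`, whose cubes have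
side comparable to `ℓ(I) + ℓ(J) + dist(I, J)`. The pair is good if the corner of `J` lies in the
middle half of its cube `K` of that level; then `mI, mJ ⊆ K` (`dilatedCube_subset_commonAnc`).
Goodness can be decided by the bits at position `ancLevel + 1` with all others fixed, and these do
not move `I` or `J`. So goodness is independent of the term of the pair and has probability `2^{-d}`
(`integral_goodInd_mul`), and restricting to good pairs costs exactly a factor `2^d`
(`inner_eq_integral_tsum_good`).

The analytic input is the decay `|⟨ψ_J, T ψ_I⟩| ≲ (min(ℓ(I), ℓ(J)) / ℓ(K))^{s-δ} √(|I||J|) / |K|`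
(`exists_norm_inner_le`). For distant cubes it comes from the vanishing moments of the smaller
wavelet and the Taylor expansion of the kernel. For close cubes the Taylor polynomial of the larger
wavelet is subtracted, which is allowed because `T` and `T*` preserve `𝒫_s`; the same hypothesis is
why no paraproducts occur. The loss `δ` pays for a convergent tail integral. As `min(ℓ(I), ℓ(J)) /
ℓ(K) = 2^{-max(i,j)}`, this is the weight of the theorem times the normalisation of a shift.

A Schur test bounds the good sum uniformly in `ω` (`exists_tsum_pairGood_le`), which justifies all
interchanges; sorting the good pairs by `(i, j, K)` produces the shifts (`hasSum_shifts`). -/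

theorem two_zpow_neg_add (k : ℤ) (n : ℕ) :
    (2 : ℝ) ^ (-(k + 1 + n)) = (2 : ℝ) ^ (-k) / 2 / 2 ^ n := by
  rw [show -(k + 1 + (n : ℤ)) = -k - 1 - n by ring, zpow_sub₀ two_ne_zero, zpow_sub₀ two_ne_zero,
    zpow_one, zpow_natCast]

theorem bit_nonneg_le_one (b : Fin 2) : (0 : ℝ) ≤ ((b : ℕ) : ℝ) ∧ ((b : ℕ) : ℝ) ≤ 1 := by
  refine ⟨Nat.cast_nonneg _, ?_⟩
  have := b.isLt
  exact_mod_cast (by omega : (b : ℕ) ≤ 1)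

theorem translation_term_nonneg (ω : Omega d) (k : ℤ) (i : Fin d) (n : ℕ) :
    0 ≤ (2 : ℝ) ^ (-(k + 1 + n)) * ((ω (k + 1 + n) i : ℕ) : ℝ) := by positivity

theorem translation_term_le (ω : Omega d) (k : ℤ) (i : Fin d) (n : ℕ) :
    (2 : ℝ) ^ (-(k + 1 + n)) * ((ω (k + 1 + n) i : ℕ) : ℝ) ≤ (2 : ℝ) ^ (-k) / 2 / 2 ^ n := by
  rw [← two_zpow_neg_add]
  exact mul_le_of_le_one_right (by positivity) (bit_nonneg_le_one _).2

theorem summable_translation (ω : Omega d) (k : ℤ) (i : Fin d) :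
    Summable fun n : ℕ => (2 : ℝ) ^ (-(k + 1 + n)) * ((ω (k + 1 + n) i : ℕ) : ℝ) :=
  Summable.of_nonneg_of_le (translation_term_nonneg ω k i) (translation_term_le ω k i)
    (summable_geometric_two' _)

theorem translation_nonneg (ω : Omega d) (k : ℤ) (i : Fin d) : 0 ≤ translation ω k i :=
  tsum_nonneg (translation_term_nonneg ω k i)

theorem translation_le (ω : Omega d) (k : ℤ) (i : Fin d) :
    translation ω k i ≤ (2 : ℝ) ^ (-k) := by
  rw [← tsum_geometric_two' ((2 : ℝ) ^ (-k))]
  exact (summable_translation ω k i).tsum_le_tsum (translation_term_le ω k i)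
    (summable_geometric_two' _)

theorem translation_succ (ω : Omega d) (k : ℤ) (i : Fin d) :
    translation ω k i =
      (2 : ℝ) ^ (-k) / 2 * ((ω (k + 1) i : ℕ) : ℝ) + translation ω (k + 1) i := by
  rw [translation, (summable_translation ω k i).tsum_eq_zero_add]
  congr 1
  · have := two_zpow_neg_add k 0
    simp only [Nat.cast_zero, add_zero, pow_zero, div_one] at this ⊢
    rw [this]
  · refine tsum_congr fun n => ?_
    rw [show k + 1 + ((n + 1 : ℕ) : ℤ) = k + 1 + 1 + n by push_cast; ring]

theorem translation_congr {ω ω' : Omega d} {k : ℤ} (h : ∀ j, k < j → ω j = ω' j) :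
    translation ω k = translation ω' k := by
  funext i
  refine tsum_congr fun n => ?_
  rw [h _ (by omega)]

theorem continuous_translation (k : ℤ) : Continuous fun ω : Omega d => translation ω k := by
  refine continuous_pi fun i => ?_
  refine continuous_tsum (u := fun n : ℕ => (2 : ℝ) ^ (-k) / 2 / 2 ^ n) (fun n => ?_)
    (summable_geometric_two' _) (fun n ω => ?_)
  · have : Continuous fun b : Fin 2 => ((b : ℕ) : ℝ) := continuous_of_discreteTopology
    exact continuous_const.mul (this.comp ((continuous_apply i).comp (continuous_apply _)))
  · rw [Real.norm_of_nonneg (translation_term_nonneg ω k i n)]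
    exact translation_term_le ω k i n

instance : IsProbabilityMeasure (omegaMeasure d) := by unfold omegaMeasure; infer_instance

/-- Add `e` to the bits at the position `a`. -/
def flipAt (a : ℤ) (e : Fin d → Fin 2) (ω : Omega d) : Omega d :=
  fun j => if j = a then ω j + e else ω j

theorem measurePreserving_add_uniform (e : Fin d → Fin 2) :
    MeasurePreserving (fun v : Fin d → Fin 2 => v + e)
      (PMF.uniformOfFintype (Fin d → Fin 2)).toMeasure
      (PMF.uniformOfFintype (Fin d → Fin 2)).toMeasure := by
  refine ⟨measurable_of_countable _, Measure.ext_of_singleton fun v => ?_⟩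
  rw [Measure.map_apply (measurable_of_countable _) (measurableSet_singleton v),
    show (fun v : Fin d → Fin 2 => v + e) ⁻¹' {v} = {v - e} by
      ext w; exact (eq_sub_iff_add_eq (a := w) (b := v) (c := e)).symm,
    PMF.toMeasure_apply_singleton _ _ (measurableSet_singleton _),
    PMF.toMeasure_apply_singleton _ _ (measurableSet_singleton _)]
  simp

theorem measurePreserving_flipAt (a : ℤ) (e : Fin d → Fin 2) :
    MeasurePreserving (flipAt (d := d) a e) (omegaMeasure d) (omegaMeasure d) := by
  have hf : ∀ j : ℤ, MeasurePreserving (fun v : Fin d → Fin 2 => if j = a then v + e else v)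
      (PMF.uniformOfFintype (Fin d → Fin 2)).toMeasure
      (PMF.uniformOfFintype (Fin d → Fin 2)).toMeasure := fun j => by
    by_cases h : j = a
    · simpa [h] using measurePreserving_add_uniform e
    · simp only [h, if_false]
      exact MeasurePreserving.id _
  refine ⟨measurable_pi_lambda _ fun j => (hf j).measurable.comp (measurable_pi_apply j), ?_⟩
  have := Measure.infinitePi_map_pi
    (μ := fun _ : ℤ => (PMF.uniformOfFintype (Fin d → Fin 2)).toMeasure)
    (f := fun j v => if j = a then v + e else v) (fun j => (hf j).measurable)
  simp only [fun j => (hf j).map_eq] at this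
  exact this

/-- Only bits at positions beyond `k` enter `t_k`. Hence a flip at position `κ + 1` leaves all cubes
of side less than `2^{-κ}` in place. -/
theorem translation_flipAt_of_le {a k : ℤ} (h : a ≤ k) (e : Fin d → Fin 2) (ω : Omega d) :
    translation (flipAt a e ω) k = translation ω k :=
  translation_congr fun j hj => by simp [flipAt, show j ≠ a by omega]

/-! ## The averaging trick -/

/-- The indicator of the event that the fractional part of `u` lies in `[1/4, 3/4)`. -/
noncomputable def midInd (u : ℝ) : ℝ := Set.indicator (Set.Ico (1 / 4 : ℝ) (3 / 4)) 1 (Int.fract u)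

/-- On the circle, a shift by one half exchanges the middle half with its complement. The half-open
interval makes this exact for every `u`, so no null set has to be discarded. -/
theorem midInd_add_midInd_sub_half (u : ℝ) : midInd u + midInd (u - 1 / 2) = 1 := by
  have h0 := Int.fract_nonneg u
  have h1 := Int.fract_lt_one u
  have hu := Int.self_sub_floor u
  rcases lt_or_ge (Int.fract u) (1 / 2) with h | h
  · have h2 : Int.fract (u - 1 / 2) = Int.fract u + 1 / 2 :=
      Int.fract_eq_iff.2 ⟨by linarith, by linarith, ⌊u⌋ - 1, by push_cast; linarith⟩
    unfold midInd
    rw [h2]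
    simp only [Set.indicator_apply, Set.mem_Ico, Pi.one_apply]
    split_ifs <;> grind
  · have h2 : Int.fract (u - 1 / 2) = Int.fract u - 1 / 2 :=
      Int.fract_eq_iff.2 ⟨by linarith, by linarith, ⌊u⌋, by linarith⟩
    unfold midInd
    rw [h2]
    simp only [Set.indicator_apply, Set.mem_Ico, Pi.one_apply]
    split_ifs <;> grind

theorem measurable_midInd : Measurable midInd :=
  (measurable_one.indicator measurableSet_Ico).comp measurable_fract

theorem midInd_eq_zero_or_one (u : ℝ) : midInd u = 0 ∨ midInd u = 1 := by
  unfold midInd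
  exact Set.indicator_eq_zero_or_self _ _ _

/-- The indicator of the event that `c` lies in the middle half, in every coordinate, of the cube
of `𝒟^ω` of side length `2^{-κ}` that contains it. -/
noncomputable def goodInd (κ : ℤ) (c : Pt d) (ω : Omega d) : ℝ :=
  ∏ i, midInd ((c i - translation ω κ i) * (2 : ℝ) ^ κ)

theorem goodInd_eq_zero_or_one (κ : ℤ) (c : Pt d) (ω : Omega d) :
    goodInd κ c ω = 0 ∨ goodInd κ c ω = 1 := by
  by_cases h : ∃ i, midInd ((c i - translation ω κ i) * (2 : ℝ) ^ κ) = 0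
  · obtain ⟨i, hi⟩ := h
    exact Or.inl (Finset.prod_eq_zero (Finset.mem_univ i) hi)
  · push Not at h
    exact Or.inr (Finset.prod_eq_one fun i _ => (midInd_eq_zero_or_one _).resolve_left (h i))

theorem measurable_goodInd (κ : ℤ) {c : Omega d → Pt d} (hc : Measurable c) :
    Measurable fun ω => goodInd κ (c ω) ω := by
  refine Finset.measurable_prod _ fun i _ => measurable_midInd.comp ?_
  exact (((measurable_pi_apply i).comp hc).sub
    ((measurable_pi_apply i).comp (continuous_translation κ).measurable)).mul_const _

/-- The bits at position `κ + 1` move `t_κ` by half a side in the chosen coordinates, so exactly one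
of the `2^d` choices brings `c` into the middle half in all coordinates. -/
theorem sum_goodInd_flipAt (κ : ℤ) (c : Pt d) (ω : Omega d) :
    ∑ e : Fin d → Fin 2, goodInd κ c (flipAt (κ + 1) e ω) = 1 := by
  have h1 : ∀ e : Fin d → Fin 2, goodInd κ c (flipAt (κ + 1) e ω) =
      ∏ i, midInd ((c i - translation ω (κ + 1) i) * (2 : ℝ) ^ κ -
        (((ω (κ + 1) + e) i : ℕ) : ℝ) / 2) := fun e => by
    refine Finset.prod_congr rfl fun i _ => ?_
    rw [translation_succ, translation_flipAt_of_le le_rfl, zpow_neg]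
    congr 1
    have : (2 : ℝ) ^ κ ≠ 0 := by positivity
    simp only [flipAt, if_true]
    field_simp
    ring
  simp_rw [h1]
  -- As `e` runs over the group `{0,1}^d`, so does `ω_{κ+1} + e`; the sum over bit vectors then
  -- factors into two-term sums, one for each coordinate.
  have he := Equiv.sum_comp (Equiv.addLeft (ω (κ + 1))) fun v : Fin d → Fin 2 =>
    ∏ i, midInd ((c i - translation ω (κ + 1) i) * (2 : ℝ) ^ κ - ((v i : ℕ) : ℝ) / 2)
  simp only [Equiv.coe_addLeft] at he
  rw [he]
  have := Finset.prod_univ_sum (fun _ : Fin d => (Finset.univ : Finset (Fin 2)))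
    (fun i b => midInd ((c i - translation ω (κ + 1) i) * (2 : ℝ) ^ κ - ((b : ℕ) : ℝ) / 2))
  rw [Fintype.piFinset_univ] at this
  rw [← this]
  refine Finset.prod_eq_one fun i _ => ?_
  rw [Fin.sum_univ_two]
  simpa using midInd_add_midInd_sub_half _

/-- If `X` and `c` do not depend on the bits at the position `κ + 1`, then the expectation of `X` on
the event of `goodInd` is `2^{-d}` times the expectation of `X`. -/
theorem integral_goodInd_mul {𝕜 : Type*} [RCLike 𝕜] (κ : ℤ) {c : Omega d → Pt d}
    (hc : Measurable c) (hcf : ∀ e ω, c (flipAt (κ + 1) e ω) = c ω) {X : Omega d → 𝕜}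
    (hX : Integrable X (omegaMeasure d)) (hXf : ∀ e ω, X (flipAt (κ + 1) e ω) = X ω) :
    ∫ ω, X ω ∂omegaMeasure d =
      2 ^ d * ∫ ω, ((goodInd κ (c ω) ω : ℝ) : 𝕜) * X ω ∂omegaMeasure d := by
  have hm : Measurable fun ω => ((goodInd κ (c ω) ω : ℝ) : 𝕜) :=
    RCLike.measurable_ofReal.comp (measurable_goodInd κ hc)
  have hi : Integrable (fun ω => ((goodInd κ (c ω) ω : ℝ) : 𝕜) * X ω) (omegaMeasure d) :=
    hX.bdd_mul (c := 1) hm.aestronglyMeasurable (Filter.Eventually.of_forall fun ω => by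
      rcases goodInd_eq_zero_or_one κ (c ω) ω with h | h <;> simp [h])
  -- Flips preserve the measure and leave `X` and `c` alone, so all `2^d` flipped integrals agree;
  -- pointwise their integrands add up to `X`.
  have h1 : ∀ e, ∫ ω, ((goodInd κ (c ω) (flipAt (κ + 1) e ω) : ℝ) : 𝕜) * X ω ∂omegaMeasure d =
      ∫ ω, ((goodInd κ (c ω) ω : ℝ) : 𝕜) * X ω ∂omegaMeasure d := fun e => by
    have hp := measurePreserving_flipAt (κ + 1) e
    have := integral_map (μ := omegaMeasure d) hp.measurable.aemeasurable
      (f := fun ω => ((goodInd κ (c ω) ω : ℝ) : 𝕜) * X ω)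
      (by rw [hp.map_eq]; exact hi.aestronglyMeasurable)
    rw [hp.map_eq] at this
    rw [this]
    simp only [hcf, hXf]
  have h2 : ∀ e ∈ (Finset.univ : Finset (Fin d → Fin 2)),
      Integrable (fun ω => ((goodInd κ (c ω) (flipAt (κ + 1) e ω) : ℝ) : 𝕜) * X ω)
        (omegaMeasure d) := fun e _ => by
    have := (measurePreserving_flipAt (κ + 1) e).integrable_comp_of_integrable hi
    simpa only [Function.comp_def, hcf, hXf] using this
  have h3 : ∑ e : Fin d → Fin 2,
      ∫ ω, ((goodInd κ (c ω) (flipAt (κ + 1) e ω) : ℝ) : 𝕜) * X ω ∂omegaMeasure d =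
      ∫ ω, X ω ∂omegaMeasure d := by
    rw [← integral_finsetSum _ h2]
    refine integral_congr_ae (Filter.Eventually.of_forall fun ω => ?_)
    simp only
    rw [← Finset.sum_mul, ← RCLike.ofReal_sum, sum_goodInd_flipAt]
    simp
  rw [← h3]
  simp only [h1, Finset.sum_const, Finset.card_univ, Fintype.card_fun, Fintype.card_fin,
    nsmul_eq_mul, Nat.cast_pow, Nat.cast_ofNat]

end Translation

/-! ## Geometry of the dyadic cubes -/

section Cubes

variable {d : ℕ}

theorem side_eq_zpow (Q : CubeIdx d) : side Q = (2 : ℝ) ^ (-Q.1) := rfl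

theorem vol_pos (Q : CubeIdx d) : 0 < vol Q := pow_pos (side_pos Q) d

/-- The index of the cube of `𝒟^ω` of side length `2^{-κ}` that contains `x`. -/
noncomputable def cellIdx (ω : Omega d) (κ : ℤ) (x : Pt d) : CubeIdx d :=
  (κ, fun i => ⌊(x i - translation ω κ i) * (2 : ℝ) ^ κ⌋)

theorem mem_cube_iff {ω : Omega d} {Q : CubeIdx d} {x : Pt d} :
    x ∈ cube ω Q ↔ cellIdx ω Q.1 x = Q := by
  obtain ⟨k, l⟩ := Q
  have hk : (0 : ℝ) < (2 : ℝ) ^ k := by positivity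
  simp only [cube, Set.mem_ofPred_eq, corner, side, cellIdx, Prod.mk.injEq, true_and, funext_iff,
    Int.floor_eq_iff]
  refine forall_congr' fun i => ?_
  rw [zpow_neg, ← div_le_iff₀ hk, ← lt_div_iff₀ hk, div_eq_mul_inv, div_eq_mul_inv]
  constructor <;> rintro ⟨h1, h2⟩ <;> constructor <;> linarith

theorem mem_descendants {ω : Omega d} {i : ℕ} {I K : CubeIdx d} :
    I ∈ descendants ω i K ↔ cube ω I ⊆ cube ω K ∧ I.1 = K.1 + i := by
  simp [descendants]

theorem eq_cellIdx_of_mem_descendants {ω : Omega d} {i : ℕ} {I K : CubeIdx d}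
    (h : I ∈ descendants ω i K) : K = cellIdx ω (I.1 - i) (corner ω I) := by
  obtain ⟨h1, h2⟩ := mem_descendants.1 h
  rw [h2, add_sub_cancel_right]
  exact (mem_cube_iff.1 (h1 (corner_mem_cube ω I))).symm

theorem side_of_mem_descendants {ω : Omega d} {i : ℕ} {I K : CubeIdx d}
    (h : I ∈ descendants ω i K) : side K = 2 ^ i * side I := by
  rw [side, side, (mem_descendants.1 h).2, neg_add, zpow_add₀ two_ne_zero, zpow_neg _ (i : ℤ),
    zpow_natCast]
  field_simp

theorem vol_of_mem_descendants {ω : Omega d} {i : ℕ} {I K : CubeIdx d}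
    (h : I ∈ descendants ω i K) : vol K = (2 ^ i) ^ d * vol I := by
  rw [vol, vol, side_of_mem_descendants h, mul_pow]

/-- The count has to be sharp, since it gives total relative volume at most one. It is sharp because
a half-open interval of length `2^i` contains no more than `2^i` integers. -/
theorem card_descendants_le (ω : Omega d) (i : ℕ) (K : CubeIdx d) :
    (descendants ω i K).card ≤ (2 ^ i) ^ d := by
  classical
  set σ : ℝ := (2 : ℝ) ^ (-(K.1 + (i : ℤ))) with hσ
  have hσ0 : 0 < σ := zpow_pos (by norm_num) _
  set u : Fin d → ℤ := fun a => ⌈(corner ω K a - translation ω (K.1 + i) a) / σ⌉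
  have hsub : descendants ω i K ⊆
      (Fintype.piFinset fun a => Finset.Ico (u a) (u a + 2 ^ i)).image
        fun l => ((K.1 + i, l) : CubeIdx d) := by
    intro I hI
    have hside := side_of_mem_descendants hI
    obtain ⟨hs, hk⟩ := mem_descendants.1 hI
    obtain ⟨k, l⟩ := I
    simp only at hk
    subst hk
    refine Finset.mem_image.2 ⟨l, Fintype.mem_piFinset.2 fun a => ?_, rfl⟩
    have h := hs (corner_mem_cube ω _) a
    have hc : corner ω (K.1 + i, l) a = σ * (l a : ℝ) + translation ω (K.1 + i) a := rfl
    have hsd : side ((K.1 + i, l) : CubeIdx d) = σ := rfl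
    rw [hc, hside, hsd] at h
    have h1 : (corner ω K a - translation ω (K.1 + i) a) / σ ≤ (l a : ℝ) := by
      rw [div_le_iff₀ hσ0]; linarith [h.1]
    have h2 : (l a : ℝ) < (corner ω K a - translation ω (K.1 + i) a) / σ + 2 ^ i := by
      rw [← sub_lt_iff_lt_add, lt_div_iff₀ hσ0]; linarith [h.2]
    refine Finset.mem_Ico.2 ⟨Int.ceil_le.2 h1, ?_⟩
    have h3 := Int.le_ceil ((corner ω K a - translation ω (K.1 + i) a) / σ)
    have : (l a : ℝ) < ((u a + 2 ^ i : ℤ) : ℝ) := by push_cast; linarith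
    exact_mod_cast this
  refine (Finset.card_le_card hsub).trans (Finset.card_image_le.trans ?_)
  have h2 : ((2 : ℤ) ^ i).toNat = 2 ^ i := by exact_mod_cast Int.toNat_natCast (2 ^ i)
  simp [h2]

theorem sum_vol_descendants_le (ω : Omega d) (i : ℕ) (K : CubeIdx d) :
    ∑ I ∈ descendants ω i K, vol I / vol K ≤ 1 := by
  have h : ∀ I ∈ descendants ω i K, vol I / vol K = ((2 ^ i : ℝ) ^ d)⁻¹ := fun I hI => by
    rw [vol_of_mem_descendants hI]
    have := (vol_pos I).ne'
    field_simp
  rw [Finset.sum_congr rfl h, Finset.sum_const, nsmul_eq_mul, ← div_eq_mul_inv,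
    div_le_one (by positivity)]
  exact_mod_cast card_descendants_le ω i K

theorem cube_subset_dilatedCube {m : ℝ} (hm : 1 ≤ m) (ω : Omega d) (Q : CubeIdx d) :
    cube ω Q ⊆ dilatedCube m ω Q := fun x hx i => by
  have := mul_le_mul_of_nonneg_right hm (side_pos Q).le
  constructor <;> linarith [hx i]

theorem dilatedCube_subset_closedBall {m : ℝ} (hm : 1 ≤ m) (ω : Omega d) (Q : CubeIdx d) :
    dilatedCube m ω Q ⊆ Metric.closedBall (corner ω Q) (m * side Q) := fun x hx => by
  have hs := side_pos Q
  have := mul_le_mul_of_nonneg_right hm hs.le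
  rw [mem_closedBall_iff_norm, pi_norm_le_iff_of_nonneg (by positivity)]
  intro i
  rw [Pi.sub_apply, Real.norm_eq_abs, abs_le]
  constructor <;> linarith [hx i]

/-- The distance of the corners of two reference cubes. -/
noncomputable def refDist (P Q : CubeIdx d) : ℝ :=
  ‖(fun i => side P * (P.2 i : ℝ) - side Q * (Q.2 i : ℝ) : Pt d)‖

theorem refDist_comm (P Q : CubeIdx d) : refDist P Q = refDist Q P := by
  rw [refDist, refDist, ← norm_neg]
  congr 1
  funext i
  simp

/-- Since `0 ≤ t_k ≤ 2^{-k}` in each coordinate, the random translations change the relative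
position of two cubes by at most the sum of their sides. This permits replacing true distances by
the deterministic `refDist`. -/
theorem norm_translation_sub_le (ω : Omega d) (P Q : CubeIdx d) :
    ‖translation ω P.1 - translation ω Q.1‖ ≤ side P + side Q := by
  have hP := side_pos P
  have hQ := side_pos Q
  rw [pi_norm_le_iff_of_nonneg (by positivity)]
  intro i
  have h1 := translation_nonneg ω P.1 i
  have h2 := translation_nonneg ω Q.1 i
  have h3 := translation_le ω P.1 i
  have h4 := translation_le ω Q.1 i
  rw [← side_eq_zpow] at h3 h4
  rw [Pi.sub_apply, Real.norm_eq_abs, abs_le]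
  constructor <;> linarith

theorem corner_sub_corner (ω : Omega d) (P Q : CubeIdx d) :
    corner ω P - corner ω Q = (fun i => side P * (P.2 i : ℝ) - side Q * (Q.2 i : ℝ)) +
      (translation ω P.1 - translation ω Q.1) := by
  funext i
  simp only [corner, Pi.sub_apply, Pi.add_apply]
  ring

theorem norm_corner_sub_le (ω : Omega d) (P Q : CubeIdx d) :
    ‖corner ω P - corner ω Q‖ ≤ refDist P Q + (side P + side Q) := by
  rw [corner_sub_corner]
  exact (norm_add_le _ _).trans (add_le_add le_rfl (norm_translation_sub_le ω P Q))

theorem refDist_le (ω : Omega d) (P Q : CubeIdx d) :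
    refDist P Q ≤ ‖corner ω P - corner ω Q‖ + (side P + side Q) := by
  have h : (fun i => side P * (P.2 i : ℝ) - side Q * (Q.2 i : ℝ) : Pt d) =
      (corner ω P - corner ω Q) - (translation ω P.1 - translation ω Q.1) := by
    rw [corner_sub_corner]; abel
  rw [refDist, h]
  exact (norm_sub_le _ _).trans (add_le_add le_rfl (norm_translation_sub_le ω P Q))

/-- A radius, independent of `ω`, of balls around the corner of `Q ∔ ω` that contain the dilated
cubes of `P ∔ ω` and `Q ∔ ω`. -/
noncomputable def sepRadius (m : ℝ) (P Q : CubeIdx d) : ℝ :=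
  refDist P Q + (m + 1) * (side P + side Q)

theorem sepRadius_comm (m : ℝ) (P Q : CubeIdx d) : sepRadius m P Q = sepRadius m Q P := by
  rw [sepRadius, sepRadius, refDist_comm, add_comm (side P)]

theorem le_sepRadius {m : ℝ} (hm : 1 ≤ m) (P Q : CubeIdx d) :
    2 * (side P + side Q) ≤ sepRadius m P Q := by
  have h : 0 ≤ refDist P Q := norm_nonneg _
  have hP := side_pos P
  have hQ := side_pos Q
  unfold sepRadius
  nlinarith

theorem sepRadius_pos {m : ℝ} (hm : 1 ≤ m) (P Q : CubeIdx d) : 0 < sepRadius m P Q :=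
  lt_of_lt_of_le (mul_pos two_pos (add_pos (side_pos P) (side_pos Q))) (le_sepRadius hm P Q)

theorem dilatedCube_left_subset {m : ℝ} (hm : 1 ≤ m) (ω : Omega d) (P Q : CubeIdx d) :
    dilatedCube m ω P ⊆ Metric.closedBall (corner ω Q) (sepRadius m P Q) := fun x hx => by
  have h1 := mem_closedBall_iff_norm.1 (dilatedCube_subset_closedBall hm ω P hx)
  have h2 := norm_corner_sub_le ω P Q
  have h3 := norm_sub_le_norm_sub_add_norm_sub x (corner ω P) (corner ω Q)
  have hQ := side_pos Q
  rw [mem_closedBall_iff_norm, sepRadius]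
  nlinarith

theorem dilatedCube_right_subset {m : ℝ} (hm : 1 ≤ m) (ω : Omega d) (P Q : CubeIdx d) :
    dilatedCube m ω Q ⊆ Metric.closedBall (corner ω Q) (sepRadius m P Q) := fun x hx => by
  have h1 := mem_closedBall_iff_norm.1 (dilatedCube_subset_closedBall hm ω Q hx)
  have h : 0 ≤ refDist P Q := norm_nonneg _
  have hP := side_pos P
  have hQ := side_pos Q
  rw [mem_closedBall_iff_norm, sepRadius]
  nlinarith

/-- The level of the common ancestors of `P ∔ ω` and `Q ∔ ω` that are used. -/
noncomputable def ancLevel (m : ℝ) (P Q : CubeIdx d) : ℤ := -Int.clog 2 (4 * sepRadius m P Q)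

theorem ancLevel_comm (m : ℝ) (P Q : CubeIdx d) : ancLevel m P Q = ancLevel m Q P := by
  rw [ancLevel, ancLevel, sepRadius_comm]

theorem sepRadius_le_zpow (m : ℝ) (P Q : CubeIdx d) :
    4 * sepRadius m P Q ≤ (2 : ℝ) ^ (-ancLevel m P Q) := by
  rw [ancLevel, neg_neg]
  exact_mod_cast Int.self_le_zpow_clog (b := 2) (by norm_num) (4 * sepRadius m P Q)

/-- The ancestor is no larger than necessary. This direction converts decay in the distance of the
cubes into decay in `ℓ(K)`. -/
theorem zpow_le_sepRadius {m : ℝ} (hm : 1 ≤ m) (P Q : CubeIdx d) :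
    (2 : ℝ) ^ (-ancLevel m P Q) ≤ 8 * sepRadius m P Q := by
  have := Int.zpow_pred_clog_lt_self (b := 2) (by norm_num)
    (mul_pos four_pos (sepRadius_pos hm P Q))
  rw [ancLevel, neg_neg]
  rw [zpow_sub₀ (by norm_num)] at this
  push_cast at this
  linarith

/-- Strictness serves twice: the bits at position `ancLevel + 1` do not move `P`, and the
generations of the shifts start at one. -/
theorem ancLevel_lt_left {m : ℝ} (hm : 1 ≤ m) (P Q : CubeIdx d) : ancLevel m P Q < P.1 := by
  have h1 := sepRadius_le_zpow m P Q
  have h2 := le_sepRadius hm P Q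
  have hP := side_pos P
  have hQ := side_pos Q
  have h3 : (2 : ℝ) ^ (-P.1) < (2 : ℝ) ^ (-ancLevel m P Q) := by
    rw [← side_eq_zpow]; linarith
  have := (zpow_lt_zpow_iff_right₀ (by norm_num : (1 : ℝ) < 2)).1 h3
  omega

theorem ancLevel_lt_right {m : ℝ} (hm : 1 ≤ m) (P Q : CubeIdx d) : ancLevel m P Q < Q.1 := by
  rw [ancLevel_comm]
  exact ancLevel_lt_left hm Q P

/-- A point of the middle half of a cube has distance at least a quarter of the side from the
complement. -/
theorem closedBall_subset_of_goodInd {κ : ℤ} {c : Pt d} {ω : Omega d} (h : goodInd κ c ω ≠ 0)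
    {r : ℝ} (hr : 4 * r ≤ (2 : ℝ) ^ (-κ)) :
    Metric.closedBall c r ⊆ cube ω (cellIdx ω κ c) := fun x hx i => by
  have hk : (0 : ℝ) < (2 : ℝ) ^ κ := by positivity
  have h1 : midInd ((c i - translation ω κ i) * (2 : ℝ) ^ κ) ≠ 0 :=
    Finset.prod_ne_zero_iff.1 h i (Finset.mem_univ i)
  have h2 : Int.fract ((c i - translation ω κ i) * (2 : ℝ) ^ κ) ∈ Set.Ico (1 / 4 : ℝ) (3 / 4) := by
    by_contra hc
    exact h1 (Set.indicator_of_notMem hc _)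
  rw [Int.fract] at h2
  obtain ⟨h3, h4⟩ := h2
  have h5 : |x i - c i| ≤ r := (norm_le_pi_norm (x - c) i).trans (mem_closedBall_iff_norm.1 hx)
  rw [abs_le] at h5
  simp only [corner, side, cellIdx]
  set n : ℝ := (⌊(c i - translation ω κ i) * (2 : ℝ) ^ κ⌋ : ℝ)
  have h6 : 1 / 4 * (2 : ℝ) ^ (-κ) ≤ c i - translation ω κ i - (2 : ℝ) ^ (-κ) * n := by
    have := mul_le_mul_of_nonneg_right h3 (by positivity : (0 : ℝ) ≤ (2 : ℝ) ^ (-κ))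
    rw [sub_mul, mul_assoc, zpow_neg, mul_inv_cancel₀ hk.ne', ← zpow_neg] at this
    linarith
  have h7 : c i - translation ω κ i - (2 : ℝ) ^ (-κ) * n < 3 / 4 * (2 : ℝ) ^ (-κ) := by
    have := mul_lt_mul_of_pos_right h4 (by positivity : (0 : ℝ) < (2 : ℝ) ^ (-κ))
    rw [sub_mul, mul_assoc, zpow_neg, mul_inv_cancel₀ hk.ne', ← zpow_neg] at this
    linarith
  constructor <;> linarith

theorem corner_flipAt {κ : ℤ} {Q : CubeIdx d} (h : κ < Q.1) (e : Fin d → Fin 2) (ω : Omega d) :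
    corner (flipAt (κ + 1) e ω) Q = corner ω Q := by
  funext i
  rw [corner, corner, translation_flipAt_of_le (by omega)]

theorem measurable_corner (Q : CubeIdx d) : Measurable fun ω : Omega d => corner ω Q :=
  measurable_pi_lambda _ fun i => measurable_const.add
    ((measurable_pi_apply i).comp (continuous_translation Q.1).measurable)

theorem wavelet_flipAt {𝕜 : Type*} [RCLike 𝕜] {κ : ℤ} {Q : CubeIdx d} (h : κ < Q.1)
    (e : Fin d → Fin 2) (ω : Omega d) (ψ : Eta d → Pt d → 𝕜) (η : Eta d) :
    wavelet ψ (flipAt (κ + 1) e ω) Q η = wavelet ψ ω Q η := by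
  funext x
  rw [wavelet, wavelet, translation_flipAt_of_le (by omega)]

/-- The indicator of the event that the common ancestor of `P ∔ ω` and `Q ∔ ω` is good. -/
noncomputable def pairGood (m : ℝ) (P Q : CubeIdx d) (ω : Omega d) : ℝ :=
  goodInd (ancLevel m P Q) (corner ω Q) ω

/-- The common ancestor of `P ∔ ω` and `Q ∔ ω` in the good event. -/
noncomputable def commonAnc (m : ℝ) (ω : Omega d) (P Q : CubeIdx d) : CubeIdx d :=
  cellIdx ω (ancLevel m P Q) (corner ω Q)

theorem side_commonAnc (m : ℝ) (ω : Omega d) (P Q : CubeIdx d) :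
    side (commonAnc m ω P Q) = (2 : ℝ) ^ (-ancLevel m P Q) := rfl

theorem dilatedCube_subset_commonAnc {m : ℝ} (hm : 1 ≤ m) {ω : Omega d} {P Q : CubeIdx d}
    (h : pairGood m P Q ω ≠ 0) :
    dilatedCube m ω P ⊆ cube ω (commonAnc m ω P Q) ∧
      dilatedCube m ω Q ⊆ cube ω (commonAnc m ω P Q) :=
  have := closedBall_subset_of_goodInd h (sepRadius_le_zpow m P Q)
  ⟨(dilatedCube_left_subset hm ω P Q).trans this, (dilatedCube_right_subset hm ω P Q).trans this⟩

end Cubes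

/-! ## Construction of the shifts -/

section Shifts

/-- The vectors span pairwise orthogonal lines, for which unconditional convergence is square
summability of the norms. -/
theorem summable_of_pairwise_inner_eq_zero {𝕜 E ι : Type*} [RCLike 𝕜] [NormedAddCommGroup E]
    [InnerProductSpace 𝕜 E] [CompleteSpace E] {x : ι → E}
    (hx : Pairwise fun i j => inner 𝕜 (x i) (x j) = 0) (hs : Summable fun i => ‖x i‖ ^ 2) :
    Summable x := by
  have ho : OrthogonalFamily 𝕜 (fun i => (𝕜 ∙ x i : Submodule 𝕜 E))
      fun i => (𝕜 ∙ x i : Submodule 𝕜 E).subtypeₗᵢ := by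
    intro i j hij v w
    obtain ⟨a, ha⟩ := Submodule.mem_span_singleton.1 v.2
    obtain ⟨b, hb⟩ := Submodule.mem_span_singleton.1 w.2
    simp [← ha, ← hb, inner_smul_left, inner_smul_right, hx hij]
  exact (ho.summable_iff_norm_sq_summable fun i =>
    ⟨x i, Submodule.mem_span_singleton_self (x i)⟩).2 hs

variable {𝕜 : Type*} [RCLike 𝕜] {d : ℕ}

/-- The wavelet `ψ_I^η` as an element of `L²`, for `p = (I, η)`. -/
noncomputable def wav (ψ : Eta d → Pt d → 𝕜) (ω : Omega d) (p : CubeIdx d × Eta d) : L2 𝕜 d :=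
  toL2 (wavelet ψ ω p.1 p.2)

/-- The indices of the wavelets on the descendants of order `i` of `K`. -/
noncomputable def desc (ω : Omega d) (i : ℕ) (K : CubeIdx d) : Finset (CubeIdx d × Eta d) :=
  descendants ω i K ×ˢ Finset.univ

theorem mem_desc {ω : Omega d} {i : ℕ} {K : CubeIdx d} {p : CubeIdx d × Eta d} :
    p ∈ desc ω i K ↔ p.1 ∈ descendants ω i K := by
  simp [desc]

theorem desc_eq_of_mem {ω : Omega d} {i : ℕ} {K K' : CubeIdx d} {p : CubeIdx d × Eta d}
    (h : p ∈ desc ω i K) (h' : p ∈ desc ω i K') : K = K' := by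
  rw [eq_cellIdx_of_mem_descendants (mem_desc.1 h), eq_cellIdx_of_mem_descendants (mem_desc.1 h')]

theorem card_desc_le (ω : Omega d) (i : ℕ) (K : CubeIdx d) :
    ((desc ω i K).card : ℝ) ≤ (2 ^ i) ^ d * Fintype.card (Eta d) := by
  rw [desc, Finset.card_product, Finset.card_univ]
  push_cast
  gcongr
  exact_mod_cast card_descendants_le ω i K

theorem blockOp_eq (ψ : Eta d → Pt d → 𝕜) (ω : Omega d) (i j : ℕ)
    (a : CubeIdx d × Eta d → CubeIdx d × Eta d → CubeIdx d → 𝕜) (K : CubeIdx d) (f : L2 𝕜 d) :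
    blockOp ψ ω i j a K f = ∑ p ∈ desc ω i K, ∑ q ∈ desc ω j K,
      (a p q K * inner 𝕜 (wav ψ ω p) f) • wav ψ ω q := by
  rw [desc, Finset.sum_product]
  refine Finset.sum_congr rfl fun I _ => ?_
  simp_rw [desc, Finset.sum_product]
  rw [Finset.sum_comm]
  rfl

/-- The operator `f ↦ blockOp ψ ω i j a K f` as a continuous linear map. -/
noncomputable def blockCLM (ψ : Eta d → Pt d → 𝕜) (ω : Omega d) (i j : ℕ)
    (a : CubeIdx d × Eta d → CubeIdx d × Eta d → CubeIdx d → 𝕜) (K : CubeIdx d) :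
    L2 𝕜 d →L[𝕜] L2 𝕜 d :=
  ∑ p ∈ desc ω i K, ∑ q ∈ desc ω j K,
    a p q K • (innerSL 𝕜 (wav ψ ω p)).smulRight (wav ψ ω q)

theorem blockCLM_apply (ψ : Eta d → Pt d → 𝕜) (ω : Omega d) (i j : ℕ)
    (a : CubeIdx d × Eta d → CubeIdx d × Eta d → CubeIdx d → 𝕜) (K : CubeIdx d) (f : L2 𝕜 d) :
    blockCLM ψ ω i j a K f = blockOp ψ ω i j a K f := by
  rw [blockOp_eq]
  simp [blockCLM, smul_smul]

variable {ψ : Eta d → Pt d → 𝕜} {ω : Omega d} {i j : ℕ}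
  {a : CubeIdx d × Eta d → CubeIdx d × Eta d → CubeIdx d → 𝕜}

/-- A cube determines its ancestor of a given generation, so blocks with different `K` take values
in the spans of disjoint sets of wavelets. -/
theorem inner_blockOp_eq_zero (ho : Orthonormal 𝕜 (wav ψ ω)) {K K' : CubeIdx d} (h : K ≠ K')
    (f : L2 𝕜 d) : inner 𝕜 (blockOp ψ ω i j a K f) (blockOp ψ ω i j a K' f) = 0 := by
  simp only [blockOp_eq, sum_inner, inner_sum, inner_smul_left, inner_smul_right]
  refine Finset.sum_eq_zero fun p _ => Finset.sum_eq_zero fun q hq => mul_eq_zero_of_right _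
    (Finset.sum_eq_zero fun p' _ => Finset.sum_eq_zero fun q' hq' => mul_eq_zero_of_right _
      (ho.2 fun he => h (desc_eq_of_mem hq' (he ▸ hq))))

/-- A crude Cauchy–Schwarz bound. Its constant grows with `i` and `j`, which is harmless: it only
serves the convergence of one shift at a time. -/
theorem norm_blockOp_sq_le (ho : Orthonormal 𝕜 (wav ψ ω))
    (ha : ∀ K, ∀ p ∈ desc ω i K, ∀ q ∈ desc ω j K, ‖a p q K‖ ≤ 1) (K : CubeIdx d) (f : L2 𝕜 d) :
    ‖blockOp ψ ω i j a K f‖ ^ 2 ≤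
      ((2 ^ j) ^ d * Fintype.card (Eta d)) ^ 2 * ((2 ^ i) ^ d * Fintype.card (Eta d)) *
        ∑ p ∈ desc ω i K, ‖inner 𝕜 (wav ψ ω p) f‖ ^ 2 := by
  have h1 : ‖blockOp ψ ω i j a K f‖ ≤
      ((2 ^ j) ^ d * Fintype.card (Eta d)) * ∑ p ∈ desc ω i K, ‖inner 𝕜 (wav ψ ω p) f‖ := by
    rw [blockOp_eq, Finset.mul_sum]
    refine norm_sum_le_of_le _ fun p hp => ?_
    calc _ ≤ ∑ q ∈ desc ω j K, ‖inner 𝕜 (wav ψ ω p) f‖ := norm_sum_le_of_le _ fun q hq => by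
            rw [norm_smul, norm_mul, ho.1 q, mul_one]
            exact mul_le_of_le_one_left (norm_nonneg _) (ha K p hp q hq)
      _ = (desc ω j K).card * ‖inner 𝕜 (wav ψ ω p) f‖ := by simp
      _ ≤ _ := by gcongr; exact card_desc_le ω j K
  have h2 := sq_sum_le_card_mul_sum_sq (s := desc ω i K) (f := fun p => ‖inner 𝕜 (wav ψ ω p) f‖)
  calc _ ≤ _ := pow_le_pow_left₀ (norm_nonneg _) h1 2
    _ ≤ _ := by
      rw [mul_pow, mul_assoc]
      refine mul_le_mul_of_nonneg_left (h2.trans ?_) (by positivity)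
      exact mul_le_mul_of_nonneg_right (card_desc_le ω i K) (by positivity)

theorem summable_blockOp (ho : Orthonormal 𝕜 (wav ψ ω))
    (ha : ∀ K, ∀ p ∈ desc ω i K, ∀ q ∈ desc ω j K, ‖a p q K‖ ≤ 1) (f : L2 𝕜 d) :
    Summable fun K => blockOp ψ ω i j a K f := by
  classical
  refine summable_of_pairwise_inner_eq_zero (fun K K' h => inner_blockOp_eq_zero ho h f) ?_
  refine Summable.of_nonneg_of_le (fun _ => by positivity) (fun K => norm_blockOp_sq_le ho ha K f) ?_
  refine Summable.mul_left _ (summable_of_sum_le (c := ‖f‖ ^ 2) (fun _ => by positivity) fun s => ?_)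
  -- The wavelets below different `K` are disjoint families, so all block sums together are
  -- controlled by Bessel's inequality.
  rw [← Finset.sum_biUnion fun K _ K' _ hne => Finset.disjoint_left.2 fun p hp hp' =>
    hne (desc_eq_of_mem hp hp')]
  exact ho.sum_inner_products_le f

/-- The partial sums are bounded operators that converge pointwise, so the limit is bounded by the
uniform boundedness principle. -/
theorem exists_hasSum_blockOp (ho : Orthonormal 𝕜 (wav ψ ω))
    (ha : ∀ K, ∀ p ∈ desc ω i K, ∀ q ∈ desc ω j K, ‖a p q K‖ ≤ 1) :
    ∃ S : L2 𝕜 d →L[𝕜] L2 𝕜 d, ∀ f, HasSum (fun K => blockOp ψ ω i j a K f) (S f) := by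
  have ht : Filter.Tendsto (fun (s : Finset (CubeIdx d)) (f : L2 𝕜 d) =>
      (∑ K ∈ s, blockCLM ψ ω i j a K) f) Filter.atTop
      (nhds fun f => ∑' K, blockOp ψ ω i j a K f) := by
    refine tendsto_pi_nhds.2 fun f => ?_
    have h := (summable_blockOp ho ha f).hasSum
    simp only [HasSum, SummationFilter.unconditional_filter] at h
    simpa [blockCLM_apply] using h
  exact ⟨continuousLinearMapOfTendsto (fun s : Finset (CubeIdx d) =>
    ∑ K ∈ s, blockCLM ψ ω i j a K) ht, fun f => (summable_blockOp ho ha f).hasSum⟩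

end Shifts

/-! ## Taylor polynomials -/

section Taylor

/-- Taylor's inequality for a sequence of successive derivatives on `[0, 1]`. -/
theorem norm_sub_sum_le_of_hasDerivAt {G : Type*} [NormedAddCommGroup G] [NormedSpace ℝ G] {M : ℝ} :
    ∀ (n : ℕ) (g : ℕ → ℝ → G),
      (∀ k < n, ∀ t ∈ Set.Icc (0 : ℝ) 1, HasDerivAt (g k) (g (k + 1) t) t) →
      (∀ t ∈ Set.Icc (0 : ℝ) 1, ‖g n t‖ ≤ M) →
      ∀ t ∈ Set.Icc (0 : ℝ) 1,
        ‖g 0 t - ∑ l ∈ Finset.range n, (t ^ l / (l.factorial : ℝ)) • g l 0‖ ≤ M := by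
  intro n
  induction n with
  | zero => intro g _ hM t ht; simpa using hM t ht
  | succ n ih =>
    intro g hg hM t ht
    have hM0 : 0 ≤ M := (norm_nonneg _).trans (hM t ht)
    have hih := ih (fun k => g (k + 1)) (fun k hk => hg (k + 1) (by omega)) hM
    -- The derivative of the remainder of order `n + 1` is the remainder of order `n` of the shifted
    -- sequence, bounded by induction; the mean value inequality then needs no continuity of the top
    -- derivative.
    have hd : ∀ t ∈ Set.Icc (0 : ℝ) 1, HasDerivWithinAt
        (fun t => g 0 t - ∑ l ∈ Finset.range (n + 1), (t ^ l / (l.factorial : ℝ)) • g l 0)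
        (g 1 t - ∑ l ∈ Finset.range n, (t ^ l / (l.factorial : ℝ)) • g (l + 1) 0)
        (Set.Icc 0 1) t := fun t ht => by
      refine ((hg 0 (by omega) t ht).sub ?_).hasDerivWithinAt
      simp_rw [Finset.sum_range_succ']
      have : HasDerivAt (fun t : ℝ => ∑ l ∈ Finset.range n,
          (t ^ (l + 1) / ((l + 1).factorial : ℝ)) • g (l + 1) 0)
          (∑ l ∈ Finset.range n, (t ^ l / (l.factorial : ℝ)) • g (l + 1) 0) t := by
        refine HasDerivAt.fun_sum fun l _ => HasDerivAt.smul_const ?_ _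
        convert (hasDerivAt_pow (l + 1) t).div_const (((l + 1).factorial : ℕ) : ℝ) using 1
        rw [Nat.factorial_succ]
        push_cast
        have h1 : (l.factorial : ℝ) ≠ 0 := by positivity
        have h2 : ((l : ℝ) + 1) ≠ 0 := by positivity
        field_simp
      simpa using this.add_const (g 0 0)
    have := norm_image_sub_le_of_norm_deriv_le_segment' hd
      (fun t ht => hih t ⟨ht.1, ht.2.le⟩) t ht
    simp only [Finset.sum_range_succ', pow_zero, Nat.factorial_zero, Nat.cast_one, div_one,
      one_smul, ne_eq, Nat.add_eq_zero_iff, one_ne_zero, and_false, not_false_eq_true, zero_pow,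
      zero_div, zero_smul, Finset.sum_const_zero, zero_add, sub_self, sub_zero] at this
    simp only [Finset.sum_range_succ', pow_zero, Nat.factorial_zero, Nat.cast_one, div_one,
      one_smul]
    exact this.trans (mul_le_of_le_one_right hM0 ht.2)

variable {d : ℕ} {E : Type*} [NormedAddCommGroup E] [NormedSpace ℝ E]
  {G : Type*} [NormedAddCommGroup G] [NormedSpace ℝ G]

theorem hasDerivAt_iteratedFDeriv_line {F : E → G} {k : ℕ} {x v : E} {t : ℝ}
    (h : DifferentiableAt ℝ (iteratedFDeriv ℝ k F) (x + t • v)) :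
    HasDerivAt (fun t : ℝ => iteratedFDeriv ℝ k F (x + t • v) fun _ => v)
      (iteratedFDeriv ℝ (k + 1) F (x + t • v) fun _ => v) t := by
  have h1 : HasDerivAt (fun t : ℝ => x + t • v) v t := by
    simpa using ((hasDerivAt_id t).smul_const v).const_add x
  have h2 := h.hasFDerivAt.comp_hasDerivAt t h1
  have h3 := (ContinuousMultilinearMap.apply ℝ (fun _ : Fin k => E) G
    (fun _ => v)).hasFDerivAt.comp_hasDerivAt t h2
  rw [iteratedFDeriv_succ_apply_left]
  exact h3

theorem map_sum_smul_const {k : ℕ} (A : ContinuousMultilinearMap ℝ (fun _ : Fin k => E) G)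
    (e : Fin d → E) (u : Pt d) :
    A (fun _ => ∑ i, u i • e i) =
      ∑ w : Fin k → Fin d, (∏ a, u (w a)) • A fun a => e (w a) := by
  rw [A.map_sum]
  refine Finset.sum_congr rfl fun w _ => ?_
  exact A.map_smul_univ (fun a => u (w a)) (fun a => e (w a))

theorem abs_prod_le_norm_pow {k : ℕ} (u : Pt d) (w : Fin k → Fin d) :
    |∏ a, u (w a)| ≤ ‖u‖ ^ k := by
  rw [Finset.abs_prod]
  calc _ ≤ ∏ _a : Fin k, ‖u‖ :=
        Finset.prod_le_prod (fun _ _ => abs_nonneg _) fun a _ => norm_le_pi_norm u (w a)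
    _ = _ := by simp

theorem norm_map_sum_smul_const_le {k : ℕ}
    (A : ContinuousMultilinearMap ℝ (fun _ : Fin k => E) G) (e : Fin d → E) (u : Pt d) {M : ℝ}
    (hM : ∀ w : Fin k → Fin d, ‖A fun a => e (w a)‖ ≤ M) :
    ‖A (fun _ => ∑ i, u i • e i)‖ ≤ (d * ‖u‖) ^ k * M := by
  rw [map_sum_smul_const]
  calc _ ≤ ∑ _w : Fin k → Fin d, ‖u‖ ^ k * M := norm_sum_le_of_le _ fun w _ => by
        rw [norm_smul]
        exact mul_le_mul (abs_prod_le_norm_pow u w) (hM w) (norm_nonneg _) (by positivity)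
    _ = _ := by simp [mul_pow]; ring

variable {𝕜 : Type*} [RCLike 𝕜]

/-- The Taylor polynomial of degree less than `n` of `F` at `x`, in the directions `e`, as a
polynomial in the displaced variable `y - c`. -/
noncomputable def taylorMv (n : ℕ) (F : E → 𝕜) (x : E) (e : Fin d → E) (c : Pt d) :
    MvPolynomial (Fin d) 𝕜 :=
  ∑ k ∈ Finset.range n, ∑ w : Fin k → Fin d,
    MvPolynomial.C (((k.factorial : ℝ)⁻¹ : ℝ) • iteratedFDeriv ℝ k F x fun a => e (w a)) *
      ∏ a, (MvPolynomial.X (w a) - MvPolynomial.C ((c (w a) : ℝ) : 𝕜))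

theorem totalDegree_taylorMv_lt {n : ℕ} (hn : 0 < n) (F : E → 𝕜) (x : E) (e : Fin d → E)
    (c : Pt d) : (taylorMv n F x e c).totalDegree < n := by
  suffices h : (taylorMv n F x e c).totalDegree ≤ n - 1 by omega
  refine MvPolynomial.totalDegree_finsetSum_le fun k hk =>
    MvPolynomial.totalDegree_finsetSum_le fun w _ => ?_
  refine (MvPolynomial.totalDegree_mul _ _).trans ?_
  rw [MvPolynomial.totalDegree_C, zero_add]
  refine (MvPolynomial.totalDegree_finsetProd _ _).trans ?_
  have : ∀ a ∈ (Finset.univ : Finset (Fin k)),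
      (MvPolynomial.X (w a) - MvPolynomial.C ((c (w a) : ℝ) : 𝕜) :
        MvPolynomial (Fin d) 𝕜).totalDegree ≤ 1 := fun a _ =>
    (MvPolynomial.totalDegree_sub_C_le _ _).trans (by rw [MvPolynomial.totalDegree_X])
  refine (Finset.sum_le_sum this).trans ?_
  have := Finset.mem_range.1 hk
  simp
  omega

theorem polyFn_taylorMv (n : ℕ) (F : E → 𝕜) (x : E) (e : Fin d → E) (c y : Pt d) :
    polyFn (taylorMv n F x e c) y = ∑ k ∈ Finset.range n,
      ((k.factorial : ℝ)⁻¹ : ℝ) • iteratedFDeriv ℝ k F x fun _ => ∑ i, (y i - c i) • e i := by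
  simp only [polyFn, taylorMv, map_sum, map_mul, map_prod, map_sub, MvPolynomial.eval_C,
    MvPolynomial.eval_X]
  refine Finset.sum_congr rfl fun k _ => ?_
  rw [map_sum_smul_const _ e (fun i => y i - c i), Finset.smul_sum]
  refine Finset.sum_congr rfl fun w _ => ?_
  simp only [RCLike.real_smul_eq_coe_mul, RCLike.ofReal_prod, RCLike.ofReal_sub]
  ring

theorem norm_sub_taylorMv_le {n : ℕ} {F : E → 𝕜} {U : Set E} (hF : TimesDifferentiableOn n F U)
    {x : E} {e : Fin d → E} {c y : Pt d}
    (hU : ∀ t ∈ Set.Icc (0 : ℝ) 1, x + t • ∑ i, (y i - c i) • e i ∈ U) {M : ℝ}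
    (hM : ∀ t ∈ Set.Icc (0 : ℝ) 1, ∀ w : Fin n → Fin d,
      ‖iteratedFDeriv ℝ n F (x + t • ∑ i, (y i - c i) • e i) fun a => e (w a)‖ ≤ M) :
    ‖F (x + ∑ i, (y i - c i) • e i) - polyFn (taylorMv n F x e c) y‖ ≤
      (d * ‖y - c‖) ^ n * M := by
  have := norm_sub_sum_le_of_hasDerivAt n
    (fun k t => iteratedFDeriv ℝ k F (x + t • ∑ i, (y i - c i) • e i)
      fun _ => ∑ i, (y i - c i) • e i)
    (fun k hk t ht => hasDerivAt_iteratedFDeriv_line (hF k hk _ (hU t ht)))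
    (fun t ht => norm_map_sum_smul_const_le _ e (y - c) (hM t ht)) 1 (by simp)
  simpa [polyFn_taylorMv] using this

theorem norm_taylorMv_le {n : ℕ} {F : E → 𝕜} {x : E} {e : Fin d → E} {c y : Pt d} {M : ℕ → ℝ}
    (hM : ∀ k < n, ∀ w : Fin k → Fin d, ‖iteratedFDeriv ℝ k F x fun a => e (w a)‖ ≤ M k) :
    ‖polyFn (taylorMv n F x e c) y‖ ≤ ∑ k ∈ Finset.range n, (d * ‖y - c‖) ^ k * M k := by
  rw [polyFn_taylorMv]
  refine norm_sum_le_of_le _ fun k hk => ?_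
  rw [norm_smul, norm_inv, Real.norm_natCast]
  refine (mul_le_of_le_one_left (norm_nonneg _) (inv_le_one_of_one_le₀ ?_)).trans
    (norm_map_sum_smul_const_le _ e (y - c) (hM k (Finset.mem_range.1 hk)))
  exact_mod_cast k.factorial_pos

theorem continuous_polyFn (p : MvPolynomial (Fin d) 𝕜) : Continuous (polyFn p) := by
  have : polyFn p = fun x : Pt d => ∑ m ∈ p.support, p.coeff m * ∏ i, ((x i : ℝ) : 𝕜) ^ m i := by
    funext x; exact MvPolynomial.eval_eq' _ _
  rw [this]
  fun_prop

theorem integrable_continuous_mul {φ g : Pt d → 𝕜} (hφ : MemLp φ 2 volume)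
    (hc : HasCompactSupport φ) (hg : Continuous g) : Integrable fun x => g x * φ x := by
  have h1 : Integrable φ := by
    have : IntegrableOn φ (tsupport φ) := by
      have := isFiniteMeasure_restrict.2 (hc.isCompact.measure_ne_top (μ := volume))
      exact (hφ.restrict (tsupport φ)).integrable (by norm_num)
    exact (integrableOn_iff_integrable_of_support_subset (subset_tsupport φ)).1 this
  have h2 : IntegrableOn (fun x => g x * φ x) (tsupport φ) :=
    h1.integrableOn.continuousOn_mul hg.continuousOn hc.isCompact
  refine (integrableOn_iff_integrable_of_support_subset ?_).1 h2
  exact (Function.support_mul_subset_right _ _).trans (subset_tsupport φ)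

theorem HasVanishingMoments.integral_polyFn_mul {n : ℕ} {φ : Pt d → 𝕜}
    (hv : HasVanishingMoments n φ) (hφ : MemLp φ 2 volume) (hc : HasCompactSupport φ)
    {p : MvPolynomial (Fin d) 𝕜} (hp : p.totalDegree < n) : ∫ x, polyFn p x * φ x = 0 := by
  have h : ∀ x, polyFn p x * φ x =
      ∑ m ∈ p.support, p.coeff m * (((monomialFn m x : ℝ) : 𝕜) * φ x) := fun x => by
    rw [polyFn, MvPolynomial.eval_eq', Finset.sum_mul]
    simp [monomialFn, mul_assoc]
  simp_rw [h]
  rw [integral_finsetSum]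
  · refine Finset.sum_eq_zero fun m hm => ?_
    rw [integral_const_mul, hv m, mul_zero]
    refine lt_of_le_of_lt ?_ hp
    have := MvPolynomial.le_totalDegree hm
    rwa [Finsupp.sum_fintype _ _ (fun _ => rfl)] at this
  · intro m _
    refine (integrable_continuous_mul hφ hc ?_).const_mul _
    unfold monomialFn
    fun_prop

end Taylor

/-! ## Kernels -/

section Kernels

variable {𝕜 : Type*} [RCLike 𝕜] {d : ℕ}

theorem coe_toL2 {f : Pt d → 𝕜} (hf : MemLp f 2 volume) : (toL2 f : Pt d → 𝕜) =ᵐ[volume] f := by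
  rw [toL2, dif_pos hf]
  exact hf.coeFn_toLp

theorem inner_toL2_left {f : Pt d → 𝕜} (hf : MemLp f 2 volume) (w : L2 𝕜 d) :
    inner 𝕜 (toL2 f) w = ∫ x, conj (f x) * w x := by
  rw [L2.inner_def]
  refine integral_congr_ae ?_
  filter_upwards [coe_toL2 hf] with x hx
  rw [RCLike.inner_apply, hx, mul_comm]

theorem inner_toL2_right {f : Pt d → 𝕜} (hf : MemLp f 2 volume) (w : L2 𝕜 d) :
    inner 𝕜 w (toL2 f) = ∫ x, conj (w x) * f x := by
  rw [L2.inner_def]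
  refine integral_congr_ae ?_
  filter_upwards [coe_toL2 hf] with x hx
  rw [RCLike.inner_apply, hx, mul_comm]

theorem KernelBound.nonneg_set_nonempty {s : ℕ} {K : Pt d → Pt d → 𝕜} (hK : IsCZKernel s K) :
    {A : ℝ | 0 ≤ A ∧ KernelBound s K A}.Nonempty := by
  obtain ⟨A, hA⟩ := hK.2
  refine ⟨max A 0, le_max_right _ _, fun k hk w x y hxy => (hA k hk w x y hxy).trans ?_⟩
  gcongr
  exact le_max_left _ _

theorem czNorm_nonneg (s : ℕ) (K : Pt d → Pt d → 𝕜) : 0 ≤ czNorm s K :=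
  Real.sInf_nonneg fun _ h => h.1

/-- Each single estimate is a closed condition on the constant, so the infimum is itself admissible.
-/
theorem kernelBound_czNorm {s : ℕ} {K : Pt d → Pt d → 𝕜} (hK : IsCZKernel s K) :
    KernelBound s K (czNorm s K) := fun k hk w x y hxy => by
  have hpos : 0 < ‖x - y‖ ^ (d + k) := pow_pos (norm_pos_iff.2 (sub_ne_zero.2 hxy)) _
  rw [le_div_iff₀ hpos]
  refine le_csInf (KernelBound.nonneg_set_nonempty hK) fun A hA => ?_
  exact (le_div_iff₀ hpos).1 (hA.2 k hk w x y hxy)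

theorem IsCZKernel.continuousOn {s : ℕ} (hs : 0 < s) {K : Pt d → Pt d → 𝕜} (hK : IsCZKernel s K) :
    ContinuousOn (fun p : Pt d × Pt d => K p.1 p.2) {p | p.1 ≠ p.2} := fun p hp => by
  have h := (hK.1 0 hs p hp).continuousAt
  have h2 : (fun p : Pt d × Pt d => K p.1 p.2) = fun p =>
      iteratedFDeriv ℝ 0 (fun p : Pt d × Pt d => K p.1 p.2) p 0 := by
    funext p; simp
  rw [h2]
  exact ((ContinuousMultilinearMap.apply ℝ (fun _ : Fin 0 => Pt d × Pt d) 𝕜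
    0).continuous.continuousAt.comp h).continuousWithinAt

/-- The functions `K x` are approximated by polynomials of degree less than `s`, as by their
Taylor polynomials. -/
def TaylorKernel (s : ℕ) (K : Pt d → Pt d → 𝕜) (B : ℝ) : Prop :=
  ∀ x c : Pt d, x ≠ c → ∃ p : MvPolynomial (Fin d) 𝕜, p.totalDegree < s ∧
    ∀ y, 2 * ‖y - c‖ ≤ ‖x - c‖ → ‖K x y - polyFn p y‖ ≤ B * ‖y - c‖ ^ s / ‖x - c‖ ^ (d + s)

theorem half_norm_le_norm_sub_line {x c y : Pt d} (h : 2 * ‖y - c‖ ≤ ‖x - c‖) {t : ℝ}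
    (ht : t ∈ Set.Icc (0 : ℝ) 1) : ‖x - c‖ / 2 ≤ ‖x - (c + t • (y - c))‖ := by
  have h1 : ‖t • (y - c)‖ ≤ ‖y - c‖ := by
    rw [norm_smul, Real.norm_of_nonneg ht.1]
    exact mul_le_of_le_one_left (norm_nonneg _) ht.2
  have h2 := norm_sub_norm_le (x - c) (t • (y - c))
  rw [sub_sub] at h2
  linarith

theorem sum_smul_inr (u : Pt d) :
    ∑ i, u i • (pairBasis (Sum.inr i) : Pt d × Pt d) = (0, u) := by
  ext j
  · simp [pairBasis, Prod.fst_sum]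
  · simp [pairBasis, Prod.snd_sum, Finset.sum_apply, Pi.single_apply]

theorem sum_smul_inl (u : Pt d) :
    ∑ i, u i • (pairBasis (Sum.inl i) : Pt d × Pt d) = (u, 0) := by
  ext j
  · simp [pairBasis, Prod.fst_sum, Finset.sum_apply, Pi.single_apply]
  · simp [pairBasis, Prod.snd_sum]

theorem taylor_const_eq {s : ℕ} {A r ρ : ℝ} :
    (d * r) ^ s * (A / (ρ / 2) ^ (d + s)) = (A * d ^ s * 2 ^ (d + s)) * r ^ s / ρ ^ (d + s) := by
  rw [div_pow, mul_pow]
  by_cases h : ρ ^ (d + s) = 0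
  · simp [h]
  · field_simp

/-- The segment from `c` to `y` keeps distance at least `|x - c| / 2` from `x`, which bounds the
derivatives of order `s` along it by `A (|x - c| / 2)^{-d-s}`. -/
theorem taylorKernel_of_bound {s : ℕ} (hs : 0 < s) {K : Pt d → Pt d → 𝕜} {A : ℝ} (hA0 : 0 ≤ A)
    (hK : TimesDifferentiableOn s (fun p : Pt d × Pt d => K p.1 p.2) {p | p.1 ≠ p.2})
    (hA : KernelBound s K A) : TaylorKernel s K (A * d ^ s * 2 ^ (d + s)) := by
  intro x c hxc
  have hpos : 0 < ‖x - c‖ := norm_pos_iff.2 (sub_ne_zero.2 hxc)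
  refine ⟨taylorMv s (fun p : Pt d × Pt d => K p.1 p.2) (x, c) (fun i => pairBasis (Sum.inr i)) c,
    totalDegree_taylorMv_lt hs _ _ _ _, fun y hy => ?_⟩
  have hv : ∑ i, (y i - c i) • (pairBasis (Sum.inr i) : Pt d × Pt d) = (0, y - c) :=
    sum_smul_inr (y - c)
  have hp : ∀ t : ℝ, ((x, c) : Pt d × Pt d) + t • ((0 : Pt d), y - c) = (x, c + t • (y - c)) :=
    fun t => by ext <;> simp
  have hne : ∀ t ∈ Set.Icc (0 : ℝ) 1, x ≠ c + t • (y - c) := fun t ht h => by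
    have := half_norm_le_norm_sub_line hy ht
    rw [← h, sub_self, norm_zero] at this
    linarith
  have h1 : ‖K x y - polyFn (taylorMv s (fun p : Pt d × Pt d => K p.1 p.2) (x, c)
      (fun i => pairBasis (Sum.inr i)) c) y‖ ≤
        (d * ‖y - c‖) ^ s * (A / (‖x - c‖ / 2) ^ (d + s)) := by
    have := norm_sub_taylorMv_le hK (x := (x, c)) (e := fun i => pairBasis (Sum.inr i))
      (c := c) (y := y) (M := A / (‖x - c‖ / 2) ^ (d + s)) (fun t ht => by
        rw [hv, hp]; exact hne t ht) (fun t ht w => by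
        rw [hv, hp]
        refine (hA s le_rfl (fun a => Sum.inr (w a)) _ _ (hne t ht)).trans ?_
        have := half_norm_le_norm_sub_line hy ht
        gcongr)
    simpa [hv] using this
  rwa [taylor_const_eq] at h1

theorem polyFn_map_conj (p : MvPolynomial (Fin d) 𝕜) (x : Pt d) :
    polyFn (p.map (starRingEnd 𝕜)) x = conj (polyFn p x) := by
  simp only [polyFn]
  rw [MvPolynomial.eval_map, ← MvPolynomial.coe_eval₂Hom, MvPolynomial.eval,
    ← RingHom.comp_apply]
  congr 1
  refine MvPolynomial.ringHom_ext (fun r => ?_) fun i => ?_ <;> simp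

/-- The expansion is made for `K` in its first variable, and the coefficients are conjugated
afterwards. Thus the kernel of `T*` is treated without differentiating it. -/
theorem taylorKernel_adjoint_of_bound {s : ℕ} (hs : 0 < s) {K : Pt d → Pt d → 𝕜} {A : ℝ}
    (hA0 : 0 ≤ A)
    (hK : TimesDifferentiableOn s (fun p : Pt d × Pt d => K p.1 p.2) {p | p.1 ≠ p.2})
    (hA : KernelBound s K A) :
    TaylorKernel s (fun x y => conj (K y x)) (A * d ^ s * 2 ^ (d + s)) := by
  intro x c hxc
  have hpos : 0 < ‖x - c‖ := norm_pos_iff.2 (sub_ne_zero.2 hxc)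
  refine ⟨(taylorMv s (fun p : Pt d × Pt d => K p.1 p.2) (c, x)
    (fun i => pairBasis (Sum.inl i)) c).map (starRingEnd 𝕜),
    (MvPolynomial.totalDegree_le_of_support_subset (MvPolynomial.support_map_subset _ _)).trans_lt (totalDegree_taylorMv_lt hs _ _ _ _),
    fun y hy => ?_⟩
  have hv : ∑ i, (y i - c i) • (pairBasis (Sum.inl i) : Pt d × Pt d) = (y - c, 0) :=
    sum_smul_inl (y - c)
  have hp : ∀ t : ℝ, ((c, x) : Pt d × Pt d) + t • (y - c, (0 : Pt d)) = (c + t • (y - c), x) :=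
    fun t => by ext <;> simp
  have hne : ∀ t ∈ Set.Icc (0 : ℝ) 1, c + t • (y - c) ≠ x := fun t ht h => by
    have := half_norm_le_norm_sub_line hy ht
    rw [h, sub_self, norm_zero] at this
    linarith
  have h1 : ‖K y x - polyFn (taylorMv s (fun p : Pt d × Pt d => K p.1 p.2) (c, x)
      (fun i => pairBasis (Sum.inl i)) c) y‖ ≤
        (d * ‖y - c‖) ^ s * (A / (‖x - c‖ / 2) ^ (d + s)) := by
    have := norm_sub_taylorMv_le hK (x := (c, x)) (e := fun i => pairBasis (Sum.inl i))
      (c := c) (y := y) (M := A / (‖x - c‖ / 2) ^ (d + s)) (fun t ht => by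
        rw [hv, hp]; exact hne t ht) (fun t ht w => by
        rw [hv, hp]
        refine (hA s le_rfl (fun a => Sum.inl (w a)) _ _ (hne t ht)).trans ?_
        have := half_norm_le_norm_sub_line hy ht
        rw [norm_sub_rev (c + t • (y - c))]
        gcongr)
    simpa [hv] using this
  rw [polyFn_map_conj, ← map_sub, RCLike.norm_conj, ← taylor_const_eq]
  exact h1

theorem integrable_of_memLp_of_hasCompactSupport {φ : Pt d → 𝕜} (hφ : MemLp φ 2 volume)
    (hc : HasCompactSupport φ) : Integrable φ := by
  simpa using integrable_continuous_mul hφ hc (g := fun _ => 1) continuous_const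

/-- Testing `T* f` against indicators of sets away from `supp f` moves `T` onto the indicator, where
its kernel applies. The kernel is bounded on products of disjoint compact sets, so Fubini's theorem
identifies the integrals of `T* f` and of the expected function. -/
theorem HasKernel.adjoint {T : L2 𝕜 d →L[𝕜] L2 𝕜 d} {K : Pt d → Pt d → 𝕜} (h : HasKernel T K)
    (hK : ContinuousOn (fun p : Pt d × Pt d => K p.1 p.2) {p | p.1 ≠ p.2}) :
    HasKernel (ContinuousLinearMap.adjoint T) fun x y => conj (K y x) := by
  intro f hf hfc
  set F := tsupport f
  have hFm : MeasurableSet F := (isClosed_tsupport f).measurableSet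
  set v : L2 𝕜 d := ContinuousLinearMap.adjoint T (toL2 f)
  set u : Pt d → 𝕜 := fun y => ∫ x, conj (K x y) * f x
  have hfi := integrable_of_memLp_of_hasCompactSupport hf hfc
  have huF : ∀ y, u y = ∫ x in F, conj (K x y) * f x := fun y =>
    (setIntegral_eq_integral_of_forall_compl_eq_zero fun x hx => by
      rw [image_eq_zero_of_notMem_tsupport hx, mul_zero]).symm
  have key : ∀ U : Set (Pt d), IsCompact U → Disjoint F U →
      ∀ᵐ y ∂volume.restrict U, (v : Pt d → 𝕜) y = u y := by
    intro U hU hFU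
    have hUm := hU.measurableSet
    have hfin : IsFiniteMeasure (volume.restrict U : Measure (Pt d)) :=
      isFiniteMeasure_restrict.2 hU.measure_ne_top
    have hfinF : IsFiniteMeasure (volume.restrict F : Measure (Pt d)) :=
      isFiniteMeasure_restrict.2 hfc.isCompact.measure_ne_top
    have hsub : F ×ˢ U ⊆ {p : Pt d × Pt d | p.1 ≠ p.2} := fun p hp he =>
      Set.disjoint_left.1 hFU hp.1 (he ▸ hp.2)
    have hc2 : ContinuousOn (fun p : Pt d × Pt d => conj (K p.1 p.2)) (F ×ˢ U) :=
      RCLike.continuous_conj.comp_continuousOn (hK.mono hsub)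
    obtain ⟨B, hB⟩ := (hfc.isCompact.prod hU).exists_bound_of_continuousOn hc2
    have hH : Integrable (fun p : Pt d × Pt d => conj (K p.1 p.2) * f p.1)
        ((volume.restrict F).prod (volume.restrict U)) := by
      refine Integrable.bdd_mul (c := B) (hfi.integrableOn.comp_fst _) ?_ ?_
      · rw [Measure.prod_restrict]
        exact hc2.aestronglyMeasurable (hFm.prod hUm)
      · rw [Measure.prod_restrict]
        exact (ae_restrict_iff' (hFm.prod hUm)).2 (Filter.Eventually.of_forall hB)
    have hui : Integrable u (volume.restrict U) := by
      have := hH.integral_prod_right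
      simpa only [← huF] using this
    have hvi : Integrable v (volume.restrict U) :=
      ((Lp.memLp v).restrict U).integrable (by norm_num)
    refine hvi.ae_eq_of_forall_setIntegral_eq _ _ hui fun A hA _ => ?_
    rw [Measure.restrict_restrict hA]
    set V := A ∩ U
    have hVm : MeasurableSet V := hA.inter hUm
    have hVU : V ⊆ U := Set.inter_subset_right
    have hVfin : volume V ≠ ⊤ := ((measure_mono hVU).trans_lt hU.measure_lt_top).ne
    set φ : Pt d → 𝕜 := V.indicator fun _ => 1
    have hφ : MemLp φ 2 volume := memLp_indicator_const 2 hVm 1 (Or.inr hVfin)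
    have hsupp : tsupport φ ⊆ U := closure_minimal
      ((Set.support_indicator_subset).trans hVU) hU.isClosed
    have hφc : HasCompactSupport φ := hU.of_isClosed_subset (isClosed_tsupport _) hsupp
    have h1 : ∫ y in V, v y = inner 𝕜 (toL2 φ) v := by
      rw [inner_toL2_left hφ, ← integral_indicator hVm]
      refine integral_congr_ae (Filter.Eventually.of_forall fun y => ?_)
      by_cases hy : y ∈ V <;> simp [φ, hy]
    have h2 : inner 𝕜 (toL2 φ) v = ∫ x in F, ∫ y in V, conj (K x y) * f x := by
      rw [ContinuousLinearMap.adjoint_inner_right, inner_toL2_right hf,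
        ← setIntegral_eq_integral_of_forall_compl_eq_zero (s := F) fun x hx => by
          rw [image_eq_zero_of_notMem_tsupport hx, mul_zero]]
      refine setIntegral_congr_ae hFm ?_
      filter_upwards [h φ hφ hφc] with x hx hxF
      rw [hx fun hx' => Set.disjoint_left.1 hFU hxF (hsupp hx'), integral_mul_const]
      congr 1
      rw [← integral_conj, ← integral_indicator hVm]
      refine integral_congr_ae (Filter.Eventually.of_forall fun y => ?_)
      by_cases hy : y ∈ V <;> simp [φ, hy]
    have h3 : ∫ x in F, ∫ y in V, conj (K x y) * f x = ∫ y in V, u y := by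
      simp only [huF]
      refine integral_integral_swap ?_
      exact hH.mono_measure (Measure.prod_mono le_rfl (Measure.restrict_mono hVU le_rfl))
    rw [h1, h2, h3]
  -- Countably many compact sets exhaust the complement of `supp f`, so the exceptional null sets
  -- can be united.
  have hall : ∀ n : ℕ, ∀ᵐ y, y ∈ Metric.closedBall (0 : Pt d) n ∩
      (Metric.thickening (1 / ((n : ℝ) + 1)) F)ᶜ → (v : Pt d → 𝕜) y = u y := fun n => by
    have hUc : IsCompact (Metric.closedBall (0 : Pt d) n ∩
        (Metric.thickening (1 / ((n : ℝ) + 1)) F)ᶜ) :=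
      (isCompact_closedBall _ _).inter_right Metric.isOpen_thickening.isClosed_compl
    refine (ae_restrict_iff' hUc.measurableSet).1 (key _ hUc ?_)
    refine Set.disjoint_left.2 fun x hx hx' => hx'.2 ?_
    exact Metric.self_subset_thickening (by positivity) F hx
  filter_upwards [ae_all_iff.2 hall] with y hy hyF
  obtain ⟨ε, hε, hb⟩ := Metric.isOpen_iff.1 (isClosed_tsupport f).isOpen_compl y hyF
  obtain ⟨n₁, hn₁⟩ := exists_nat_ge ‖y‖
  obtain ⟨n₂, hn₂⟩ := exists_nat_one_div_lt hε
  refine hy (max n₁ n₂) ⟨?_, fun ht => ?_⟩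
  · rw [mem_closedBall_zero_iff]
    exact hn₁.trans (by exact_mod_cast le_max_left _ _)
  · obtain ⟨z, hz, hyz⟩ := Metric.mem_thickening_iff.1 ht
    refine hb ?_ hz
    rw [Metric.mem_ball, dist_comm]
    refine hyz.trans (lt_of_le_of_lt ?_ hn₂)
    gcongr
    exact le_max_right _ _

end Kernels

/-! ## Estimates for single matrix entries -/

section Entries

variable {𝕜 : Type*} [RCLike 𝕜] {d : ℕ}

/-- The decay of `T φ` away from the support of `φ`, if `φ` has vanishing moments. -/
theorem norm_apply_le_of_vanishing {T : L2 𝕜 d →L[𝕜] L2 𝕜 d} {K : Pt d → Pt d → 𝕜} {s : ℕ} {B : ℝ}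
    (hK : HasKernel T K) (hB : 0 ≤ B) (hT : TaylorKernel s K B) {φ : Pt d → 𝕜}
    (hφ : MemLp φ 2 volume) {c : Pt d} {r M : ℝ} (hr : 0 ≤ r) (hM0 : 0 ≤ M)
    (hsupp : Function.support φ ⊆ Metric.closedBall c r) (hM : ∀ x, ‖φ x‖ ≤ M)
    (hv : HasVanishingMoments s φ) :
    ∀ᵐ x, 2 * r < ‖x - c‖ → ‖(T (toL2 φ) : Pt d → 𝕜) x‖ ≤
      B * r ^ s * M * (2 * r) ^ d / ‖x - c‖ ^ (d + s) := by
  have hts : tsupport φ ⊆ Metric.closedBall c r := closure_minimal hsupp Metric.isClosed_closedBall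
  have hc : HasCompactSupport φ :=
    (isCompact_closedBall c r).of_isClosed_subset (isClosed_tsupport _) hts
  filter_upwards [hK φ hφ hc] with x hx hxr
  have hpos : 0 < ‖x - c‖ := by linarith
  obtain ⟨p, hp, hpK⟩ := hT x c (sub_ne_zero.1 (norm_pos_iff.1 hpos))
  rw [hx fun h => by have := mem_closedBall_iff_norm.1 (hts h); linarith]
  by_cases hi : Integrable fun y => K x y * φ y
  · have h1 : ∫ y, K x y * φ y = ∫ y in Metric.closedBall c r, (K x y - polyFn p y) * φ y := by
      rw [setIntegral_eq_integral_of_forall_compl_eq_zero fun y hy => by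
        rw [Function.notMem_support.1 fun h => hy (hsupp h), mul_zero]]
      simp_rw [sub_mul]
      rw [integral_sub hi (integrable_continuous_mul hφ hc (continuous_polyFn p)),
        hv.integral_polyFn_mul hφ hc hp, sub_zero]
    rw [h1]
    have h2 : ∀ y ∈ Metric.closedBall c r, ‖(K x y - polyFn p y) * φ y‖ ≤
        B * r ^ s / ‖x - c‖ ^ (d + s) * M := fun y hy => by
      have hy := mem_closedBall_iff_norm.1 hy
      rw [norm_mul]
      refine mul_le_mul ((hpK y (by linarith)).trans ?_) (hM y) (norm_nonneg _) (by positivity)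
      gcongr
    refine (norm_setIntegral_le_of_norm_le_const
      (isCompact_closedBall c r).measure_lt_top h2).trans (le_of_eq ?_)
    rw [Measure.real, Real.volume_pi_closedBall c hr, Fintype.card_fin,
      ENNReal.toReal_ofReal (by positivity)]
    ring
  -- A divergent integral has the value `0` by convention, so the bound is trivial.
  · rw [integral_undef hi, norm_zero]
    positivity

theorem norm_inner_le_of_separated {T : L2 𝕜 d →L[𝕜] L2 𝕜 d} {φ h : Pt d → 𝕜} {s : ℕ}
    (hh : MemLp h 2 volume) {c c' : Pt d} {r r' N M ρ : ℝ} (hr' : 0 ≤ r') (hN : 0 ≤ N)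
    (hM0 : 0 ≤ M) (hρ : 0 < ρ) (hrρ : 2 * r < ρ)
    (hT : ∀ᵐ x, 2 * r < ‖x - c‖ → ‖(T (toL2 φ) : Pt d → 𝕜) x‖ ≤ N / ‖x - c‖ ^ (d + s))
    (hsupp : Function.support h ⊆ Metric.closedBall c' r') (hM : ∀ x, ‖h x‖ ≤ M)
    (hsep : ∀ x ∈ Metric.closedBall c' r', ρ ≤ ‖x - c‖) :
    ‖inner 𝕜 (toL2 h) (T (toL2 φ))‖ ≤ M * (2 * r') ^ d * (N / ρ ^ (d + s)) := by
  rw [inner_toL2_left hh, ← setIntegral_eq_integral_of_forall_compl_eq_zero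
    (s := Metric.closedBall c' r') fun y hy => by
      rw [Function.notMem_support.1 fun h => hy (hsupp h), map_zero, zero_mul]]
  refine (norm_setIntegral_le_of_norm_le_const_ae (C := M * (N / ρ ^ (d + s)))
    (isCompact_closedBall c' r').measure_lt_top ?_).trans (le_of_eq ?_)
  · refine (ae_restrict_iff' Metric.isClosed_closedBall.measurableSet).2 ?_
    filter_upwards [hT] with x hx hxV
    have h1 := hsep x hxV
    rw [norm_mul, RCLike.norm_conj]
    refine mul_le_mul (hM x) ((hx (by linarith)).trans ?_) (norm_nonneg _) hM0
    gcongr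
  · rw [Measure.real, Real.volume_pi_closedBall c' hr', Fintype.card_fin,
      ENNReal.toReal_ofReal (by positivity)]
    ring

/-- Outside the ball of radius `ρ` one has `|x - c| ≥ (ρ/2)(1 + |x - c|/ρ)`, and scaling reduces the
integral to that of `(1 + |z|)^{-(d+δ)}`, finite because `δ > 0`. -/
theorem exists_lintegral_tail_le (d : ℕ) {δ : ℝ} (hδ : 0 < δ) :
    ∃ Ct : ℝ, 0 ≤ Ct ∧ ∀ (c : Pt d) (ρ : ℝ), 0 < ρ →
      ∫⁻ x in (Metric.closedBall c ρ)ᶜ, ENNReal.ofReal (‖x - c‖ ^ (-(d + δ))) ≤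
        ENNReal.ofReal (Ct * ρ ^ (-δ)) := by
  have hfr : (Module.finrank ℝ (Pt d) : ℝ) < d + δ := by simp [hδ]
  have hint := integrable_one_add_norm (μ := (volume : Measure (Pt d))) hfr
  refine ⟨2 ^ (d + δ) * ∫ z : Pt d, (1 + ‖z‖) ^ (-(d + δ)),
    mul_nonneg (by positivity) (integral_nonneg fun z => by positivity), fun c ρ hρ => ?_⟩
  have hle : ∀ x ∈ (Metric.closedBall c ρ)ᶜ, ENNReal.ofReal (‖x - c‖ ^ (-(d + δ))) ≤
      ENNReal.ofReal ((ρ / 2) ^ (-(d + δ)) * (1 + ‖ρ⁻¹ • (x - c)‖) ^ (-(d + δ))) := fun x hx => by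
    have h1 : ρ < ‖x - c‖ := by simpa [dist_eq_norm] using hx
    refine ENNReal.ofReal_le_ofReal ?_
    rw [← Real.mul_rpow (by positivity) (by positivity), norm_smul, norm_inv,
      Real.norm_of_nonneg hρ.le]
    refine Real.rpow_le_rpow_of_nonpos (by positivity) ?_ (by linarith [d.cast_nonneg (α := ℝ)])
    field_simp
    linarith
  have hint2 : Integrable fun x : Pt d => (1 + ‖ρ⁻¹ • (x - c)‖) ^ (-(d + δ)) :=
    (hint.comp_smul (inv_ne_zero hρ.ne')).comp_sub_right c
  have hval : ∫ x : Pt d, (1 + ‖ρ⁻¹ • (x - c)‖) ^ (-(d + δ)) =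
      ρ ^ d * ∫ z : Pt d, (1 + ‖z‖) ^ (-(d + δ)) := by
    rw [integral_sub_right_eq_self (fun x : Pt d => (1 + ‖ρ⁻¹ • x‖) ^ (-(d + δ))) c,
      Measure.integral_comp_inv_smul_of_nonneg volume
        (fun x : Pt d => (1 + ‖x‖) ^ (-(d + δ))) hρ.le]
    simp
  calc _ ≤ ∫⁻ x in (Metric.closedBall c ρ)ᶜ,
        ENNReal.ofReal ((ρ / 2) ^ (-(d + δ)) * (1 + ‖ρ⁻¹ • (x - c)‖) ^ (-(d + δ))) :=
        setLIntegral_mono' Metric.isClosed_closedBall.measurableSet.compl hle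
    _ ≤ ∫⁻ x, ENNReal.ofReal ((ρ / 2) ^ (-(d + δ)) * (1 + ‖ρ⁻¹ • (x - c)‖) ^ (-(d + δ))) :=
        setLIntegral_le_lintegral _ _
    _ = ENNReal.ofReal ((ρ / 2) ^ (-(d + δ)) *
          (ρ ^ d * ∫ z : Pt d, (1 + ‖z‖) ^ (-(d + δ)))) := by
        rw [← ofReal_integral_eq_lintegral_ofReal (hint2.const_mul _)
          (Filter.Eventually.of_forall fun x => by positivity), integral_const_mul, hval]
    _ = _ := by
        congr 1
        have h2 : (ρ / 2) ^ (-(d + δ)) = 2 ^ (d + δ) * ρ ^ (-δ) * (ρ ^ d)⁻¹ := by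
          rw [Real.div_rpow hρ.le (by norm_num), Real.rpow_neg (by norm_num : (0 : ℝ) ≤ 2),
            div_inv_eq_mul, neg_add, Real.rpow_add hρ, Real.rpow_neg hρ.le, Real.rpow_natCast]
          ring
        rw [h2]
        field_simp

theorem lintegral_closedBall_enorm_le (u : L2 𝕜 d) (c : Pt d) {r : ℝ} (hr : 0 ≤ r) :
    ∫⁻ x in Metric.closedBall c r, ‖(u : Pt d → 𝕜) x‖ₑ ≤
      ENNReal.ofReal (‖u‖ * √((2 * r) ^ d)) := by
  rw [← eLpNorm_one_eq_lintegral_enorm]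
  refine (eLpNorm_le_eLpNorm_mul_rpow_measure_univ (q := 2) (by norm_num)
    (Lp.aestronglyMeasurable u).restrict).trans ?_
  rw [ENNReal.ofReal_mul (norm_nonneg _)]
  refine mul_le_mul' ?_ (le_of_eq ?_)
  · refine (eLpNorm_mono_measure _ Measure.restrict_le_self).trans (le_of_eq ?_)
    rw [Lp.norm_def, ENNReal.ofReal_toReal (Lp.eLpNorm_ne_top u)]
  · rw [Measure.restrict_apply_univ, Real.volume_pi_closedBall c hr, Fintype.card_fin,
      Real.sqrt_eq_rpow, ENNReal.ofReal_rpow_of_nonneg (by positivity) (by norm_num)]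
    norm_num

/-- Because `T φ` annihilates `p`, one may pair it with `h - p`, which vanishes at `c` to order
almost `s`. On the ball of radius `2r` the `L²` norm of `T φ` suffices. Outside, `|x - c|^{-d-s} |x
- c|^{s-δ} = |x - c|^{-d-δ}` is integrable, which it would not be for `δ = 0`. -/
theorem norm_inner_le_of_near {δ : ℝ} {Ct : ℝ} (hCt0 : 0 ≤ Ct)
    (hCt : ∀ (c : Pt d) (ρ : ℝ), 0 < ρ →
      ∫⁻ x in (Metric.closedBall c ρ)ᶜ, ENNReal.ofReal (‖x - c‖ ^ (-(d + δ))) ≤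
        ENNReal.ofReal (Ct * ρ ^ (-δ)))
    {T : L2 𝕜 d →L[𝕜] L2 𝕜 d} {φ h : Pt d → 𝕜} {s : ℕ} (hδs : δ ≤ s)
    (hh : MemLp h 2 volume) {c : Pt d} {r N M : ℝ} (hr : 0 < r) (hN : 0 ≤ N) (hM0 : 0 ≤ M)
    (hT : ∀ᵐ x, 2 * r < ‖x - c‖ → ‖(T (toL2 φ) : Pt d → 𝕜) x‖ ≤ N / ‖x - c‖ ^ (d + s))
    {p : MvPolynomial (Fin d) 𝕜}
    (hp : Integrable fun x => conj ((T (toL2 φ) : Pt d → 𝕜) x) * polyFn p x)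
    (hp0 : ∫ x, conj ((T (toL2 φ) : Pt d → 𝕜) x) * polyFn p x = 0)
    (hM : ∀ x, ‖h x - polyFn p x‖ ≤ M * ‖x - c‖ ^ (s - δ)) :
    ‖inner 𝕜 (toL2 h) (T (toL2 φ))‖ ≤
      M * (2 * r) ^ (s - δ) * (‖T (toL2 φ)‖ * √((2 * (2 * r)) ^ d)) +
        M * N * (Ct * (2 * r) ^ (-δ)) := by
  set u : L2 𝕜 d := T (toL2 φ)
  have hi : Integrable fun x => conj ((u : Pt d → 𝕜) x) * h x := by
    refine (L2.integrable_inner (𝕜 := 𝕜) u (toL2 h)).congr ?_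
    filter_upwards [coe_toL2 hh] with x hx
    rw [RCLike.inner_apply, hx, mul_comm]
  have h1 : inner 𝕜 u (toL2 h) = ∫ x, conj ((u : Pt d → 𝕜) x) * (h x - polyFn p x) := by
    simp_rw [mul_sub]
    rw [integral_sub hi hp, hp0, sub_zero, inner_toL2_right hh]
  rw [← inner_conj_symm, RCLike.norm_conj, h1]
  have h2r : 0 ≤ 2 * r := by positivity
  have hBm : MeasurableSet (Metric.closedBall c (2 * r)) :=
    Metric.isClosed_closedBall.measurableSet
  have hle : ∫⁻ x, ‖conj ((u : Pt d → 𝕜) x) * (h x - polyFn p x)‖ₑ ≤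
      ENNReal.ofReal (M * (2 * r) ^ (s - δ) * (‖u‖ * √((2 * (2 * r)) ^ d)) +
        M * N * (Ct * (2 * r) ^ (-δ))) := by
    rw [← lintegral_add_compl _ hBm, ENNReal.ofReal_add (by positivity) (by positivity)]
    refine add_le_add ?_ ?_
    · calc _ ≤ ∫⁻ x in Metric.closedBall c (2 * r),
            ENNReal.ofReal (M * (2 * r) ^ (s - δ)) * ‖(u : Pt d → 𝕜) x‖ₑ := by
            refine setLIntegral_mono' hBm fun x hx => ?_
            rw [enorm_mul, mul_comm]
            refine mul_le_mul' ?_ (le_of_eq ?_)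
            · rw [← ofReal_norm]
              refine ENNReal.ofReal_le_ofReal ((hM x).trans ?_)
              have := mem_closedBall_iff_norm.1 hx
              have hsd : 0 ≤ (s : ℝ) - δ := by linarith
              gcongr
            · rw [← ofReal_norm, RCLike.norm_conj, ofReal_norm]
        _ ≤ _ := by
            rw [lintegral_const_mul' _ _ ENNReal.ofReal_ne_top,
              ENNReal.ofReal_mul (p := M * (2 * r) ^ ((s : ℝ) - δ)) (by positivity)]
            gcongr
            exact lintegral_closedBall_enorm_le u c h2r
    · calc _ ≤ ∫⁻ x in (Metric.closedBall c (2 * r))ᶜ,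
            ENNReal.ofReal (M * N) * ENNReal.ofReal (‖x - c‖ ^ (-(d + δ))) := by
            refine lintegral_mono_ae ((ae_restrict_iff' hBm.compl).2 ?_)
            filter_upwards [hT] with x hx hxB
            have hxr : 2 * r < ‖x - c‖ := by simpa [dist_eq_norm] using hxB
            have hx0 : 0 < ‖x - c‖ := by linarith
            rw [← ENNReal.ofReal_mul (by positivity), ← ofReal_norm]
            refine ENNReal.ofReal_le_ofReal ?_
            rw [norm_mul, RCLike.norm_conj]
            calc _ ≤ N / ‖x - c‖ ^ (d + s) * (M * ‖x - c‖ ^ (s - δ)) :=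
                  mul_le_mul (hx hxr) (hM x) (norm_nonneg _) (by positivity)
              _ = M * N * (‖x - c‖ ^ (s - δ) * (‖x - c‖ ^ (d + s))⁻¹) := by ring
              _ = _ := by
                  rw [← Real.rpow_natCast, ← Real.rpow_neg hx0.le, ← Real.rpow_add hx0]
                  congr 2
                  push_cast
                  ring
        _ ≤ _ := by
            rw [lintegral_const_mul' _ _ ENNReal.ofReal_ne_top,
              ENNReal.ofReal_mul (p := M * N) (by positivity)]
            gcongr
            exact hCt c (2 * r) (by positivity)
  have h3 := (enorm_integral_le_lintegral_enorm _).trans hle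
  rw [← ofReal_norm] at h3
  exact (ENNReal.ofReal_le_ofReal_iff (by positivity)).1 h3

end Entries

/-! ## The matrix of an operator in a wavelet basis -/

section Matrix

variable {𝕜 : Type*} [RCLike 𝕜] {d : ℕ}

section WaveletBounds

variable {ψ : Eta d → Pt d → 𝕜} {ω : Omega d} {m C : ℝ} {s v : ℕ}

theorem IsWaveletSystem.norm_le (hW : IsWaveletSystem ψ ω m s v C) (Q : CubeIdx d) (η : Eta d)
    (x : Pt d) : ‖wavelet ψ ω Q η x‖ ≤ |C| * (√(vol Q))⁻¹ := by
  have := hW.regularity Q η 0 (Nat.zero_le _) Fin.elim0 x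
  simp only [iteratedFDeriv_zero_apply, pow_zero, mul_one] at this
  exact this.trans (by gcongr; exact le_abs_self C)

theorem IsWaveletSystem.norm_iteratedFDeriv_le (hW : IsWaveletSystem ψ ω m s v C) (Q : CubeIdx d)
    (η : Eta d) {k : ℕ} (hk : k ≤ s) (w : Fin k → Fin d) (x : Pt d) :
    ‖iteratedFDeriv ℝ k (wavelet ψ ω Q η) x (fun a => Pi.single (w a) 1)‖ ≤
      |C| * (√(vol Q))⁻¹ * (side Q)⁻¹ ^ k := by
  refine (hW.regularity Q η k hk w x).trans ?_
  have := side_pos Q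
  rw [mul_right_comm]
  gcongr
  exact le_abs_self C

theorem IsWaveletSystem.support_subset (hW : IsWaveletSystem ψ ω m s v C) (hm : 1 ≤ m)
    (Q : CubeIdx d) (η : Eta d) :
    Function.support (wavelet ψ ω Q η) ⊆ Metric.closedBall (corner ω Q) (m * side Q) :=
  (hW.localization Q η).trans (dilatedCube_subset_closedBall hm ω Q)

theorem IsWaveletSystem.hasCompactSupport (hW : IsWaveletSystem ψ ω m s v C) (hm : 1 ≤ m)
    (Q : CubeIdx d) (η : Eta d) : HasCompactSupport (wavelet ψ ω Q η) :=
  (isCompact_closedBall _ _).of_isClosed_subset (isClosed_tsupport _)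
    (closure_minimal (hW.support_subset hm Q η) Metric.isClosed_closedBall)

/-- A wavelet differs from its Taylor polynomial of degree less than `s` by at most
`|I|^{-1/2} (|x - c| / ℓ(I))^{s - δ}`, globally. -/
theorem IsWaveletSystem.exists_polyFn_approx (hW : IsWaveletSystem ψ ω m s v C) (hd : 0 < d)
    (hs : 0 < s) {δ : ℝ} (hδ0 : 0 ≤ δ) (hδ : δ ≤ 1) (Q : CubeIdx d) (η : Eta d) (c : Pt d) :
    ∃ p : MvPolynomial (Fin d) 𝕜, p.totalDegree < s ∧ ∀ x,
      ‖wavelet ψ ω Q η x - polyFn p x‖ ≤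
        |C| * (√(vol Q))⁻¹ * (1 + s * (d : ℝ) ^ s) * (‖x - c‖ / side Q) ^ (s - δ) := by
  have hσ := side_pos Q
  have hd1 : (1 : ℝ) ≤ d := by exact_mod_cast hd
  have hs1 : (1 : ℝ) ≤ s := by exact_mod_cast hs
  refine ⟨taylorMv s (wavelet ψ ω Q η) c (fun i => Pi.single i 1) c,
    totalDegree_taylorMv_lt hs _ _ _ _, fun x => ?_⟩
  have hsum : ∑ i, (x i - c i) • (Pi.single i (1 : ℝ) : Pt d) = x - c := by
    rw [pi_eq_sum_univ' (x - c)]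
    refine Finset.sum_congr rfl fun i _ => ?_
    congr 1
  set G : ℝ := |C| * (√(vol Q))⁻¹ with hG
  have hG0 : 0 ≤ G := by positivity
  set u : ℝ := ‖x - c‖ / side Q with hu
  have hu0 : 0 ≤ u := by positivity
  have hsd : 0 ≤ (s : ℝ) - δ := by linarith
  have hds : (1 : ℝ) ≤ (d : ℝ) ^ s := one_le_pow₀ hd1
  rw [mul_assoc]
  -- Below scale one the Taylor remainder gives `u^s`. Above it, the wavelet and its polynomial of
  -- degree at most `s - 1` are each bounded by multiples of `u^{s-1}`. Both powers are at most
  -- `u^{s-δ}`, as `0 ≤ δ ≤ 1`.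
  rcases le_total u 1 with h1 | h1
  · have hT := norm_sub_taylorMv_le (hW.differentiable Q η) (x := c)
      (e := fun i => Pi.single i 1) (c := c) (y := x) (M := G * (side Q)⁻¹ ^ s)
      (fun _ _ => Set.mem_univ _) fun t _ w => hW.norm_iteratedFDeriv_le Q η le_rfl w _
    rw [hsum, add_sub_cancel] at hT
    refine hT.trans ?_
    have h2 : (d * ‖x - c‖) ^ s * (G * (side Q)⁻¹ ^ s) = G * ((d : ℝ) ^ s * u ^ s) := by
      rw [hu, mul_pow, div_eq_mul_inv, mul_pow]; ring
    rw [h2]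
    have h3 : u ^ s ≤ u ^ ((s : ℝ) - δ) := by
      rcases hu0.eq_or_lt with h0 | h0
      · rw [← h0, zero_pow hs.ne']; exact Real.rpow_nonneg le_rfl _
      · rw [← Real.rpow_natCast]
        exact Real.rpow_le_rpow_of_exponent_ge h0 h1 (by linarith)
    have h4 : (d : ℝ) ^ s ≤ 1 + s * (d : ℝ) ^ s := by nlinarith
    gcongr
  · have hT := norm_taylorMv_le (n := s) (F := wavelet ψ ω Q η) (x := c)
      (e := fun i => Pi.single i 1) (c := c) (y := x) (M := fun k => G * (side Q)⁻¹ ^ k)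
      fun k hk w => hW.norm_iteratedFDeriv_le Q η hk.le w _
    have hup : u ^ (s - 1) ≤ u ^ ((s : ℝ) - δ) := by
      rw [← Real.rpow_natCast, Nat.cast_sub (show 1 ≤ s from hs)]
      exact Real.rpow_le_rpow_of_exponent_le h1 (by push_cast; linarith)
    have hk : ∀ k ∈ Finset.range s, (d * ‖x - c‖) ^ k * (G * (side Q)⁻¹ ^ k) ≤
        G * ((d : ℝ) ^ s * u ^ ((s : ℝ) - δ)) := fun k hk => by
      have hk := Finset.mem_range.1 hk
      have h2 : (d * ‖x - c‖) ^ k * (G * (side Q)⁻¹ ^ k) = G * ((d : ℝ) ^ k * u ^ k) := by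
        rw [hu, mul_pow, div_eq_mul_inv, mul_pow]; ring
      rw [h2]
      have h3 : u ^ k ≤ u ^ ((s : ℝ) - δ) := (pow_le_pow_right₀ h1 (by omega)).trans hup
      have h4 : (d : ℝ) ^ k ≤ (d : ℝ) ^ s := pow_le_pow_right₀ hd1 hk.le
      gcongr
    have hsumle := hT.trans (Finset.sum_le_sum hk)
    rw [Finset.sum_const, Finset.card_range, nsmul_eq_mul] at hsumle
    have h5 : (1 : ℝ) ≤ u ^ ((s : ℝ) - δ) := Real.one_le_rpow h1 hsd
    calc _ ≤ ‖wavelet ψ ω Q η x‖ + _ := norm_sub_le _ _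
      _ ≤ G * u ^ ((s : ℝ) - δ) + s * (G * ((d : ℝ) ^ s * u ^ ((s : ℝ) - δ))) :=
          add_le_add ((hW.norm_le Q η x).trans (le_mul_of_one_le_right hG0 h5)) hsumle
      _ = _ := by ring

end WaveletBounds

/-- `T φ` is orthogonal to the polynomials of degree less than `s`, if the moments of `φ` of order
less than `s` vanish. -/
def AnnihilatesPolynomials (s : ℕ) (T : L2 𝕜 d →L[𝕜] L2 𝕜 d) : Prop :=
  ∀ φ : Pt d → 𝕜, MemLp φ 2 (volume : Measure (Pt d)) → HasCompactSupport φ →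
    HasVanishingMoments s φ → ∀ p : MvPolynomial (Fin d) 𝕜, p.totalDegree < s →
      Integrable (fun x => conj ((T (toL2 φ) : Pt d → 𝕜) x) * polyFn p x) ∧
        ∫ x, conj ((T (toL2 φ) : Pt d → 𝕜) x) * polyFn p x = 0

/-- By duality `⟨T* φ, p⟩ = ⟨φ, q⟩` with `q` of degree less than `s`, and the moments of `φ` kill
the right side. A condition on `T` thus yields cancellation for `T*`. -/
theorem MapsPolynomials.annihilates_adjoint {s : ℕ} {T : L2 𝕜 d →L[𝕜] L2 𝕜 d}
    (h : MapsPolynomials s T) : AnnihilatesPolynomials s (ContinuousLinearMap.adjoint T) := by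
  intro φ hφ hc hv p hp
  obtain ⟨q, hq, hqφ⟩ := h p hp
  obtain ⟨h1, h2⟩ := hqφ φ hφ hc hv
  refine ⟨h1, h2.trans ?_⟩
  have h3 := hv.integral_polyFn_mul hφ hc (p := q.map (starRingEnd 𝕜))
    ((MvPolynomial.totalDegree_le_of_support_subset
      (MvPolynomial.support_map_subset _ _)).trans_lt hq)
  have h4 : ∀ x, conj (φ x) * polyFn q x = conj (polyFn (q.map (starRingEnd 𝕜)) x * φ x) :=
    fun x => by rw [polyFn_map_conj, map_mul, RCLike.conj_conj, mul_comm]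
  simp_rw [h4]
  rw [integral_conj, h3, map_zero]

set_option maxHeartbeats 1000000 in
/-- The bound for the matrix entries with `ℓ(I) ≤ ℓ(J)`. -/
theorem exists_norm_inner_le_of_side_le (hd : 0 < d) {s : ℕ} (hs : 0 < s) {m : ℝ} (hm : 1 ≤ m)
    (C : ℝ) {δ : ℝ} (hδ0 : 0 < δ) (hδ : δ ≤ 1) :
    ∃ C₁ : ℝ, 0 ≤ C₁ ∧ ∀ (ψ : Eta d → Pt d → 𝕜) (ω : Omega d),
      IsWaveletSystem ψ ω m s (s - 1) C →
      ∀ (T : L2 𝕜 d →L[𝕜] L2 𝕜 d) (K : Pt d → Pt d → 𝕜) (B : ℝ), 0 ≤ B → TaylorKernel s K B →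
        HasKernel T K → AnnihilatesPolynomials s T →
      ∀ p q : CubeIdx d × Eta d, side p.1 ≤ side q.1 →
        ‖inner 𝕜 (wav ψ ω q) (T (wav ψ ω p))‖ ≤ C₁ * (B + ‖T‖) *
          ((side p.1 / (2 : ℝ) ^ (-ancLevel m p.1 q.1)) ^ (s - δ) *
            (√(vol p.1 * vol q.1) / ((2 : ℝ) ^ (-ancLevel m p.1 q.1)) ^ d)) := by
  obtain ⟨Ct, hCt0, hCt⟩ := exists_lintegral_tail_le d hδ0
  have hm0 : 0 < m := by linarith
  have hs1 : (1 : ℝ) ≤ s := by exact_mod_cast hs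
  have hsd : 0 ≤ (s : ℝ) - δ := by linarith
  set D : ℝ := 1 + s * (d : ℝ) ^ s
  have hD0 : 0 ≤ D := by positivity
  set Z : ℝ := (160 * m) ^ ((s : ℝ) - δ) * (160 * m) ^ d
  have hZ0 : 0 ≤ Z := by positivity
  -- The constants belong to distant cubes, and to the ball and the tail in the case of close cubes.
  set c₁ : ℝ := |C| * |C| * (2 * m) ^ d * (2 * m) ^ d * m ^ s * 16 ^ (d + s)
  set c₂ : ℝ := |C| * D * (2 * m) ^ ((s : ℝ) - δ) * √((4 * m) ^ d) * Z
  set c₃ : ℝ := |C| * |C| * D * Ct * m ^ s * (2 * m) ^ d * (2 * m) ^ (-δ) * Z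
  have hc₁ : 0 ≤ c₁ := by positivity
  have hc₂ : 0 ≤ c₂ := by positivity
  have hc₃ : 0 ≤ c₃ := by positivity
  refine ⟨c₁ + c₂ + c₃, by positivity, fun ψ ω hW T K B hB hTK hK hA p q hpq => ?_⟩
  set a := side p.1 with ha
  set b := side q.1 with hb
  have ha0 : 0 < a := side_pos _
  have hb0 : 0 < b := side_pos _
  set L : ℝ := (2 : ℝ) ^ (-ancLevel m p.1 q.1) with hL
  have hL0 : 0 < L := by positivity
  have hL1 : 4 * sepRadius m p.1 q.1 ≤ L := sepRadius_le_zpow m p.1 q.1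
  have hL2 : L ≤ 8 * sepRadius m p.1 q.1 := zpow_le_sepRadius hm p.1 q.1
  have hL3 := le_sepRadius hm p.1 q.1
  rw [← ha, ← hb] at hL3
  have hvI : √(vol p.1) * √(vol p.1) = a ^ d := Real.mul_self_sqrt (vol_pos _).le
  have hvJ : √(vol q.1) * √(vol q.1) = b ^ d := Real.mul_self_sqrt (vol_pos _).le
  rw [Real.sqrt_mul (vol_pos _).le]
  set P := √(vol p.1)
  set Q := √(vol q.1)
  have hP0 : 0 < P := Real.sqrt_pos.2 (vol_pos _)
  have hQ0 : 0 < Q := Real.sqrt_pos.2 (vol_pos _)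
  have hmp := hW.memLp p.1 p.2
  have hmq := hW.memLp q.1 q.2
  have hcp := hW.hasCompactSupport hm p.1 p.2
  have hvp : HasVanishingMoments s (wavelet ψ ω p.1 p.2) := by
    have := hW.cancellation p.1 p.2
    rwa [Nat.sub_add_cancel hs] at this
  have hdec := norm_apply_le_of_vanishing hK hB hTK hmp (r := m * a) (by positivity)
    (M := |C| * P⁻¹) (by positivity) (hW.support_subset hm p.1 p.2) (hW.norm_le p.1 p.2) hvp
  set N : ℝ := B * (m * a) ^ s * (|C| * P⁻¹) * (2 * (m * a)) ^ d with hN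
  have hN' : N = B * |C| * m ^ s * (2 * m) ^ d * a ^ s * P := by
    have : (2 * (m * a)) ^ d = (2 * m) ^ d * (P * P) := by rw [hvI, ← mul_pow, mul_assoc]
    rw [hN, this, mul_pow m a s]
    field_simp
  have hN0 : 0 ≤ N := by positivity
  have hTn : 0 ≤ ‖T‖ := norm_nonneg T
  set X : ℝ := (a / L) ^ ((s : ℝ) - δ) * (P * Q / L ^ d) with hX
  have hX0 : 0 ≤ X := by positivity
  -- For distant cubes `L` is comparable to the distance of the supports; for close cubes it is
  -- bounded by a multiple of the larger side `b`.
  rcases le_or_gt (8 * m * (a + b)) (refDist p.1 q.1) with hfar | hnear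
  · have hR : sepRadius m p.1 q.1 = refDist p.1 q.1 + (m + 1) * (a + b) := rfl
    have hm1 : 4 * (m + 1) * (a + b) ≤ 8 * m * (a + b) := by
      have : 4 * (m + 1) ≤ 8 * m := by linarith
      exact mul_le_mul_of_nonneg_right this (by positivity)
    have hma : 2 * (m * a) ≤ m * (a + b) := by nlinarith
    -- Here `(m + 1)(a + b) ≤ refDist / 4`, so `L ≤ 8 · (5/4) refDist = 10 refDist`, while the
    -- distance in question is at least `(3/4) refDist`.
    have hsep : ∀ x ∈ Metric.closedBall (corner ω q.1) (m * b), L / 16 ≤ ‖x - corner ω p.1‖ :=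
      fun x hx => by
        have h1 := mem_closedBall_iff_norm.1 hx
        have h2 := refDist_le ω p.1 q.1
        have h3 := norm_sub_le_norm_sub_add_norm_sub (corner ω p.1) x (corner ω q.1)
        rw [norm_sub_rev (corner ω p.1) x] at h3
        have h4 : (0 : ℝ) ≤ m * a := by positivity
        rw [← ha, ← hb] at h2
        linarith
    have h2r : 2 * (m * a) < L / 16 := by
      have h1 : 0 < m * a := by positivity
      have h2 : 0 ≤ (m + 1) * (a + b) := by positivity
      linarith
    have hfar' := norm_inner_le_of_separated (h := wavelet ψ ω q.1 q.2) hmq (r' := m * b)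
      (M := |C| * Q⁻¹) (ρ := L / 16) (by positivity) hN0 (by positivity) (by positivity)
      h2r hdec
      (hW.support_subset hm q.1 q.2) (hW.norm_le q.1 q.2) hsep
    have hval : |C| * Q⁻¹ * (2 * (m * b)) ^ d * (N / (L / 16) ^ (d + s)) =
        c₁ * B * ((a / L) ^ s * (P * Q / L ^ d)) := by
      have : (2 * (m * b)) ^ d = (2 * m) ^ d * (Q * Q) := by rw [hvJ, ← mul_pow, mul_assoc]
      rw [this, hN', div_pow L, div_pow a, pow_add L]
      simp only [c₁]
      field_simp
    -- Distant cubes even give the full exponent `s`; it is lowered only to match the other case.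
    have haL : a / L ≤ 1 := by
      rw [div_le_one hL0]; linarith
    have hpow : (a / L) ^ s ≤ (a / L) ^ ((s : ℝ) - δ) := by
      rw [← Real.rpow_natCast]
      exact Real.rpow_le_rpow_of_exponent_ge (by positivity) haL (by linarith)
    calc _ ≤ _ := hfar'
      _ = _ := hval
      _ ≤ c₁ * B * X := by rw [hX]; gcongr
      _ ≤ _ := by
        gcongr
        · linarith
        · linarith
  · obtain ⟨pol, hpol, happ⟩ := hW.exists_polyFn_approx hd hs hδ0.le hδ q.1 q.2 (corner ω p.1)
    obtain ⟨hi, hi0⟩ := hA _ hmp hcp hvp pol hpol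
    have happ' : ∀ x, ‖wavelet ψ ω q.1 q.2 x - polyFn pol x‖ ≤
        (|C| * Q⁻¹ * D * (b ^ ((s : ℝ) - δ))⁻¹) * ‖x - corner ω p.1‖ ^ ((s : ℝ) - δ) := fun x => by
      refine (happ x).trans (le_of_eq ?_)
      rw [Real.div_rpow (norm_nonneg _) hb0.le]
      simp only [D, Q]
      ring
    have hnr := norm_inner_le_of_near hCt0 hCt (by linarith) hmq (r := m * a) (by positivity)
      hN0 (M := |C| * Q⁻¹ * D * (b ^ ((s : ℝ) - δ))⁻¹) (by positivity) hdec hi hi0 happ'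
    have hTw : ‖T (toL2 (wavelet ψ ω p.1 p.2))‖ ≤ ‖T‖ := by
      have := T.le_opNorm (toL2 (wavelet ψ ω p.1 p.2))
      rwa [hW.orthonormal.1 p, mul_one] at this
    have hR : sepRadius m p.1 q.1 = refDist p.1 q.1 + (m + 1) * (a + b) := rfl
    -- Here `sepRadius ≤ 8m(a + b) + 2m(a + b) ≤ 20mb`, and `L` is at most eight times this.
    have hLb : L ≤ 160 * m * b := by
      have h1 : (m + 1) * (a + b) ≤ 2 * m * (a + b) :=
        mul_le_mul_of_nonneg_right (by linarith) (by positivity)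
      have h2 : m * (a + b) ≤ m * (2 * b) := mul_le_mul_of_nonneg_left (by linarith) hm0.le
      linarith
    have hXb : (a / b) ^ ((s : ℝ) - δ) * (P / Q) ≤ Z * X := by
      have h1 : a / b ≤ (160 * m) * (a / L) := by
        rw [div_le_iff₀ hb0]
        have : 160 * m * (a / L) * b = a * (160 * m * b / L) := by ring
        rw [this]
        exact le_mul_of_one_le_right ha0.le ((one_le_div hL0).2 hLb)
      have h2 : (a / b) ^ ((s : ℝ) - δ) ≤
          (160 * m) ^ ((s : ℝ) - δ) * (a / L) ^ ((s : ℝ) - δ) := by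
        rw [← Real.mul_rpow (by positivity) (by positivity)]
        gcongr
      have h3 : P / Q ≤ (160 * m) ^ d * (P * Q / L ^ d) := by
        have h4 : P / Q = P * Q / b ^ d := by rw [← hvJ]; field_simp
        rw [h4, div_le_iff₀ (by positivity)]
        have h5 : (160 * m) ^ d * (P * Q / L ^ d) * b ^ d =
            P * Q * ((160 * m * b) ^ d / L ^ d) := by rw [mul_pow _ b]; ring
        rw [h5]
        refine le_mul_of_one_le_right (by positivity) ((one_le_div (by positivity)).2 ?_)
        gcongr
      calc _ ≤ ((160 * m) ^ ((s : ℝ) - δ) * (a / L) ^ ((s : ℝ) - δ)) *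
            ((160 * m) ^ d * (P * Q / L ^ d)) := by gcongr
        _ = _ := by simp only [Z, hX]; ring
    have hsq : √((2 * (2 * (m * a))) ^ d) = √((4 * m) ^ d) * P := by
      have : (2 * (2 * (m * a))) ^ d = (4 * m) ^ d * vol p.1 := by
        rw [vol, ← ha, ← mul_pow]; ring
      rw [this, Real.sqrt_mul (by positivity)]
    have hdiv : (a / b) ^ ((s : ℝ) - δ) = a ^ ((s : ℝ) - δ) * (b ^ ((s : ℝ) - δ))⁻¹ := by
      rw [Real.div_rpow ha0.le hb0.le]; rfl
    have hfirst : |C| * Q⁻¹ * D * (b ^ ((s : ℝ) - δ))⁻¹ * (2 * (m * a)) ^ ((s : ℝ) - δ) *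
        (‖T‖ * √((2 * (2 * (m * a))) ^ d)) ≤ c₂ * ‖T‖ * X := by
      rw [hsq, ← mul_assoc 2 m a, Real.mul_rpow (by positivity) ha0.le]
      calc _ = |C| * D * (2 * m) ^ ((s : ℝ) - δ) * √((4 * m) ^ d) * ‖T‖ *
            ((a / b) ^ ((s : ℝ) - δ) * (P / Q)) := by rw [hdiv]; ring
        _ ≤ |C| * D * (2 * m) ^ ((s : ℝ) - δ) * √((4 * m) ^ d) * ‖T‖ * (Z * X) := by gcongr
        _ = _ := by simp only [c₂]; ring
    have hsecond : |C| * Q⁻¹ * D * (b ^ ((s : ℝ) - δ))⁻¹ * N * (Ct * (2 * (m * a)) ^ (-δ)) ≤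
        c₃ * B * X := by
      have h1 : a ^ ((s : ℝ) - δ) = a ^ s * a ^ (-δ) := by
        rw [sub_eq_add_neg, Real.rpow_add ha0, Real.rpow_natCast]
      rw [hN', ← mul_assoc 2 m a, Real.mul_rpow (by positivity) ha0.le]
      calc _ = |C| * |C| * D * Ct * m ^ s * (2 * m) ^ d * (2 * m) ^ (-δ) * B *
            ((a / b) ^ ((s : ℝ) - δ) * (P / Q)) := by rw [hdiv, h1]; ring
        _ ≤ |C| * |C| * D * Ct * m ^ s * (2 * m) ^ d * (2 * m) ^ (-δ) * B * (Z * X) := by gcongr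
        _ = _ := by simp only [c₃]; ring
    have hfirst' : |C| * Q⁻¹ * D * (b ^ ((s : ℝ) - δ))⁻¹ * (2 * (m * a)) ^ ((s : ℝ) - δ) *
        (‖T (toL2 (wavelet ψ ω p.1 p.2))‖ * √((2 * (2 * (m * a))) ^ d)) ≤ c₂ * ‖T‖ * X := by
      refine le_trans ?_ hfirst
      gcongr
    calc _ ≤ _ := hnr
      _ ≤ c₂ * ‖T‖ * X + c₃ * B * X := add_le_add hfirst' hsecond
      _ ≤ (c₁ + c₂ + c₃) * (B + ‖T‖) * X := by
        rw [← add_mul]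
        refine mul_le_mul_of_nonneg_right ?_ hX0
        have h1 : c₂ * ‖T‖ ≤ (c₁ + c₂ + c₃) * ‖T‖ := by gcongr; linarith
        have h2 : c₃ * B ≤ (c₁ + c₂ + c₃) * B := by gcongr; linarith
        linarith

/-- The decay of the matrix of a Calderón–Zygmund operator in a wavelet basis. -/
theorem exists_norm_inner_le (hd : 0 < d) {s : ℕ} (hs : 0 < s) {m : ℝ} (hm : 1 ≤ m)
    (C : ℝ) {δ : ℝ} (hδ0 : 0 < δ) (hδ : δ ≤ 1) :
    ∃ C₁ : ℝ, 0 < C₁ ∧ ∀ (ψ : Eta d → Pt d → 𝕜) (ω : Omega d),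
      IsWaveletSystem ψ ω m s (s - 1) C →
      ∀ (T : L2 𝕜 d →L[𝕜] L2 𝕜 d) (K : Pt d → Pt d → 𝕜), IsCZKernel s K → HasKernel T K →
        MapsPolynomials s T → MapsPolynomials s (ContinuousLinearMap.adjoint T) →
      ∀ p q : CubeIdx d × Eta d,
        ‖inner 𝕜 (wav ψ ω q) (T (wav ψ ω p))‖ ≤ C₁ * (czNorm s K + ‖T‖) *
          ((min (side p.1) (side q.1) / (2 : ℝ) ^ (-ancLevel m p.1 q.1)) ^ (s - δ) *
            (√(vol p.1 * vol q.1) / ((2 : ℝ) ^ (-ancLevel m p.1 q.1)) ^ d)) := by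
  obtain ⟨C₁, hC₁, h⟩ := exists_norm_inner_le_of_side_le (𝕜 := 𝕜) hd hs hm C hδ0 hδ
  set B₀ : ℝ := (d : ℝ) ^ s * 2 ^ (d + s)
  have hB₀ : 0 ≤ B₀ := by positivity
  refine ⟨(C₁ + 1) * (B₀ + 1), by positivity, fun ψ ω hW T K hK hT hmT hmT' p q => ?_⟩
  have hA0 := czNorm_nonneg s K
  have hA := kernelBound_czNorm hK
  have hTn := norm_nonneg T
  have hle : C₁ * (czNorm s K * d ^ s * 2 ^ (d + s) + ‖T‖) ≤
      (C₁ + 1) * (B₀ + 1) * (czNorm s K + ‖T‖) := by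
    have h1 : czNorm s K * d ^ s * 2 ^ (d + s) + ‖T‖ ≤ (B₀ + 1) * (czNorm s K + ‖T‖) := by
      have : czNorm s K * d ^ s * 2 ^ (d + s) = B₀ * czNorm s K := by simp only [B₀]; ring
      rw [this]
      nlinarith [mul_nonneg hB₀ hTn]
    calc _ ≤ (C₁ + 1) * ((B₀ + 1) * (czNorm s K + ‖T‖)) :=
          mul_le_mul (by linarith) h1 (by positivity) (by positivity)
      _ = _ := by ring
  rcases le_total (side p.1) (side q.1) with hpq | hpq
  · rw [min_eq_left hpq]
    refine (h ψ ω hW T K _ (by positivity) (taylorKernel_of_bound hs hA0 hK.1 hA) hT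
      (by simpa using hmT'.annihilates_adjoint) p q hpq).trans ?_
    have := side_pos p.1
    gcongr
  -- If the second cube is the smaller one, the estimate is applied to `T*` with the pair reversed.
  · rw [min_eq_right hpq, ancLevel_comm m p.1 q.1, mul_comm (vol p.1)]
    have h1 := h ψ ω hW (ContinuousLinearMap.adjoint T) (fun x y => conj (K y x)) _ (by positivity)
      (taylorKernel_adjoint_of_bound hs hA0 hK.1 hA) (hT.adjoint (hK.continuousOn hs))
      hmT.annihilates_adjoint q p hpq
    rw [ContinuousLinearMap.adjoint_inner_right, ← inner_conj_symm, RCLike.norm_conj,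
      LinearIsometryEquiv.norm_map] at h1
    refine h1.trans ?_
    have := side_pos q.1
    gcongr

end Matrix

/-! ## Summation over the good pairs -/

section GoodPairs

variable {𝕜 : Type*} [RCLike 𝕜] {d : ℕ}

/-- One half of a Schur test. With `p` fixed, the generation `i` determines `K`, and the descendants
of `K` of generation `j` have total relative volume at most one. Only the sum over `(i, j)` remains.
-/
theorem tsum_le_of_common_ancestor {ω : Omega d} {τ : ℕ → ℕ → ENNReal} {p : CubeIdx d × Eta d}
    {u : CubeIdx d × Eta d → ENNReal}
    (h : ∀ q, u q ≠ 0 → ∃ i j K, p ∈ desc ω i K ∧ q ∈ desc ω j K ∧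
      u q ≤ τ i j * ENNReal.ofReal (vol q.1 / vol K)) :
    ∑' q, u q ≤ (∑' i, ∑' j, τ i j) * Fintype.card (Eta d) := by
  classical
  set anc : ℕ → CubeIdx d := fun i => cellIdx ω (p.1.1 - i) (corner ω p.1)
  have h1 : ∀ q, u q ≤ ∑' i, ∑' j, τ i j *
      (if q ∈ desc ω j (anc i) then ENNReal.ofReal (vol q.1 / vol (anc i)) else 0) := fun q => by
    by_cases hq : u q = 0
    · simp [hq]
    obtain ⟨i, j, K, hp, hqK, hle⟩ := h q hq
    have hK : K = anc i := eq_cellIdx_of_mem_descendants (mem_desc.1 hp)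
    subst hK
    refine hle.trans ?_
    refine le_trans (le_of_eq ?_) ((ENNReal.le_tsum j).trans
      (ENNReal.le_tsum (f := fun i => ∑' j, τ i j *
        (if q ∈ desc ω j (anc i) then ENNReal.ofReal (vol q.1 / vol (anc i)) else 0)) i))
    rw [if_pos hqK]
  have h2 : ∀ i j, ∑' q, (if q ∈ desc ω j (anc i) then
      ENNReal.ofReal (vol q.1 / vol (anc i)) else 0) ≤ Fintype.card (Eta d) := fun i j => by
    rw [tsum_eq_sum (s := desc ω j (anc i)) fun q hq => if_neg hq]
    rw [Finset.sum_congr rfl fun q hq => if_pos hq,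
      ← ENNReal.ofReal_sum_of_nonneg fun q _ => (div_pos (vol_pos _) (vol_pos _)).le,
      ← ENNReal.ofReal_natCast]
    refine ENNReal.ofReal_le_ofReal ?_
    rw [desc, Finset.sum_product]
    simp only [Finset.sum_const, Finset.card_univ, nsmul_eq_mul]
    rw [← Finset.mul_sum]
    exact mul_le_of_le_one_right (Nat.cast_nonneg _) (sum_vol_descendants_le ω j _)
  calc ∑' q, u q ≤ ∑' q, ∑' i, ∑' j, τ i j *
        (if q ∈ desc ω j (anc i) then ENNReal.ofReal (vol q.1 / vol (anc i)) else 0) :=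
        ENNReal.tsum_le_tsum h1
    _ = ∑' i, ∑' j, τ i j * ∑' q,
        (if q ∈ desc ω j (anc i) then ENNReal.ofReal (vol q.1 / vol (anc i)) else 0) := by
        rw [ENNReal.tsum_comm]
        refine tsum_congr fun i => ?_
        rw [ENNReal.tsum_comm]
        exact tsum_congr fun j => ENNReal.tsum_mul_left
    _ ≤ ∑' i, ∑' j, τ i j * Fintype.card (Eta d) :=
        ENNReal.tsum_le_tsum fun i => ENNReal.tsum_le_tsum fun j => by gcongr; exact h2 i j
    _ = _ := by simp_rw [ENNReal.tsum_mul_right]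

/-- The generation of `P` below the common ancestor of `P` and `Q`. -/
noncomputable def genLeft (m : ℝ) (P Q : CubeIdx d) : ℕ := (P.1 - ancLevel m P Q).toNat

/-- The generation of `Q` below the common ancestor of `P` and `Q`. -/
noncomputable def genRight (m : ℝ) (P Q : CubeIdx d) : ℕ := (Q.1 - ancLevel m P Q).toNat

theorem mem_descendants_commonAnc {m : ℝ} (hm : 1 ≤ m) {ω : Omega d} {P Q : CubeIdx d}
    (h : pairGood m P Q ω ≠ 0) :
    P ∈ descendants ω (genLeft m P Q) (commonAnc m ω P Q) ∧
      Q ∈ descendants ω (genRight m P Q) (commonAnc m ω P Q) := by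
  obtain ⟨h1, h2⟩ := dilatedCube_subset_commonAnc hm h
  have h3 := ancLevel_lt_left hm P Q
  have h4 := ancLevel_lt_right hm P Q
  refine ⟨mem_descendants.2 ⟨(cube_subset_dilatedCube hm ω P).trans h1, ?_⟩,
    mem_descendants.2 ⟨(cube_subset_dilatedCube hm ω Q).trans h2, ?_⟩⟩
  · change P.1 = ancLevel m P Q + (P.1 - ancLevel m P Q).toNat
    omega
  · change Q.1 = ancLevel m P Q + (Q.1 - ancLevel m P Q).toNat
    omega

theorem inv_two_pow_rpow (i : ℕ) (t : ℝ) : (((2 : ℝ) ^ i)⁻¹) ^ t = ((2 : ℝ) ^ (-t)) ^ i := by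
  rw [← Real.rpow_natCast, ← Real.rpow_natCast, ← Real.rpow_neg (by norm_num),
    ← Real.rpow_mul (by norm_num), ← Real.rpow_mul (by norm_num)]
  congr 1
  ring

theorem Orthonormal.tsum_ofReal_inner_sq_le {ι : Type*} {E : Type*} [NormedAddCommGroup E]
    [InnerProductSpace 𝕜 E] {b : ι → E} (hb : Orthonormal 𝕜 b) (f : E) :
    ∑' p, ENNReal.ofReal (‖inner 𝕜 (b p) f‖ ^ 2) ≤ ENNReal.ofReal (‖f‖ ^ 2) := by
  rw [← ENNReal.ofReal_tsum_of_nonneg (fun _ => by positivity) (hb.inner_products_summable f)]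
  exact ENNReal.ofReal_le_ofReal (hb.tsum_inner_products_le f)

/-- The term of `⟨g, T f⟩` that comes from the matrix entry `M p q`. -/
noncomputable def entryTerm (ψ : Eta d → Pt d → 𝕜) (ω : Omega d)
    (M : CubeIdx d × Eta d → CubeIdx d × Eta d → 𝕜) (f g : L2 𝕜 d)
    (x : (CubeIdx d × Eta d) × (CubeIdx d × Eta d)) : 𝕜 :=
  inner 𝕜 g (wav ψ ω x.2) * M x.1 x.2 * inner 𝕜 (wav ψ ω x.1) f

/-- The estimate that the entries of the matrix `M` have to satisfy. -/
def EntryBound (m σ N : ℝ) (M : CubeIdx d × Eta d → CubeIdx d × Eta d → 𝕜) : Prop :=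
  ∀ p q, ‖M p q‖ ≤ N * ((min (side p.1) (side q.1) / (2 : ℝ) ^ (-ancLevel m p.1 q.1)) ^ σ *
    (√(vol p.1 * vol q.1) / ((2 : ℝ) ^ (-ancLevel m p.1 q.1)) ^ d))

/-- The weights `√(|I||J|) / |K|` are split by the arithmetic-geometric inequality, so that the
Schur test in each variable and Bessel's inequality apply. The bound does not depend on `ω`, which
makes the good sum converge for every `ω` and integrable. -/
theorem exists_tsum_pairGood_le (𝕜 : Type*) [RCLike 𝕜] (d : ℕ) {m : ℝ} (hm : 1 ≤ m) {σ : ℝ}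
    (hσ : 0 < σ) :
    ∃ Θ : ENNReal, Θ ≠ ⊤ ∧ ∀ (ψ : Eta d → Pt d → 𝕜) (ω : Omega d), Orthonormal 𝕜 (wav ψ ω) →
      ∀ (N : ℝ) (M : CubeIdx d × Eta d → CubeIdx d × Eta d → 𝕜), 0 ≤ N → EntryBound m σ N M →
      ∀ f g : L2 𝕜 d, ∑' x, ‖((pairGood m x.1.1 x.2.1 ω : ℝ) : 𝕜) * entryTerm ψ ω M f g x‖ₑ ≤
        ENNReal.ofReal N * (Θ * (ENNReal.ofReal (‖f‖ ^ 2) + ENNReal.ofReal (‖g‖ ^ 2))) := by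
  set r : ℝ := (2 : ℝ) ^ (-(σ / 2)) with hr
  have hr0 : 0 < r := by positivity
  have hr1 : r < 1 := Real.rpow_lt_one_of_one_lt_of_neg (by norm_num) (by linarith)
  set τ : ℕ → ℕ → ENNReal := fun i j => ENNReal.ofReal r ^ i * ENNReal.ofReal r ^ j
  refine ⟨(∑' i, ∑' j, τ i j) * Fintype.card (Eta d), ?_, fun ψ ω ho N M hN hM f g => ?_⟩
  · refine ENNReal.mul_ne_top ?_ (ENNReal.natCast_ne_top _)
    simp only [τ, ENNReal.tsum_mul_left, ENNReal.tsum_mul_right, ENNReal.tsum_geometric]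
    have : (1 - ENNReal.ofReal r)⁻¹ ≠ ⊤ := by
      rw [ENNReal.inv_ne_top, ← ENNReal.ofReal_one, ← ENNReal.ofReal_sub _ hr0.le]
      exact (ENNReal.ofReal_pos.2 (by linarith)).ne'
    exact ENNReal.mul_ne_top this this
  set Θ := (∑' i, ∑' j, τ i j) * Fintype.card (Eta d)
  set w : CubeIdx d → CubeIdx d → CubeIdx d → ENNReal := fun P Q I =>
    if pairGood m P Q ω ≠ 0 then τ (genLeft m P Q) (genRight m P Q) *
      ENNReal.ofReal (vol I / vol (commonAnc m ω P Q)) else 0 with hw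
  have hterm : ∀ x : (CubeIdx d × Eta d) × (CubeIdx d × Eta d),
      ‖((pairGood m x.1.1 x.2.1 ω : ℝ) : 𝕜) * entryTerm ψ ω M f g x‖ₑ ≤
        ENNReal.ofReal N *
          (ENNReal.ofReal (‖inner 𝕜 (wav ψ ω x.1) f‖ ^ 2) * w x.1.1 x.2.1 x.2.1 +
            ENNReal.ofReal (‖inner 𝕜 (wav ψ ω x.2) g‖ ^ 2) * w x.1.1 x.2.1 x.1.1) := by
    rintro ⟨p, q⟩
    by_cases hG : pairGood m p.1 q.1 ω = 0
    · simp [hG]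
    have hG1 : pairGood m p.1 q.1 ω = 1 := (goodInd_eq_zero_or_one _ _ _).resolve_left hG
    obtain ⟨hpK, hqK⟩ := mem_descendants_commonAnc hm hG
    simp only [hw, hG1, ne_eq, one_ne_zero, not_false_eq_true, if_true, RCLike.ofReal_one, one_mul]
    have hMpq := hM p q
    rw [← side_commonAnc m ω p.1 q.1] at hMpq
    set K := commonAnc m ω p.1 q.1
    set i := genLeft m p.1 q.1
    set j := genRight m p.1 q.1
    have hL0 := side_pos K
    have ha0 := side_pos p.1
    have hb0 := side_pos q.1
    have haL : side p.1 / side K = ((2 : ℝ) ^ i)⁻¹ := by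
      rw [side_of_mem_descendants hpK]; field_simp
    have hbL : side q.1 / side K = ((2 : ℝ) ^ j)⁻¹ := by
      rw [side_of_mem_descendants hqK]; field_simp
    -- Half of the exponent is spent on each cube, so that the decay is summable in `i` and in `j`.
    have hmin : (min (side p.1) (side q.1) / side K) ^ σ ≤ r ^ i * r ^ j := by
      have hmn : 0 < min (side p.1) (side q.1) / side K := div_pos (lt_min ha0 hb0) hL0
      rw [← add_halves σ, Real.rpow_add hmn, hr, ← inv_two_pow_rpow, ← inv_two_pow_rpow, ← haL,
        ← hbL]
      gcongr
      · exact min_le_left _ _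
      · exact min_le_right _ _
    have hreal : ‖entryTerm ψ ω M f g (p, q)‖ ≤
        N * (‖inner 𝕜 (wav ψ ω p) f‖ ^ 2 * (r ^ i * r ^ j * (vol q.1 / vol K)) +
          ‖inner 𝕜 (wav ψ ω q) g‖ ^ 2 * (r ^ i * r ^ j * (vol p.1 / vol K))) := by
      rw [entryTerm, norm_mul, norm_mul, ← inner_conj_symm, RCLike.norm_conj]
      set F := ‖inner 𝕜 (wav ψ ω p) f‖
      set G := ‖inner 𝕜 (wav ψ ω q) g‖
      have hv : √(vol p.1 * vol q.1) = √(vol p.1) * √(vol q.1) := Real.sqrt_mul (vol_pos _).le _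
      have hvp := Real.sq_sqrt (vol_pos p.1).le
      have hvq := Real.sq_sqrt (vol_pos q.1).le
      have hvK := vol_pos K
      have hF : 0 ≤ F := norm_nonneg _
      have hG : 0 ≤ G := norm_nonneg _
      have hamgm : F * G * √(vol p.1 * vol q.1) ≤ F ^ 2 * vol q.1 + G ^ 2 * vol p.1 := by
        rw [hv]
        nlinarith [sq_nonneg (F * √(vol q.1) - G * √(vol p.1)),
          mul_nonneg (mul_nonneg hF hG) (mul_nonneg (Real.sqrt_nonneg (vol p.1))
            (Real.sqrt_nonneg (vol q.1)))]
      have h1 : ‖M p q‖ ≤ N * (r ^ i * r ^ j * (√(vol p.1 * vol q.1) / vol K)) :=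
        hMpq.trans (by rw [vol, vol, vol]; gcongr)
      calc G * ‖M p q‖ * F
          ≤ G * (N * (r ^ i * r ^ j * (√(vol p.1 * vol q.1) / vol K))) * F := by gcongr
        _ = N * (r ^ i * r ^ j) / vol K * (F * G * √(vol p.1 * vol q.1)) := by ring
        _ ≤ N * (r ^ i * r ^ j) / vol K * (F ^ 2 * vol q.1 + G ^ 2 * vol p.1) := by gcongr
        _ = _ := by ring
    have hτ : ∀ v : ℝ, τ i j * ENNReal.ofReal v = ENNReal.ofReal (r ^ i * r ^ j * v) := fun v => by
      rw [ENNReal.ofReal_mul (p := r ^ i * r ^ j) (by positivity), ENNReal.ofReal_mul (by positivity),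
        ENNReal.ofReal_pow hr0.le, ENNReal.ofReal_pow hr0.le]
    have hvp := vol_pos p.1
    have hvq := vol_pos q.1
    have hvK := vol_pos K
    rw [hτ, hτ, ← ENNReal.ofReal_mul (by positivity), ← ENNReal.ofReal_mul (by positivity),
      ← ENNReal.ofReal_add (by positivity) (by positivity), ← ENNReal.ofReal_mul hN, ← ofReal_norm]
    exact ENNReal.ofReal_le_ofReal hreal
  have hcomm : ∀ i j, τ i j = τ j i := fun i j => mul_comm _ _
  have hsum1 : ∀ p : CubeIdx d × Eta d, ∑' q : CubeIdx d × Eta d, w p.1 q.1 q.1 ≤ Θ := fun p => by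
    refine tsum_le_of_common_ancestor (ω := ω) (p := p) fun q hq => ?_
    have hG : pairGood m p.1 q.1 ω ≠ 0 := fun hG => hq (if_neg (not_not.2 hG))
    obtain ⟨hpK, hqK⟩ := mem_descendants_commonAnc hm hG
    exact ⟨_, _, _, mem_desc.2 hpK, mem_desc.2 hqK, (if_pos hG).le⟩
  have hsum2 : ∀ q : CubeIdx d × Eta d, ∑' p : CubeIdx d × Eta d, w p.1 q.1 p.1 ≤ Θ := fun q => by
    refine tsum_le_of_common_ancestor (ω := ω) (p := q) fun p hq => ?_
    have hG : pairGood m p.1 q.1 ω ≠ 0 := fun hG => hq (if_neg (not_not.2 hG))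
    obtain ⟨hpK, hqK⟩ := mem_descendants_commonAnc hm hG
    refine ⟨_, _, _, mem_desc.2 hqK, mem_desc.2 hpK, ?_⟩
    rw [hcomm]
    exact (if_pos hG).le
  refine (ENNReal.tsum_le_tsum hterm).trans ?_
  rw [ENNReal.tsum_mul_left, ENNReal.tsum_add, mul_add Θ]
  refine mul_le_mul' le_rfl (add_le_add ?_ ?_)
  · rw [ENNReal.tsum_prod (f := fun p q : CubeIdx d × Eta d =>
      ENNReal.ofReal (‖inner 𝕜 (wav ψ ω p) f‖ ^ 2) * w p.1 q.1 q.1)]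
    calc _ ≤ ∑' p, ENNReal.ofReal (‖inner 𝕜 (wav ψ ω p) f‖ ^ 2) * Θ :=
          ENNReal.tsum_le_tsum fun p => by
            rw [ENNReal.tsum_mul_left]; exact mul_le_mul' le_rfl (hsum1 p)
      _ ≤ _ := by
          rw [ENNReal.tsum_mul_right, mul_comm]
          exact mul_le_mul' le_rfl (Orthonormal.tsum_ofReal_inner_sq_le ho f)
  · rw [ENNReal.tsum_prod (f := fun p q : CubeIdx d × Eta d =>
      ENNReal.ofReal (‖inner 𝕜 (wav ψ ω q) g‖ ^ 2) * w p.1 q.1 p.1), ENNReal.tsum_comm]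
    calc _ ≤ ∑' q, ENNReal.ofReal (‖inner 𝕜 (wav ψ ω q) g‖ ^ 2) * Θ :=
          ENNReal.tsum_le_tsum fun p => by
            rw [ENNReal.tsum_mul_left]; exact mul_le_mul' le_rfl (hsum2 p)
      _ ≤ _ := by
          rw [ENNReal.tsum_mul_right, mul_comm]
          exact mul_le_mul' le_rfl (Orthonormal.tsum_ofReal_inner_sq_le ho g)

end GoodPairs

/-! ## Measurability -/

section Measurability

variable {𝕜 : Type*} [RCLike 𝕜] {d : ℕ}

theorem measurable_of_hasSum {ι Ω : Type*} [Countable ι] [MeasurableSpace Ω] {F : ι → Ω → 𝕜}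
    {G : Ω → 𝕜} (hF : ∀ i, Measurable (F i)) (h : ∀ ω, HasSum (fun i => F i ω) (G ω)) :
    Measurable G := by
  refine measurable_of_tendsto_metrizable' (Filter.atTop : Filter (Finset ι))
    (fun s => Finset.measurable_fun_sum s fun i _ => hF i) (tendsto_pi_nhds.2 fun ω => ?_)
  have := h ω
  simpa only [HasSum, SummationFilter.unconditional_filter] using this

variable {ψ : Eta d → Pt d → 𝕜} {m C : ℝ} {s v : ℕ}

theorem IsWaveletSystem.continuous {ω : Omega d} (hW : IsWaveletSystem ψ ω m s v C) (hs : 0 < s)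
    (Q : CubeIdx d) (η : Eta d) : Continuous (wavelet ψ ω Q η) := by
  refine continuous_iff_continuousAt.2 fun x => ?_
  have h := (hW.differentiable Q η 0 hs x (Set.mem_univ x)).continuousAt
  have h2 : wavelet ψ ω Q η = fun x => iteratedFDeriv ℝ 0 (wavelet ψ ω Q η) x 0 := by
    funext x; simp
  rw [h2]
  exact (ContinuousMultilinearMap.apply ℝ (fun _ : Fin 0 => Pt d) 𝕜 0).continuous.continuousAt.comp h

theorem continuous_mother (hW : IsWaveletSystem ψ 0 m s v C) (hs : 0 < s) (η : Eta d) :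
    Continuous (ψ η) := by
  have h : ψ η = wavelet ψ 0 (0, 0) η := by
    funext x
    have ht : translation (0 : Omega d) 0 = 0 := by
      funext i; simp [translation]
    simp [wavelet, ht]
  rw [h]
  exact hW.continuous hs _ η

/-- The mother wavelets are continuous, so `ψ_I(x)` is jointly measurable in `(ω, x)`, and
integrating out `x` preserves measurability in `ω`. -/
theorem measurable_inner_wav (hW : ∀ ω, IsWaveletSystem ψ ω m s v C) (hs : 0 < s)
    (p : CubeIdx d × Eta d) (f : L2 𝕜 d) : Measurable fun ω => inner 𝕜 f (wav ψ ω p) := by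
  have h1 : ∀ ω, inner 𝕜 f (wav ψ ω p) = ∫ x, conj (f x) * wavelet ψ ω p.1 p.2 x := fun ω =>
    inner_toL2_right ((hW ω).memLp p.1 p.2) f
  simp_rw [h1]
  have hψ : Measurable (ψ p.2) := (continuous_mother (hW 0) hs p.2).measurable
  have hm : Measurable fun z : Omega d × Pt d => conj (f z.2) * wavelet ψ z.1 p.1 p.2 z.2 := by
    refine Measurable.mul ?_ ?_
    · exact RCLike.continuous_conj.measurable.comp
        ((Lp.stronglyMeasurable f).measurable.comp measurable_snd)
    · refine measurable_const.mul (hψ.comp (measurable_pi_lambda _ fun i => ?_))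
      have ht : Measurable fun z : Omega d × Pt d => translation z.1 p.1.1 i :=
        (measurable_pi_apply i).comp
          ((continuous_translation p.1.1).measurable.comp measurable_fst)
      have hx : Measurable fun z : Omega d × Pt d => z.2 i :=
        (measurable_pi_apply i).comp measurable_snd
      exact ((hx.sub ht).const_mul _).sub_const _
  exact (hm.stronglyMeasurable.integral_prod_right (ν := (volume : Measure (Pt d)))).measurable

/-- The wavelets as a Hilbert basis. -/
noncomputable def waveletBasis {ω : Omega d} (hW : IsWaveletSystem ψ ω m s v C) :
    HilbertBasis (CubeIdx d × Eta d) 𝕜 (L2 𝕜 d) :=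
  HilbertBasis.mk hW.orthonormal hW.complete.ge

theorem coe_waveletBasis {ω : Omega d} (hW : IsWaveletSystem ψ ω m s v C)
    (p : CubeIdx d × Eta d) : waveletBasis hW p = wav ψ ω p := by
  rw [waveletBasis, HilbertBasis.coe_mk]
  rfl

theorem hasSum_inner_wav {ω : Omega d} (hW : IsWaveletSystem ψ ω m s v C) (f g : L2 𝕜 d) :
    HasSum (fun p => inner 𝕜 f (wav ψ ω p) * inner 𝕜 (wav ψ ω p) g) (inner 𝕜 f g) := by
  simpa only [coe_waveletBasis] using (waveletBasis hW).hasSum_inner_mul_inner f g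

theorem measurable_inner_wav' (hW : ∀ ω, IsWaveletSystem ψ ω m s v C) (hs : 0 < s)
    (p : CubeIdx d × Eta d) (f : L2 𝕜 d) : Measurable fun ω => inner 𝕜 (wav ψ ω p) f := by
  have h : ∀ ω, inner 𝕜 (wav ψ ω p) f = conj (inner 𝕜 f (wav ψ ω p)) := fun ω =>
    (inner_conj_symm _ _).symm
  simp_rw [h]
  exact RCLike.continuous_conj.measurable.comp (measurable_inner_wav hW hs p f)

/-- Both vectors depend on `ω`. Expanding in the fixed basis of the parameter `0` leaves a countable
sum of products in which `ω` enters one factor of each inner product. -/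
theorem measurable_matrix_entry (hW : ∀ ω, IsWaveletSystem ψ ω m s v C) (hs : 0 < s)
    (T : L2 𝕜 d →L[𝕜] L2 𝕜 d) (p q : CubeIdx d × Eta d) :
    Measurable fun ω => inner 𝕜 (wav ψ ω q) (T (wav ψ ω p)) := by
  refine measurable_of_hasSum (fun e => ?_) fun ω =>
    hasSum_inner_wav (hW 0) (wav ψ ω q) (T (wav ψ ω p))
  refine (measurable_inner_wav' hW hs q _).mul ?_
  simp_rw [← ContinuousLinearMap.adjoint_inner_left T]
  exact measurable_inner_wav hW hs p _

theorem measurable_entryTerm (hW : ∀ ω, IsWaveletSystem ψ ω m s v C) (hs : 0 < s)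
    (T : L2 𝕜 d →L[𝕜] L2 𝕜 d) (f g : L2 𝕜 d)
    (x : (CubeIdx d × Eta d) × (CubeIdx d × Eta d)) :
    Measurable fun ω => entryTerm ψ ω (fun p q => inner 𝕜 (wav ψ ω q) (T (wav ψ ω p))) f g x :=
  ((measurable_inner_wav hW hs _ g).mul (measurable_matrix_entry hW hs T _ _)).mul
    (measurable_inner_wav' hW hs _ f)

end Measurability

/-! ## The representation -/

section Representation

variable {𝕜 : Type*} [RCLike 𝕜] {d : ℕ}

/-- The matrix of `T` with respect to the wavelets. -/
noncomputable def waveletMatrix (ψ : Eta d → Pt d → 𝕜) (T : L2 𝕜 d →L[𝕜] L2 𝕜 d) (ω : Omega d)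
    (p q : CubeIdx d × Eta d) : 𝕜 :=
  inner 𝕜 (wav ψ ω q) (T (wav ψ ω p))

variable {ψ : Eta d → Pt d → 𝕜} {m C : ℝ} {s v : ℕ}

theorem norm_entryTerm_le {ω : Omega d} (hW : IsWaveletSystem ψ ω m s v C)
    (T : L2 𝕜 d →L[𝕜] L2 𝕜 d) (f g : L2 𝕜 d)
    (x : (CubeIdx d × Eta d) × (CubeIdx d × Eta d)) :
    ‖entryTerm ψ ω (waveletMatrix ψ T ω) f g x‖ ≤ ‖g‖ * ‖T‖ * ‖f‖ := by
  have h1 : ∀ p, ‖wav ψ ω p‖ = 1 := fun p => hW.orthonormal.1 p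
  have hTx : ‖T (wav ψ ω x.1)‖ ≤ ‖T‖ := by
    simpa [h1] using T.le_opNorm (wav ψ ω x.1)
  rw [entryTerm, norm_mul, norm_mul]
  gcongr
  · simpa [h1] using norm_inner_le_norm (𝕜 := 𝕜) g (wav ψ ω x.2)
  · refine (norm_inner_le_norm _ _).trans ?_
    rwa [h1, one_mul]
  · simpa [h1] using norm_inner_le_norm (𝕜 := 𝕜) (wav ψ ω x.1) f

/-- Parseval's identity is used once in each index. Summability over pairs is assumed because it is
what permits the iterated summation. -/
theorem tsum_entryTerm {ω : Omega d} (hW : IsWaveletSystem ψ ω m s v C)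
    (T : L2 𝕜 d →L[𝕜] L2 𝕜 d) (f g : L2 𝕜 d)
    (hs : Summable fun x => entryTerm ψ ω (waveletMatrix ψ T ω) f g x) :
    ∑' x, entryTerm ψ ω (waveletMatrix ψ T ω) f g x = inner 𝕜 g (T f) := by
  rw [hs.tsum_prod]
  have h1 : ∀ p, ∑' q, entryTerm ψ ω (waveletMatrix ψ T ω) f g (p, q) =
      inner 𝕜 (ContinuousLinearMap.adjoint T g) (wav ψ ω p) * inner 𝕜 (wav ψ ω p) f := fun p => by
    simp only [entryTerm, waveletMatrix]
    rw [tsum_mul_right, (hasSum_inner_wav hW g (T (wav ψ ω p))).tsum_eq,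
      ContinuousLinearMap.adjoint_inner_left]
  simp_rw [h1]
  rw [(hasSum_inner_wav hW _ f).tsum_eq, ContinuousLinearMap.adjoint_inner_left]

section Expectation

variable {T : L2 𝕜 d →L[𝕜] L2 𝕜 d} {f g : L2 𝕜 d}

theorem integrable_entryTerm (hW : ∀ ω, IsWaveletSystem ψ ω m s v C) (hs : 0 < s)
    (T : L2 𝕜 d →L[𝕜] L2 𝕜 d) (f g : L2 𝕜 d)
    (x : (CubeIdx d × Eta d) × (CubeIdx d × Eta d)) :
    Integrable (fun ω => entryTerm ψ ω (waveletMatrix ψ T ω) f g x) (omegaMeasure d) :=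
  Integrable.of_bound (measurable_entryTerm hW hs T f g x).aestronglyMeasurable _
    (Filter.Eventually.of_forall fun ω => norm_entryTerm_le (hW ω) T f g x)

theorem entryTerm_flipAt (hm : 1 ≤ m) (x : (CubeIdx d × Eta d) × (CubeIdx d × Eta d))
    (e : Fin d → Fin 2) (ω : Omega d) :
    entryTerm ψ (flipAt (ancLevel m x.1.1 x.2.1 + 1) e ω)
        (waveletMatrix ψ T (flipAt (ancLevel m x.1.1 x.2.1 + 1) e ω)) f g x =
      entryTerm ψ ω (waveletMatrix ψ T ω) f g x := by
  simp only [entryTerm, waveletMatrix, wav, wavelet_flipAt (ancLevel_lt_left hm x.1.1 x.2.1),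
    wavelet_flipAt (ancLevel_lt_right hm x.1.1 x.2.1)]

theorem measurable_pairGood (m : ℝ) (P Q : CubeIdx d) : Measurable (pairGood (d := d) m P Q) :=
  measurable_goodInd _ (measurable_corner Q)

theorem integral_entryTerm (hm : 1 ≤ m) (hW : ∀ ω, IsWaveletSystem ψ ω m s v C) (hs : 0 < s)
    (T : L2 𝕜 d →L[𝕜] L2 𝕜 d) (f g : L2 𝕜 d)
    (x : (CubeIdx d × Eta d) × (CubeIdx d × Eta d)) :
    ∫ ω, entryTerm ψ ω (waveletMatrix ψ T ω) f g x ∂omegaMeasure d =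
      2 ^ d * ∫ ω, ((pairGood m x.1.1 x.2.1 ω : ℝ) : 𝕜) *
        entryTerm ψ ω (waveletMatrix ψ T ω) f g x ∂omegaMeasure d :=
  integral_goodInd_mul _ (measurable_corner x.2.1)
    (fun e ω => corner_flipAt (ancLevel_lt_right hm _ _) e ω)
    (integrable_entryTerm hW hs T f g x) (fun e ω => entryTerm_flipAt hm x e ω)

/-- The averaging trick for absolute values transfers absolute summability in expectation from the
good pairs to all pairs, for which no direct bound is at hand. -/
theorem integral_norm_entryTerm (hm : 1 ≤ m) (hW : ∀ ω, IsWaveletSystem ψ ω m s v C) (hs : 0 < s)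
    (T : L2 𝕜 d →L[𝕜] L2 𝕜 d) (f g : L2 𝕜 d)
    (x : (CubeIdx d × Eta d) × (CubeIdx d × Eta d)) :
    ∫ ω, ‖entryTerm ψ ω (waveletMatrix ψ T ω) f g x‖ ∂omegaMeasure d =
      2 ^ d * ∫ ω, ‖((pairGood m x.1.1 x.2.1 ω : ℝ) : 𝕜) *
        entryTerm ψ ω (waveletMatrix ψ T ω) f g x‖ ∂omegaMeasure d := by
  have := integral_goodInd_mul (𝕜 := ℝ) (ancLevel m x.1.1 x.2.1) (measurable_corner x.2.1)
    (fun e ω => corner_flipAt (ancLevel_lt_right hm _ _) e ω)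
    (integrable_entryTerm hW hs T f g x).norm
    (fun e ω => by rw [entryTerm_flipAt hm x e ω])
  rw [this]
  congr 1
  refine integral_congr_ae (Filter.Eventually.of_forall fun ω => ?_)
  simp only
  rw [norm_mul]
  congr 1
  rcases goodInd_eq_zero_or_one (ancLevel m x.1.1 x.2.1) (corner ω x.2.1) ω with h | h <;>
    simp [pairGood, h]

theorem integrable_good_entryTerm (hW : ∀ ω, IsWaveletSystem ψ ω m s v C) (hs : 0 < s)
    (T : L2 𝕜 d →L[𝕜] L2 𝕜 d) (f g : L2 𝕜 d)
    (x : (CubeIdx d × Eta d) × (CubeIdx d × Eta d)) :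
    Integrable (fun ω => ((pairGood m x.1.1 x.2.1 ω : ℝ) : 𝕜) *
      entryTerm ψ ω (waveletMatrix ψ T ω) f g x) (omegaMeasure d) :=
  (integrable_entryTerm hW hs T f g x).bdd_mul (c := 1)
    (RCLike.measurable_ofReal.comp (measurable_pairGood m _ _)).aestronglyMeasurable
    (Filter.Eventually.of_forall fun ω => by
      rcases goodInd_eq_zero_or_one (ancLevel m x.1.1 x.2.1) (corner ω x.2.1) ω with h | h <;>
        simp [pairGood, h])

/-- If the sums over the good pairs are bounded, then `⟨g, T f⟩` is `2^d` times their
expectation. -/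
theorem inner_eq_integral_tsum_good (hm : 1 ≤ m) (hW : ∀ ω, IsWaveletSystem ψ ω m s v C)
    (hs : 0 < s) (T : L2 𝕜 d →L[𝕜] L2 𝕜 d) (f g : L2 𝕜 d) {R : ENNReal} (hR : R ≠ ⊤)
    (hb : ∀ ω, ∑' x, ‖((pairGood m x.1.1 x.2.1 ω : ℝ) : 𝕜) *
      entryTerm ψ ω (waveletMatrix ψ T ω) f g x‖ₑ ≤ R) :
    (∀ ω, Summable fun x => ((pairGood m x.1.1 x.2.1 ω : ℝ) : 𝕜) *
      entryTerm ψ ω (waveletMatrix ψ T ω) f g x) ∧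
    Integrable (fun ω => ∑' x, ((pairGood m x.1.1 x.2.1 ω : ℝ) : 𝕜) *
      entryTerm ψ ω (waveletMatrix ψ T ω) f g x) (omegaMeasure d) ∧
    inner 𝕜 g (T f) = 2 ^ d * ∫ ω, ∑' x, ((pairGood m x.1.1 x.2.1 ω : ℝ) : 𝕜) *
      entryTerm ψ ω (waveletMatrix ψ T ω) f g x ∂omegaMeasure d := by
  have hXi := integrable_entryTerm hW hs T f g
  have hYi := integrable_good_entryTerm hW hs T f g
  set X : (CubeIdx d × Eta d) × (CubeIdx d × Eta d) → Omega d → 𝕜 :=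
    fun x ω => entryTerm ψ ω (waveletMatrix ψ T ω) f g x
  set Y : (CubeIdx d × Eta d) × (CubeIdx d × Eta d) → Omega d → 𝕜 :=
    fun x ω => ((pairGood m x.1.1 x.2.1 ω : ℝ) : 𝕜) * X x ω
  have hXY : ∀ x, ∫ ω, ‖X x ω‖ ∂omegaMeasure d = 2 ^ d * ∫ ω, ‖Y x ω‖ ∂omegaMeasure d :=
    integral_norm_entryTerm hm hW hs T f g
  have hsumm : ∀ ω, Summable fun x => ‖Y x ω‖ := fun ω => by
    have : ∑' x, ‖Y x ω‖ₑ ≠ ⊤ := ne_top_of_le_ne_top hR (hb ω)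
    simpa using ENNReal.summable_toReal this
  have hYsum : Summable fun x => ∫ ω, ‖Y x ω‖ ∂omegaMeasure d := by
    have h1 : ∑' x, ∫⁻ ω, ‖Y x ω‖ₑ ∂omegaMeasure d ≠ ⊤ := by
      rw [← lintegral_tsum fun x => (hYi x).aestronglyMeasurable.enorm]
      refine ne_top_of_le_ne_top hR ((lintegral_mono hb).trans (le_of_eq ?_))
      simp
    refine (ENNReal.summable_toReal h1).congr fun x => ?_
    rw [integral_norm_eq_lintegral_enorm (hYi x).aestronglyMeasurable]
  have hXsum : Summable fun x => ∫ ω, ‖X x ω‖ ∂omegaMeasure d := by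
    simp_rw [hXY]
    exact hYsum.mul_left _
  -- The full series is only known to converge absolutely for almost every `ω`; that is enough,
  -- since `⟨g, T f⟩` does not depend on `ω`.
  have hae : ∀ᵐ ω ∂omegaMeasure d, ∑' x, X x ω = inner 𝕜 g (T f) := by
    have h1 : ∫⁻ ω, ∑' x, ‖X x ω‖ₑ ∂omegaMeasure d ≠ ⊤ := by
      rw [lintegral_tsum fun x => (hXi x).aestronglyMeasurable.enorm]
      have h2 : ∀ x, ∫⁻ ω, ‖X x ω‖ₑ ∂omegaMeasure d =
          ENNReal.ofReal (∫ ω, ‖X x ω‖ ∂omegaMeasure d) := fun x =>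
        (ofReal_integral_norm_eq_lintegral_enorm (hXi x)).symm
      rw [tsum_congr h2, ← ENNReal.ofReal_tsum_of_nonneg (fun x => integral_nonneg fun ω => norm_nonneg _) hXsum]
      exact ENNReal.ofReal_ne_top
    have h3 : AEMeasurable (fun ω => ∑' x, ‖X x ω‖ₑ) (omegaMeasure d) :=
      AEMeasurable.tsum fun x => (hXi x).aestronglyMeasurable.enorm
    filter_upwards [ae_lt_top' h3 h1] with ω hω
    refine tsum_entryTerm (hW ω) T f g (Summable.of_norm ?_)
    simpa using ENNReal.summable_toReal hω.ne
  have hX := hasSum_integral_of_summable_integral_norm hXi hXsum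
  have hY := hasSum_integral_of_summable_integral_norm hYi hYsum
  refine ⟨fun ω => (hsumm ω).of_norm, ?_, ?_⟩
  · have hmeas : Measurable fun ω => ∑' x, Y x ω := by
      refine measurable_of_hasSum (fun x => ?_) fun ω => (hsumm ω).of_norm.hasSum
      exact (RCLike.measurable_ofReal.comp (measurable_pairGood m _ _)).mul
        (measurable_entryTerm hW hs T f g x)
    refine Integrable.of_bound hmeas.aestronglyMeasurable R.toReal
      (Filter.Eventually.of_forall fun ω => ?_)
    refine (norm_tsum_le_tsum_norm (hsumm ω)).trans ?_
    have h1 := ENNReal.toReal_mono hR (hb ω)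
    rw [ENNReal.tsum_toReal_eq fun x => enorm_ne_top] at h1
    simpa only [toReal_enorm] using h1
  · rw [← hY.tsum_eq, ← tsum_mul_left]
    have h2 : ∫ ω, ∑' x, X x ω ∂omegaMeasure d = inner 𝕜 g (T f) := by
      rw [integral_congr_ae hae]
      simp
    rw [← h2, ← hX.tsum_eq]
    exact tsum_congr fun x => integral_entryTerm hm hW hs T f g x

end Expectation

/-- The coefficients of the shifts. -/
noncomputable def shiftCoeff (m : ℝ) (ω : Omega d) (A : ℝ)
    (M : CubeIdx d × Eta d → CubeIdx d × Eta d → 𝕜) (p q : CubeIdx d × Eta d) (K : CubeIdx d) : 𝕜 :=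
  open Classical in
  -- A pair may lie below many cubes; assigning it to its designated ancestor alone ensures that it
  -- is counted once. The factor `A⁻¹` normalises the entry to the bound required of a shift.
  if K = commonAnc m ω p.1 q.1 ∧ pairGood m p.1 q.1 ω ≠ 0 then ((A⁻¹ : ℝ) : 𝕜) * M p q else 0

/-- For generations `i` and `j` the smaller side is `2^{-max(i,j)} ℓ(K)`, so the decay factor of the
entry depends on `max(i, j)` only and is absorbed by `A`. -/
theorem norm_shiftCoeff_le {ω : Omega d} {σ N A : ℝ} (hA : 0 < A)
    {M : CubeIdx d × Eta d → CubeIdx d × Eta d → 𝕜} (hM : EntryBound m σ N M) {i j : ℕ}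
    (hσ : N * (((2 : ℝ) ^ max i j)⁻¹) ^ σ ≤ A) {K : CubeIdx d} {p q : CubeIdx d × Eta d}
    (hp : p.1 ∈ descendants ω i K) (hq : q.1 ∈ descendants ω j K) :
    ‖shiftCoeff m ω A M p q K‖ ≤ √(vol p.1 * vol q.1) / vol K := by
  have hvK := vol_pos K
  unfold shiftCoeff
  split_ifs with h
  · have hMpq := hM p q
    rw [← side_commonAnc m ω p.1 q.1, ← h.1] at hMpq
    have hK := side_pos K
    have hmin : min (side p.1) (side q.1) / side K = ((2 : ℝ) ^ max i j)⁻¹ := by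
      have haL : side p.1 / side K = ((2 : ℝ) ^ i)⁻¹ := by
        rw [side_of_mem_descendants hp]; have := side_pos p.1; field_simp
      have hbL : side q.1 / side K = ((2 : ℝ) ^ j)⁻¹ := by
        rw [side_of_mem_descendants hq]; have := side_pos q.1; field_simp
      rw [← min_div_div_right hK.le, haL, hbL]
      rcases le_total i j with hij | hij
      · rw [max_eq_right hij, min_eq_right]
        gcongr
        norm_num
      · rw [max_eq_left hij, min_eq_left]
        gcongr
        norm_num
    rw [hmin] at hMpq
    rw [norm_mul, RCLike.norm_ofReal, abs_of_pos (inv_pos.2 hA), inv_mul_le_iff₀ hA]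
    refine hMpq.trans ?_
    rw [← mul_assoc]
    exact mul_le_mul_of_nonneg_right hσ (by positivity)
  · rw [norm_zero]
    positivity

theorem sqrt_vol_mul_div_le_one {ω : Omega d} {i j : ℕ} {I J K : CubeIdx d}
    (hI : I ∈ descendants ω i K) (hJ : J ∈ descendants ω j K) :
    √(vol I * vol J) / vol K ≤ 1 := by
  have hK := vol_pos K
  have hle : ∀ {n : ℕ} {Q : CubeIdx d}, Q ∈ descendants ω n K → vol Q ≤ vol K := fun {n Q} h => by
    rw [vol_of_mem_descendants h]
    exact le_mul_of_one_le_left (vol_pos Q).le (one_le_pow₀ (one_le_pow₀ (by norm_num)))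
  rw [div_le_one hK, Real.sqrt_le_left hK.le, sq]
  exact mul_le_mul (hle hI) (hle hJ) (vol_pos J).le hK.le

theorem exists_isGoodWaveletShift (hm : 1 ≤ m) {ω : Omega d} (ho : Orthonormal 𝕜 (wav ψ ω))
    {σ N A : ℝ} (hA : 0 < A)
    {M : CubeIdx d × Eta d → CubeIdx d × Eta d → 𝕜} (hM : EntryBound m σ N M) {i j : ℕ}
    (hσ : N * (((2 : ℝ) ^ max i j)⁻¹) ^ σ ≤ A) :
    ∃ S : L2 𝕜 d →L[𝕜] L2 𝕜 d, IsGoodWaveletShift ψ m ω i j S ∧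
      ∀ f, HasSum (fun K => blockOp ψ ω i j (shiftCoeff m ω A M) K f) (S f) := by
  have hle := fun K p (hp : p ∈ desc ω i K) q (hq : q ∈ desc ω j K) =>
    norm_shiftCoeff_le hA hM hσ (mem_desc.1 hp) (mem_desc.1 hq)
  obtain ⟨S, hS⟩ := exists_hasSum_blockOp ho fun K p hp q hq =>
    (hle K p hp q hq).trans (sqrt_vol_mul_div_le_one (mem_desc.1 hp) (mem_desc.1 hq))
  refine ⟨S, ⟨_, fun K I hI J hJ η ζ => ⟨hle K (I, η) (mem_desc.2 hI) (J, ζ) (mem_desc.2 hJ),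
    fun hne => ?_⟩, hS⟩, hS⟩
  unfold shiftCoeff at hne
  split_ifs at hne with h
  · rw [h.1]
    exact dilatedCube_subset_commonAnc hm h.2
  · exact absurd rfl hne

theorem inner_blockOp (ω : Omega d) (i j : ℕ)
    (a : CubeIdx d × Eta d → CubeIdx d × Eta d → CubeIdx d → 𝕜) (K : CubeIdx d) (f g : L2 𝕜 d) :
    inner 𝕜 g (blockOp ψ ω i j a K f) = ∑ x ∈ desc ω i K ×ˢ desc ω j K,
      a x.1 x.2 K * inner 𝕜 (wav ψ ω x.1) f * inner 𝕜 g (wav ψ ω x.2) := by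
  rw [blockOp_eq, Finset.sum_product]
  simp only [inner_sum, inner_smul_right]

theorem genLeft_pos (hm : 1 ≤ m) (P Q : CubeIdx d) : 0 < genLeft m P Q := by
  have := ancLevel_lt_left hm P Q
  unfold genLeft
  omega

theorem genRight_pos (hm : 1 ≤ m) (P Q : CubeIdx d) : 0 < genRight m P Q := by
  have := ancLevel_lt_right hm P Q
  unfold genRight
  omega

theorem genLeft_eq {ω : Omega d} {i : ℕ} {P Q : CubeIdx d}
    (h : P ∈ descendants ω i (commonAnc m ω P Q)) : genLeft m P Q = i := by
  have h1 : P.1 = ancLevel m P Q + i := (mem_descendants.1 h).2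
  unfold genLeft
  omega

theorem genRight_eq {ω : Omega d} {j : ℕ} {P Q : CubeIdx d}
    (h : Q ∈ descendants ω j (commonAnc m ω P Q)) : genRight m P Q = j := by
  have h1 : Q.1 = ancLevel m P Q + j := (mem_descendants.1 h).2
  unfold genRight
  omega

/-- The type of a pair: its generations below the common ancestor, and the common ancestor. -/
noncomputable def pairType (hm : 1 ≤ m) (ω : Omega d)
    (x : (CubeIdx d × Eta d) × (CubeIdx d × Eta d)) : (ℕ+ × ℕ+) × CubeIdx d :=
  ((⟨genLeft m x.1.1 x.2.1, genLeft_pos hm _ _⟩, ⟨genRight m x.1.1 x.2.1, genRight_pos hm _ _⟩),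
    commonAnc m ω x.1.1 x.2.1)

/-- The sum over the good pairs is a sum of shifts. -/
theorem hasSum_shifts (hm : 1 ≤ m) {ω : Omega d} {A : ℕ+ × ℕ+ → ℝ} (hA : ∀ c, 0 < A c)
    {M : CubeIdx d × Eta d → CubeIdx d × Eta d → 𝕜} {S : ℕ+ × ℕ+ → L2 𝕜 d →L[𝕜] L2 𝕜 d}
    (hS : ∀ c f, HasSum (fun K => blockOp ψ ω c.1 c.2 (shiftCoeff m ω (A c) M) K f) (S c f))
    (f g : L2 𝕜 d)
    (hs : Summable fun x => ((pairGood m x.1.1 x.2.1 ω : ℝ) : 𝕜) * entryTerm ψ ω M f g x) :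
    HasSum (fun c : ℕ+ × ℕ+ => ((A c : ℝ) : 𝕜) * inner 𝕜 g (S c f))
      (∑' x, ((pairGood m x.1.1 x.2.1 ω : ℝ) : 𝕜) * entryTerm ψ ω M f g x) := by
  classical
  -- Every pair has exactly one type `(i, j, K)`, and the good terms of a given type make up one
  -- block of one shift.
  have h1 := hs.hasSum.tsum_fiberwise (pairType hm ω)
  have h2 : ∀ c : (ℕ+ × ℕ+) × CubeIdx d, ∑' x : pairType hm ω ⁻¹' {c},
      ((pairGood m x.1.1.1 x.1.2.1 ω : ℝ) : 𝕜) * entryTerm ψ ω M f g x.1 =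
      ((A c.1 : ℝ) : 𝕜) *
        inner 𝕜 g (blockOp ψ ω c.1.1 c.1.2 (shiftCoeff m ω (A c.1) M) c.2 f) := by
    rintro ⟨⟨i, j⟩, K⟩
    rw [tsum_subtype (pairType hm ω ⁻¹' {((i, j), K)}) (fun x =>
      ((pairGood m x.1.1 x.2.1 ω : ℝ) : 𝕜) * entryTerm ψ ω M f g x),
      tsum_eq_sum (s := desc ω i K ×ˢ desc ω j K), inner_blockOp, Finset.mul_sum]
    · refine Finset.sum_congr rfl fun x hx => ?_
      obtain ⟨hp, hq⟩ := Finset.mem_product.1 hx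
      have hp := mem_desc.1 hp
      have hq := mem_desc.1 hq
      by_cases hK : K = commonAnc m ω x.1.1 x.2.1
      · subst hK
        have hmem : x ∈ pairType hm ω ⁻¹' {((i, j), commonAnc m ω x.1.1 x.2.1)} := by
          simp only [Set.mem_preimage, Set.mem_singleton_iff, pairType, Prod.mk.injEq, and_true]
          exact Prod.ext (PNat.eq (genLeft_eq hp)) (PNat.eq (genRight_eq hq))
        rw [Set.indicator_of_mem hmem]
        rcases goodInd_eq_zero_or_one (ancLevel m x.1.1 x.2.1) (corner ω x.2.1) ω with hG | hG
        · simp [shiftCoeff, pairGood, hG]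
        · have hA0 : ((A (i, j) : ℝ) : 𝕜) ≠ 0 := by exact_mod_cast (hA (i, j)).ne'
          simp only [shiftCoeff, pairGood, hG, RCLike.ofReal_one, one_mul, ne_eq, one_ne_zero,
            not_false_eq_true, and_true, if_true, entryTerm, RCLike.ofReal_inv]
          field_simp
      · rw [Set.indicator_of_notMem fun hmem => hK ?_]
        · simp [shiftCoeff, hK]
        · simp only [Set.mem_preimage, Set.mem_singleton_iff, pairType, Prod.mk.injEq] at hmem
          exact hmem.2.symm
    -- A pair of this type that does not lie below `K` cannot be good, so its term vanishes.
    · intro x hx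
      refine Set.indicator_apply_eq_zero.2 fun hmem => ?_
      simp only [Set.mem_preimage, Set.mem_singleton_iff, pairType, Prod.mk.injEq] at hmem
      obtain ⟨⟨rfl, rfl⟩, rfl⟩ := hmem
      by_cases hG : pairGood m x.1.1 x.2.1 ω = 0
      · simp [hG]
      · obtain ⟨h3, h4⟩ := mem_descendants_commonAnc hm hG
        exact absurd (Finset.mem_product.2 ⟨mem_desc.2 h3, mem_desc.2 h4⟩) hx
  simp_rw [h2] at h1
  refine h1.prod_fiberwise fun c => ?_
  exact (((hS c f).mapL (innerSL 𝕜 g)).mul_left _)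

end Representation

end DyadicWavelet

/-! ### Assembly of the representation theorem. -/

theorem theorem3p1 {𝕜 : Type*} [RCLike 𝕜] (d s : ℕ) (hd : 0 < d) (hs : 0 < s)
    (ε : ℝ) (hε : 0 < ε) (m C : ℝ) (hm : 1 ≤ m) :
    ∃ c : ℝ, 0 < c ∧
      ∀ ψ : Eta d → Pt d → 𝕜, (∀ ω : Omega d, IsWaveletSystem ψ ω m s (s - 1) C) →
      ∀ (T : L2 𝕜 d →L[𝕜] L2 𝕜 d) (K : Pt d → Pt d → 𝕜),
        IsCZKernel s K → HasKernel T K →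
        MapsPolynomials s T → MapsPolynomials s (ContinuousLinearMap.adjoint T) →
      ∃ S : ℕ+ → ℕ+ → Omega d → (L2 𝕜 d →L[𝕜] L2 𝕜 d),
        (∀ (i j : ℕ+) (ω : Omega d), IsGoodWaveletShift ψ m ω i j (S i j ω)) ∧
        ∀ f g : Pt d → 𝕜, IsC1c f → IsC1c g →
          (∀ ω : Omega d, Summable fun p : ℕ+ × ℕ+ =>
            (((2 : ℝ) ^ (-((s : ℝ) - ε) * ((max p.1 p.2 : ℕ+) : ℝ)) : ℝ) : 𝕜) *
              inner 𝕜 (toL2 g) (S p.1 p.2 ω (toL2 f))) ∧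
          Integrable (fun ω : Omega d => ∑' p : ℕ+ × ℕ+,
            (((2 : ℝ) ^ (-((s : ℝ) - ε) * ((max p.1 p.2 : ℕ+) : ℝ)) : ℝ) : 𝕜) *
              inner 𝕜 (toL2 g) (S p.1 p.2 ω (toL2 f))) (omegaMeasure d) ∧
          inner 𝕜 (toL2 g) (T (toL2 f)) =
            ((c * (czNorm s K + ‖T‖) : ℝ) : 𝕜) *
              ∫ ω : Omega d, ∑' p : ℕ+ × ℕ+,
                (((2 : ℝ) ^ (-((s : ℝ) - ε) * ((max p.1 p.2 : ℕ+) : ℝ)) : ℝ) : 𝕜) *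
                  inner 𝕜 (toL2 g) (S p.1 p.2 ω (toL2 f)) ∂(omegaMeasure d) := by

  -- The cap keeps `s - δ` positive, for the Schur test, and `δ ≤ 1`, for the Taylor estimate; a
  -- smaller `δ` only improves the decay.
  set δ : ℝ := min ε (1 / 2) with hδ
  have hδ0 : 0 < δ := lt_min hε (by norm_num)
  have hδ1 : δ ≤ 1 / 2 := min_le_right _ _
  have hδε : δ ≤ ε := min_le_left _ _
  have hs1 : (1 : ℝ) ≤ s := by exact_mod_cast hs
  have hσ : 0 < (s : ℝ) - δ := by linarith
  obtain ⟨C₁, hC₁, hC⟩ := exists_norm_inner_le (𝕜 := 𝕜) hd hs hm C hδ0 (by linarith : δ ≤ 1)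
  obtain ⟨Θ, hΘ, hsum⟩ := exists_tsum_pairGood_le 𝕜 d hm hσ
  refine ⟨2 ^ d * C₁, by positivity, fun ψ hW T K hK hT hmT hmT' => ?_⟩
  have ho : ∀ ω, Orthonormal 𝕜 (wav ψ ω) := fun ω => (hW ω).orthonormal
  set N : ℝ := czNorm s K + ‖T‖ with hN
  have hN0 : 0 ≤ N := add_nonneg (czNorm_nonneg s K) (norm_nonneg T)
  have hM : ∀ ω, EntryBound m ((s : ℝ) - δ) (C₁ * N) (waveletMatrix ψ T ω) := fun ω =>
    hC ψ ω (hW ω) T K hK hT hmT hmT'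
  -- a positive substitute for `N`
  obtain ⟨N', hN', hNN', hN'N⟩ : ∃ N' : ℝ, 0 < N' ∧ N ≤ N' ∧ (N ≠ 0 → N' = N) := by
    rcases hN0.eq_or_lt with h | h
    · exact ⟨1, one_pos, by linarith, fun h' => absurd h.symm h'⟩
    · exact ⟨N, h, le_rfl, fun _ => rfl⟩
  set wt : ℕ+ × ℕ+ → ℝ := fun p => (2 : ℝ) ^ (-((s : ℝ) - ε) * ((max p.1 p.2 : ℕ+) : ℝ)) with hwt
  have hwt0 : ∀ p, 0 < wt p := fun p => Real.rpow_pos_of_pos two_pos _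
  -- The normalising constant is the bound for the entries with `s - δ` weakened to `s - ε`, so that
  -- it contains the prescribed weight; `N'` keeps it positive.
  set A : ℕ+ × ℕ+ → ℝ := fun p => C₁ * N' * wt p with hA
  have hA0 : ∀ p, 0 < A p := fun p => mul_pos (mul_pos hC₁ hN') (hwt0 p)
  have hAle : ∀ p : ℕ+ × ℕ+,
      C₁ * N * (((2 : ℝ) ^ max (p.1 : ℕ) (p.2 : ℕ))⁻¹) ^ ((s : ℝ) - δ) ≤ A p := fun p => by
    have hmax : ((max p.1 p.2 : ℕ+) : ℝ) = ((max (p.1 : ℕ) (p.2 : ℕ) : ℕ) : ℝ) := by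
      rcases le_total p.1 p.2 with h | h
      · rw [max_eq_right h, max_eq_right (by exact_mod_cast h)]
      · rw [max_eq_left h, max_eq_left (by exact_mod_cast h)]
    have h1 : (((2 : ℝ) ^ max (p.1 : ℕ) (p.2 : ℕ))⁻¹) ^ ((s : ℝ) - δ) ≤ wt p := by
      simp only [hwt, hmax]
      rw [inv_two_pow_rpow, ← Real.rpow_natCast, ← Real.rpow_mul (by norm_num)]
      refine Real.rpow_le_rpow_of_exponent_le (by norm_num) ?_
      exact mul_le_mul_of_nonneg_right (by linarith) (Nat.cast_nonneg _)
    exact mul_le_mul (by gcongr) h1 (by positivity) (by positivity)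
  choose S hSgood hSsum using fun (p : ℕ+ × ℕ+) (ω : Omega d) =>
    exists_isGoodWaveletShift hm (ho ω) (hA0 p) (hM ω) (hAle p)
  refine ⟨fun i j ω => S (i, j) ω, fun i j ω => hSgood (i, j) ω, fun f g _ _ => ?_⟩
  set F : L2 𝕜 d := toL2 f
  set G : L2 𝕜 d := toL2 g
  obtain ⟨hsm, hint, heq⟩ := inner_eq_integral_tsum_good hm hW hs T F G
    (R := ENNReal.ofReal (C₁ * N) * (Θ * (ENNReal.ofReal (‖F‖ ^ 2) + ENNReal.ofReal (‖G‖ ^ 2))))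
    (ENNReal.mul_ne_top ENNReal.ofReal_ne_top (ENNReal.mul_ne_top hΘ (by simp)))
    fun ω => hsum ψ ω (ho ω) _ _ (mul_nonneg hC₁.le hN0) (hM ω) F G
  have hCN : ((C₁ * N' : ℝ) : 𝕜) ≠ 0 := by exact_mod_cast (mul_pos hC₁ hN').ne'
  have hrep : ∀ ω, HasSum (fun p : ℕ+ × ℕ+ => ((wt p : ℝ) : 𝕜) * inner 𝕜 G (S p ω F))
      (((C₁ * N' : ℝ) : 𝕜)⁻¹ * ∑' x, ((pairGood m x.1.1 x.2.1 ω : ℝ) : 𝕜) *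
        entryTerm ψ ω (waveletMatrix ψ T ω) F G x) := fun ω => by
    have h := (hasSum_shifts hm hA0 (fun c f => hSsum c ω f) F G (hsm ω)).mul_left
      (((C₁ * N' : ℝ) : 𝕜)⁻¹)
    have hA' : ∀ p, ((A p : ℝ) : 𝕜) = ((C₁ * N' : ℝ) : 𝕜) * ((wt p : ℝ) : 𝕜) := fun p => by
      simp only [hA]; push_cast; ring
    simpa only [hA', mul_assoc, inv_mul_cancel_left₀ hCN] using h
  have hval := fun ω => (hrep ω).tsum_eq
  refine ⟨fun ω => (hrep ω).summable, ?_, ?_⟩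
  · simp only [hwt] at hval
    simp_rw [hval]
    exact hint.const_mul _
  · simp only [hwt] at hval
    simp_rw [hval]
    rw [integral_const_mul, heq]
    -- If `N = 0` then `T = 0` and both sides vanish, whatever positive `N'` was used in the
    -- normalisation.
    by_cases hN1 : N = 0
    · have hT0 : T = 0 := by
        have := czNorm_nonneg s K
        have h2 := norm_nonneg T
        exact norm_eq_zero.1 (by linarith)
      rw [hN1, mul_zero, RCLike.ofReal_zero, zero_mul, ← heq, hT0]
      simp
    · rw [hN'N hN1] at hCN ⊢
      rw [show ((2 ^ d * C₁ * N : ℝ) : 𝕜) = 2 ^ d * ((C₁ * N : ℝ) : 𝕜) by push_cast; ring,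
        mul_assoc, mul_inv_cancel_left₀ hCN]
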